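/- Let $\Omega=\{X=(X_1,X_2)\in\mathbb R^2: X_2>0\}$, let $\varepsilon_2>0$, let $\sigma:\mathbb R\to\mathbb R$ be twice differentiable with $|\sigma|+|\sigma'|+|\sigma''|\le C$ on $\mathbb R$ for some constant $C>0$, and let $u_0\in W^{2,\infty}(\overline\Omega)$ (continuous up to $\partial\Omega$) be harmonic in $\Omega$. For $\varepsilon>0$ put $\Omega^\varepsilon=\varepsilon\mathbb Z\times\varepsilon(\mathbb N\setminus\{0\})$, $\partial\Omega^\varepsilon=\varepsilon\mathbb Z\times\{0\}$, $\overline\Omega^\varepsilon=\Omega^\varepsilon\cup\partial\Omega^\varepsilon$. Conditions on a potential $V:\mathbb R\to\mathbb R$: (i) $V\in C^3(\mathbb R)$; (ii) $V(a+1)=V(a)$ for all $a$; (iii) $V=0$ on $\mathbb Z$ and $V>0$ on $\mathbb R\setminus\mathbb Z$. Given $W^\varepsilon:\mathbb R\to\mathbb R$, the rescaled generalized Frenkel–Kontorova system is $$\begin{cases}0=\dfrac1{\varepsilon^2}\displaystyle\sum_{J\in\mathbb Z^2,\,|J|=1}\big(u^\varepsilon(X+\varepsilon J,t)-u^\varepsilon(X,t)\big),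 & (X,t)\in\Omega^\varepsilon\times(0,\infty),\\[2mm] u^\varepsilon_t(X,t)=2\varepsilon_2\sigma(\varepsilon_2X_1)-(W^\varepsilon)'(u^\varepsilon(X,t))+\dfrac1\varepsilon\displaystyle\sum_{J\in\mathbb Z^2,\,|J|=1,\,J_2\ge0}\big(u^\varepsilon(X+\varepsilon J,t)-u^\varepsilon(X,t)\big), & (X,t)\in\partial\Omega^\varepsilon\times(0,\infty),\\[2mm] u^\varepsilon(X,0)=u_0(X), & X\in\partial\Omega^\varepsilon.\end{cases}\tag{FK}$$ A viscosity subsolution of (FK) is a function $u$ on $\overline\Omega^\varepsilon\times[0,\infty)$, upper semicontinuous in $t$, with $u(\cdot,0)\le u_0$ on $\partial\Omega^\varepsilon$, satisfying the first line with $0\le$ in place of $0=$, and such that whenever $X\in\partial\Omega^\varepsilon$, $t>0$, $\varphi\in C^1(\mathbb R)$ and $u(X,\cdot)-\varphi$ has a local maximum at $t$, the second line holds at $(X,t)$ with $\varphi'(t)\le$ in place of $u^\varepsilon_t(X,t)=$. Supersolutions are defined symmetrically (lower semicontinuity, reversed inequalities, local minima). A viscosity solution is a function that is both a sub- and a supersolution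 and is bounded on $\overline\Omega^\varepsilon\times[0,T]$ for every $T>0$. The Peierls–Nabarro system for a potential $W$ is $$\begin{cases}0=\Delta u^0 & \text{on }\Omega\times(0,\infty),\\ u^0_t=2\varepsilon_2\sigma(\varepsilon_2X_1)-W'(u^0)+\dfrac{\partial u^0}{\partial X_2} & \text{on }\partial\Omega\times(0,\infty),\\ u^0(X,0)=u_0(X) & \text{for }X\in\partial\Omega.\end{cases}\tag{PN}$$ A viscosity subsolution of (PN) is an upper semicontinuous function $u$ on $\overline\Omega\times[0,\infty)$ with $u(\cdot,0)\le u_0$ on $\partial\Omega$ such that, whenever $\varphi\in C^2(\mathbb R^2\times\mathbb R)$ and $u-\varphi$ has a local maximum relative to $\overline\Omega\times(0,\infty)$ at $(X,t)$, one has at $(X,t)$: $-\Delta\varphi\le0$ if $X\in\Omega$, and $\min\big(-\Delta\varphi,\ \varphi_t-2\varepsilon_2\sigma(\varepsilon_2X_1)+W'(u)-\partial\varphi/\partial X_2\big)\le0$ if $X\in\partial\Omega$. Supersolutions are defined symmetrically (lower semicontinuity, local minima, $\max\ge0$ in place of $\min\le0$). A viscosity solution is a function that is both and is bounded on $\overline\Omega\times[0,T]$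 for every $T>0$. **Theorem.** (a) Let $\varepsilon>0$ and suppose that $\varepsilon W^\varepsilon$ satisfies (i), (ii), (iii) and, for some $\delta>0$, $\varepsilon W^\varepsilon(a)=\frac12a^2$ for all $|a|<\delta$. Then (FK) has a unique viscosity solution $u^\varepsilon$. (b) Suppose that the hypothesis of (a) holds for all sufficiently small $\varepsilon>0$ (with $\delta$ allowed to depend on $\varepsilon$), that $W$ satisfies (i), (ii), (iii) and $W''(0)>0$, and that $\|W^\varepsilon-W\|_{C^1(\mathbb R)}\to0$ as $\varepsilon\to0$. Then there is a viscosity solution $u^0$ of (PN) such that $u^\varepsilon\to u^0$ locally uniformly as $\varepsilon\to0$, i.e. for every $R>0$ $$\sup\big\{|u^\varepsilon(X,t)-u^0(X,t)|:\ X\in\overline\Omega^\varepsilon,\ |X|\le R,\ 0\le t\le R\big\}\to0 .$$ -/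

import Mathlib

open Set Filter Topology MeasureTheory
open scoped ContDiff

noncomputable section

namespace FKPN

/-- The Euclidean plane, with coordinates `X 0 = X₁` and `X 1 = X₂`. -/
abbrev Plane : Type := EuclideanSpace ℝ (Fin 2)

/-- The open upper half-plane `Ω`. -/
def Omega : Set Plane := {X | 0 < X 1}

/-- The closed upper half-plane. -/
def OmegaBar : Set Plane := {X | 0 ≤ X 1}

/-! ### Assumptions on the potentials and on the stress -/

/-- Regularity, `1`-periodicity, and minimum `0` attained exactly on `ℤ`. -/
structure PeriodicPotential (W : ℝ → ℝ) : Prop where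
  regular : ContDiff ℝ 3 W
  periodic : ∀ a, W (a + 1) = W a
  zero_int : ∀ n : ℤ, W n = 0
  pos : ∀ a, (∀ n : ℤ, a ≠ n) → 0 < W a

/-- A periodic potential that is exactly harmonic near `0`. -/
def LocallyHarmonicPotential (W : ℝ → ℝ) : Prop :=
  PeriodicPotential W ∧ ∃ δ > 0, ∀ a, |a| < δ → W a = a ^ 2 / 2

/-- A periodic potential whose minima are non-degenerate. -/
def NondegeneratePotential (W : ℝ → ℝ) : Prop :=
  PeriodicPotential W ∧ 0 < deriv (deriv W) 0

/-- The stress is twice differentiable and bounded together with its first two derivatives. -/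
def AdmissibleStress (σ : ℝ → ℝ) : Prop :=
  Differentiable ℝ σ ∧ Differentiable ℝ (deriv σ) ∧
    ∃ C > 0, ∀ x, |σ x| + |deriv σ x| + |deriv (deriv σ) x| ≤ C

/-- `‖W^ε - W‖_{C¹(ℝ)} → 0` as `ε → 0⁺`. -/
def TendstoC1 (Weps : ℝ → ℝ → ℝ) (W : ℝ → ℝ) : Prop :=
  TendstoUniformly Weps W (𝓝[>] 0) ∧
    TendstoUniformly (fun ε => deriv (Weps ε)) (deriv W) (𝓝[>] 0)

/-! ### The Sobolev space `W^{2,∞}` of the half-plane -/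

/-- `g` is the weak derivative of `f` on `Ω` in the `k`-th coordinate direction. -/
def IsWeakDeriv (k : Fin 2) (f g : Plane → ℝ) : Prop :=
  ∀ φ : Plane → ℝ, ContDiff ℝ ∞ φ → HasCompactSupport φ → tsupport φ ⊆ Omega →
    ∫ X in Omega, f X * lineDeriv ℝ φ X (EuclideanSpace.single k 1) = -∫ X in Omega, g X * φ X

/-- `f ∈ L^∞(Ω)`. -/
def MemLinf (f : Plane → ℝ) : Prop := MemLp f ⊤ (volume.restrict Omega)

/-- `f ∈ W^{1,∞}(Ω)`. -/
def MemW1inf (f : Plane → ℝ) : Prop :=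
  MemLinf f ∧ ∀ k, ∃ g, MemLinf g ∧ IsWeakDeriv k f g

/-- `f ∈ W^{2,∞}` on the closed half-plane: `f ∈ W^{2,∞}(Ω)`, and `f` is the representative that is
continuous up to the boundary. -/
def MemW2inf (f : Plane → ℝ) : Prop :=
  ContinuousOn f OmegaBar ∧ MemLinf f ∧ ∀ k, ∃ g, MemW1inf g ∧ IsWeakDeriv k f g

/-! ### The rescaled generalized Frenkel-Kontorova system

A function on the rescaled lattice `(ε ℤ) × (ε ℕ)` is written `u i j t`, for its value at the lattice
point `X = (ε i, ε j)` and at time `t`; the boundary of the lattice is `j = 0`. -/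

/-- The lattice point `(ε i, ε j)`. -/
def latticePoint (ε : ℝ) (i : ℤ) (j : ℕ) : Plane := !₂[ε * i, ε * j]

/-- The discrete Laplacian `ε⁻² ∑_{|J| = 1} (u(X + εJ, t) - u(X, t))` at the interior lattice point
`X = (ε i, ε (j + 1))`. -/
def discreteLaplacian (ε : ℝ) (u : ℤ → ℕ → ℝ → ℝ) (i : ℤ) (j : ℕ) (t : ℝ) : ℝ :=
  1 / ε ^ 2 *
    ((u (i + 1) (j + 1) t - u i (j + 1) t) + (u (i - 1) (j + 1) t - u i (j + 1) t) +
      (u i (j + 2) t - u i (j + 1) t) + (u i j t - u i (j + 1) t))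

/-- The operator `I^ε[u] = ε⁻¹ ∑_{|J| = 1, J₂ ≥ 0} (u(X + εJ, t) - u(X, t))` at the boundary lattice
point `X = (ε i, 0)`. -/
def boundaryOperator (ε : ℝ) (u : ℤ → ℕ → ℝ → ℝ) (i : ℤ) (t : ℝ) : ℝ :=
  1 / ε * ((u (i + 1) 0 t - u i 0 t) + (u (i - 1) 0 t - u i 0 t) + (u i 1 t - u i 0 t))

/-- The right-hand side of the evolution equation at the boundary lattice point `X = (ε i, 0)`. -/
def boundaryForce (ε ε₂ : ℝ) (σ Weps : ℝ → ℝ) (u : ℤ → ℕ → ℝ → ℝ) (i : ℤ) (t : ℝ) : ℝ :=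
  2 * ε₂ * σ (ε₂ * (ε * i)) - deriv Weps (u i 0 t) + boundaryOperator ε u i t

/-- Viscosity subsolution of the lattice system with initial data `u₀`. -/
structure IsLatticeSubsolution (ε ε₂ : ℝ) (σ Weps : ℝ → ℝ) (u₀ : Plane → ℝ)
    (u : ℤ → ℕ → ℝ → ℝ) : Prop where
  usc : ∀ i j, UpperSemicontinuousOn (u i j) (Ici 0)
  interior : ∀ i j, ∀ t > 0, 0 ≤ discreteLaplacian ε u i j t
  boundary : ∀ i, ∀ t > 0, ∀ φ : ℝ → ℝ, ContDiff ℝ 1 φ →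
    IsLocalMax (fun s => u i 0 s - φ s) t → deriv φ t ≤ boundaryForce ε ε₂ σ Weps u i t
  initial : ∀ i, u i 0 0 ≤ u₀ (latticePoint ε i 0)

/-- Viscosity supersolution of the lattice system with initial data `u₀`. -/
structure IsLatticeSupersolution (ε ε₂ : ℝ) (σ Weps : ℝ → ℝ) (u₀ : Plane → ℝ)
    (u : ℤ → ℕ → ℝ → ℝ) : Prop where
  lsc : ∀ i j, LowerSemicontinuousOn (u i j) (Ici 0)
  interior : ∀ i j, ∀ t > 0, discreteLaplacian ε u i j t ≤ 0
  boundary : ∀ i, ∀ t > 0, ∀ φ : ℝ → ℝ, ContDiff ℝ 1 φ →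
    IsLocalMin (fun s => u i 0 s - φ s) t → boundaryForce ε ε₂ σ Weps u i t ≤ deriv φ t
  initial : ∀ i, u₀ (latticePoint ε i 0) ≤ u i 0 0

/-- Viscosity solution of the lattice system, in the class of functions that are bounded on bounded
time intervals. -/
structure IsLatticeSolution (ε ε₂ : ℝ) (σ Weps : ℝ → ℝ) (u₀ : Plane → ℝ)
    (u : ℤ → ℕ → ℝ → ℝ) : Prop where
  sub : IsLatticeSubsolution ε ε₂ σ Weps u₀ u
  super : IsLatticeSupersolution ε ε₂ σ Weps u₀ u
  bounded : ∀ T : ℝ, ∃ C : ℝ, ∀ i j, ∀ t ∈ Icc 0 T, |u i j t| ≤ C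

/-! ### The Peierls-Nabarro system -/

/-- The Laplacian in the space variables of `φ(X, t)`. -/
def spaceLaplacian (φ : Plane → ℝ → ℝ) (X : Plane) (t : ℝ) : ℝ :=
  Laplacian.laplacian (fun Y => φ Y t) X

/-- `φ_t - 2 ε₂ σ(ε₂ X₁) + W'(r) - ∂φ/∂X₂` at the point `(X, t)`. -/
def boundaryResidual (ε₂ : ℝ) (σ W : ℝ → ℝ) (φ : Plane → ℝ → ℝ) (r : ℝ) (X : Plane) (t : ℝ) : ℝ :=
  deriv (fun s => φ X s) t - 2 * ε₂ * σ (ε₂ * X 0) + deriv W r -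
    lineDeriv ℝ (fun Y => φ Y t) X (EuclideanSpace.single 1 1)

/-- Viscosity subsolution of the Peierls-Nabarro system with initial data `u₀`. On the boundary one
of the two equations holds. -/
structure IsPNSubsolution (ε₂ : ℝ) (σ W : ℝ → ℝ) (u₀ : Plane → ℝ) (u : Plane → ℝ → ℝ) : Prop where
  usc : UpperSemicontinuousOn (fun p : Plane × ℝ => u p.1 p.2) (OmegaBar ×ˢ Ici 0)
  interior : ∀ X, 0 < X 1 → ∀ t > 0, ∀ φ : Plane → ℝ → ℝ,
    ContDiff ℝ 2 (fun p : Plane × ℝ => φ p.1 p.2) →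
    IsLocalMaxOn (fun p : Plane × ℝ => u p.1 p.2 - φ p.1 p.2) (OmegaBar ×ˢ Ioi 0) (X, t) →
    -spaceLaplacian φ X t ≤ 0
  boundary : ∀ X, X 1 = 0 → ∀ t > 0, ∀ φ : Plane → ℝ → ℝ,
    ContDiff ℝ 2 (fun p : Plane × ℝ => φ p.1 p.2) →
    IsLocalMaxOn (fun p : Plane × ℝ => u p.1 p.2 - φ p.1 p.2) (OmegaBar ×ˢ Ioi 0) (X, t) →
    min (-spaceLaplacian φ X t) (boundaryResidual ε₂ σ W φ (u X t) X t) ≤ 0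
  initial : ∀ X, X 1 = 0 → u X 0 ≤ u₀ X

/-- Viscosity supersolution of the Peierls-Nabarro system with initial data `u₀`. On the boundary
one of the two equations holds. -/
structure IsPNSupersolution (ε₂ : ℝ) (σ W : ℝ → ℝ) (u₀ : Plane → ℝ) (u : Plane → ℝ → ℝ) :
    Prop where
  lsc : LowerSemicontinuousOn (fun p : Plane × ℝ => u p.1 p.2) (OmegaBar ×ˢ Ici 0)
  interior : ∀ X, 0 < X 1 → ∀ t > 0, ∀ φ : Plane → ℝ → ℝ,
    ContDiff ℝ 2 (fun p : Plane × ℝ => φ p.1 p.2) →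
    IsLocalMinOn (fun p : Plane × ℝ => u p.1 p.2 - φ p.1 p.2) (OmegaBar ×ˢ Ioi 0) (X, t) →
    0 ≤ -spaceLaplacian φ X t
  boundary : ∀ X, X 1 = 0 → ∀ t > 0, ∀ φ : Plane → ℝ → ℝ,
    ContDiff ℝ 2 (fun p : Plane × ℝ => φ p.1 p.2) →
    IsLocalMinOn (fun p : Plane × ℝ => u p.1 p.2 - φ p.1 p.2) (OmegaBar ×ˢ Ioi 0) (X, t) →
    0 ≤ max (-spaceLaplacian φ X t) (boundaryResidual ε₂ σ W φ (u X t) X t)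
  initial : ∀ X, X 1 = 0 → u₀ X ≤ u X 0

/-- Viscosity solution of the Peierls-Nabarro system, in the class of functions that are bounded on
bounded time intervals. -/
structure IsPNSolution (ε₂ : ℝ) (σ W : ℝ → ℝ) (u₀ : Plane → ℝ) (u : Plane → ℝ → ℝ) : Prop where
  sub : IsPNSubsolution ε₂ σ W u₀ u
  super : IsPNSupersolution ε₂ σ W u₀ u
  bounded : ∀ T : ℝ, ∃ C : ℝ, ∀ X ∈ OmegaBar, ∀ t ∈ Icc 0 T, |u X t| ≤ C

/-- The lattice functions `u^ε` converge to `u`, uniformly on bounded subsets of the closed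
half-plane times `[0, ∞)`, as `ε → 0⁺`. -/
def LatticeTendstoLocallyUniformly (ueps : ℝ → ℤ → ℕ → ℝ → ℝ) (u : Plane → ℝ → ℝ) : Prop :=
  ∀ R : ℝ, ∀ η > 0, ∀ᶠ ε in 𝓝[>] (0 : ℝ), ∀ i j, ∀ t ∈ Icc 0 R,
    ‖latticePoint ε i j‖ ≤ R → |ueps ε i j t - u (latticePoint ε i j) t| ≤ η

end FKPN

end

/-!
A comparison principle on the lattice, localized by an explicit barrier on tall strips, gives
uniqueness for (FK). Eliminating the interior values through the bounded discrete harmonic extension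
turns (FK) into an ordinary differential equation with globally Lipschitz right-hand side in the
space of bounded sequences, which gives existence.

In the continuum the bounded harmonic extension is the Poisson integral, and `∂/∂X₂` generates the
Poisson semigroup. By Duhamel's formula a solution of (PN) is the fixed point of a contraction in a
weighted sup norm: the value at height `y` and time `t` of what the boundary emitted at time `s` is
its Poisson average at height `y + t - s`. Inserting this formula, shifted up by a small `δ` so that
all the averages are taken at positive heights, into the lattice system leaves a small residual, and
the lattice comparison principle turns the residual into locally uniform convergence.
-/

namespace FKPN

open scoped BoundedContinuousFunction

/-! ### Comparison on the lattice -/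

lemma deriv_nonneg_of_eventually_le_left {f : ℝ → ℝ} {d t : ℝ} (hf : HasDerivAt f d t)
    (hle : ∀ᶠ s in 𝓝[<] t, f s ≤ f t) : 0 ≤ d := by
  have hslope : Tendsto (slope f t) (𝓝[<] t) (𝓝 d) :=
    (hasDerivWithinAt_iff_tendsto_slope' self_notMem_Iio).1 hf.hasDerivWithinAt
  refine ge_of_tendsto hslope ?_
  filter_upwards [hle, self_mem_nhdsWithin] with s hs hst
  rw [slope_def_field]
  exact div_nonneg_of_nonpos (sub_nonpos.2 hs) (sub_nonpos.2 (le_of_lt hst))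

lemma exists_forall_le_of_finite_superlevel {α β : Type*} [TopologicalSpace β] {A : Set α}
    {s : Set β} (hs : IsCompact s) {f : α → β → ℝ} (hf : ∀ a ∈ A, ContinuousOn (f a) s)
    {a₀ : α} (ha₀ : a₀ ∈ A) {t₀ : β} (ht₀ : t₀ ∈ s)
    (hfin : {a ∈ A | ∃ t ∈ s, f a₀ t₀ ≤ f a t}.Finite) :
    ∃ a ∈ A, ∃ t ∈ s, ∀ a' ∈ A, ∀ t' ∈ s, f a' t' ≤ f a t := by
  have : Nonempty β := ⟨t₀⟩
  have hmax : ∀ a ∈ A, ∃ t ∈ s, ∀ t' ∈ s, f a t' ≤ f a t := fun a ha =>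
    hs.exists_isMaxOn ⟨t₀, ht₀⟩ (hf a ha)
  choose! τ hτs hτ using hmax
  obtain ⟨a, ⟨haA, -⟩, ha⟩ :=
    exists_max_image _ (fun a => f a (τ a)) hfin ⟨a₀, ha₀, t₀, ht₀, le_rfl⟩
  refine ⟨a, haA, τ a, hτs a haA, fun a' ha' t' ht' => (hτ a' ha' t' ht').trans ?_⟩
  by_cases hle : f a₀ t₀ ≤ f a' (τ a')
  · exact ha a' ⟨ha', τ a', hτs a' ha', hle⟩
  · exact (le_of_not_ge hle).trans ((hτ a₀ ha₀ t₀ ht₀).trans (ha a₀ ⟨ha₀, t₀, ht₀, le_rfl⟩))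

lemma finite_setOf_intCast_sq_le (c : ℝ) : {i : ℤ | (i : ℝ) ^ 2 ≤ c}.Finite := by
  refine (finite_Icc (-⌈c⌉) ⌈c⌉).subset fun i hi => mem_Icc.2 (abs_le.1 ?_)
  rw [Int.abs_eq_natAbs]
  exact (Int.natAbs_le_self_sq i).trans (by exact_mod_cast hi.trans (Int.le_ceil c))

section Linearity

variable (ε : ℝ) (u v : ℤ → ℕ → ℝ → ℝ) (i : ℤ) (t : ℝ)

lemma discreteLaplacian_sub (j : ℕ) :
    discreteLaplacian ε (fun i j s => u i j s - v i j s) i j t =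
      discreteLaplacian ε u i j t - discreteLaplacian ε v i j t := by
  unfold discreteLaplacian; ring

lemma discreteLaplacian_mul (c : ℝ → ℝ) (j : ℕ) :
    discreteLaplacian ε (fun i j s => c s * u i j s) i j t = c t * discreteLaplacian ε u i j t := by
  unfold discreteLaplacian; ring

lemma boundaryOperator_sub :
    boundaryOperator ε (fun i j s => u i j s - v i j s) i t =
      boundaryOperator ε u i t - boundaryOperator ε v i t := by
  unfold boundaryOperator; ring

lemma boundaryOperator_mul (c : ℝ → ℝ) :
    boundaryOperator ε (fun i j s => c s * u i j s) i t = c t * boundaryOperator ε u i t := by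
  unfold boundaryOperator; ring

end Linearity

theorem strip_maximum_principle {ε T : ℝ} (hε : 0 < ε) {n : ℕ} {f : ℤ → ℕ → ℝ → ℝ}
    (hcont : ∀ i j, ContinuousOn (f i j) (Icc 0 T))
    (hfin : {i | ∃ j ≤ n, ∃ t ∈ Icc 0 T, 0 < f i j t}.Finite)
    (hinner : ∀ i j, j + 1 < n → ∀ t ∈ Icc 0 T, 0 < discreteLaplacian ε f i j t)
    (hbdy : ∀ i, ∀ t ∈ Ioc 0 T, 0 < f i 0 t →
      ∃ d, HasDerivAt (f i 0) d t ∧ d < boundaryOperator ε f i t)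
    (htop : ∀ i, ∀ t ∈ Icc 0 T, f i n t ≤ 0) (hstart : ∀ i, f i 0 0 ≤ 0)
    {i : ℤ} {j : ℕ} {t : ℝ} (hj : j ≤ n) (ht : t ∈ Icc 0 T) : f i j t ≤ 0 := by
  by_contra! hpos
  obtain ⟨⟨i₁, j₁⟩, hj₁, t₁, ht₁, hmax⟩ :=
    exists_forall_le_of_finite_superlevel (A := {p : ℤ × ℕ | p.2 ≤ n}) (s := Icc 0 T)
      (f := fun p => f p.1 p.2) (a₀ := (i, j)) (t₀ := t) isCompact_Icc (fun p _ => hcont p.1 p.2)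
      hj ht <| (hfin.prod (finite_Iic n)).subset fun p hp =>
        let ⟨hp₂, s, hs, hle⟩ := hp
        ⟨⟨p.2, hp₂, s, hs, hpos.trans_le hle⟩, hp₂⟩
  have hpos₁ : 0 < f i₁ j₁ t₁ := hpos.trans_le (hmax (i, j) hj t ht)
  have hle : ∀ i' j', j' ≤ n → f i' j' t₁ ≤ f i₁ j₁ t₁ := fun i' j' hj' =>
    hmax (i', j') hj' t₁ ht₁
  rcases (show j₁ ≤ n from hj₁).eq_or_lt with rfl | hj₁n
  · exact (htop i₁ t₁ ht₁).not_gt hpos₁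
  rcases j₁ with _ | k
  · rcases ht₁.1.eq_or_lt with rfl | ht₁pos
    · exact (hstart i₁).not_gt hpos₁
    obtain ⟨d, hd, hlt⟩ := hbdy i₁ t₁ ⟨ht₁pos, ht₁.2⟩ hpos₁
    have hd_nonneg : 0 ≤ d := deriv_nonneg_of_eventually_le_left hd <| by
      filter_upwards [Ioo_mem_nhdsLT ht₁pos] with s hs
      exact hmax (i₁, 0) hj₁ s ⟨hs.1.le, hs.2.le.trans ht₁.2⟩
    have hop : boundaryOperator ε f i₁ t₁ ≤ 0 :=
      mul_nonpos_of_nonneg_of_nonpos (by positivity)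
        (by linarith [hle (i₁ + 1) 0 hj₁, hle (i₁ - 1) 0 hj₁, hle i₁ 1 hj₁n])
    linarith
  · refine (hinner i₁ k hj₁n t₁ ht₁).not_ge (mul_nonpos_of_nonneg_of_nonpos (by positivity) ?_)
    linarith [hle (i₁ + 1) (k + 1) hj₁, hle (i₁ - 1) (k + 1) hj₁, hle i₁ (k + 2) hj₁n,
      hle i₁ k (by omega)]

/-- A strict supersolution of the lattice system on the strip of height `Y`, used to localize the
comparison principle: it exceeds `M` on the top layer of the strip, the parameter `η` absorbs the
residuals of the compared function, and `δ` makes it grow along the strip. -/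
noncomputable def stripBarrier (ε M η δ Y : ℝ) (i : ℤ) (j : ℕ) : ℝ :=
  M / Y * (1 + ε * j) + 2 * η * (1 + Y) + η * (ε * j * (2 * Y - ε * j)) +
    δ * ((ε * i) ^ 2 + Y ^ 2 + ε - (ε * j) ^ 2)

section StripBarrier

variable {ε M η δ Y : ℝ}

lemma le_stripBarrier (hε : 0 < ε) (hη : 0 ≤ η) (hδ : 0 ≤ δ) (i : ℤ) {j : ℕ} (hj : ε * j ≤ Y) :
    M / Y * (1 + ε * j) + 2 * η * (1 + Y) + δ * (ε * i) ^ 2 ≤ stripBarrier ε M η δ Y i j := by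
  have hj_nonneg : 0 ≤ ε * j := by positivity
  have hη_term : 0 ≤ η * (ε * j * (2 * Y - ε * j)) :=
    mul_nonneg hη (mul_nonneg hj_nonneg (by linarith))
  have hδ_term : 0 ≤ δ * (Y ^ 2 + ε - (ε * j) ^ 2) := mul_nonneg hδ (by nlinarith)
  unfold stripBarrier
  linarith

lemma two_mul_add_lt_stripBarrier (hε : 0 < ε) (hM : 0 ≤ M) (hη : 0 < η) (hδ : 0 ≤ δ) (hY : 0 < Y)
    (i : ℤ) {j : ℕ} (hj : ε * j ≤ Y) : 2 * η + δ * (ε * i) ^ 2 < stripBarrier ε M η δ Y i j := by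
  have hM_term : 0 ≤ M / Y * (1 + ε * j) := by positivity
  have hY_term : 0 < 2 * η * Y := by positivity
  linarith [le_stripBarrier (M := M) hε hη.le hδ i hj]

lemma le_stripBarrier_top (hε : 0 < ε) (hM : 0 ≤ M) (hη : 0 ≤ η) (hδ : 0 ≤ δ) (i : ℤ) {n : ℕ}
    (hn : 0 < n) : M ≤ stripBarrier ε M η δ (ε * n) i n := by
  have : (0 : ℝ) < n := by exact_mod_cast hn
  calc M = M / (ε * n) * (ε * n) := (div_mul_cancel₀ M (by positivity)).symm
    _ ≤ M / (ε * n) * (1 + ε * n) := by gcongr; linarith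
    _ ≤ M / (ε * n) * (1 + ε * n) + 2 * η * (1 + ε * n) + δ * (ε * i) ^ 2 := by
        rw [add_assoc]
        exact le_add_of_nonneg_right (by positivity)
    _ ≤ _ := le_stripBarrier hε hη hδ i le_rfl

lemma stripBarrier_zero_le (hη : 0 ≤ η) (i : ℤ) (j : ℕ) :
    stripBarrier ε M η 0 Y i j ≤ M / Y * (1 + ε * j) + 2 * η * (1 + Y + Y * (ε * j)) := by
  unfold stripBarrier
  nlinarith [mul_nonneg hη (sq_nonneg (ε * j))]

lemma discreteLaplacian_stripBarrier (hε : ε ≠ 0) (i : ℤ) (j : ℕ) (t : ℝ) :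
    discreteLaplacian ε (fun i j _ => stripBarrier ε M η δ Y i j) i j t = -(2 * η) := by
  simp only [discreteLaplacian, stripBarrier]
  push_cast
  field_simp
  ring

lemma boundaryOperator_stripBarrier (hε : ε ≠ 0) (i : ℤ) (t : ℝ) :
    boundaryOperator ε (fun i j _ => stripBarrier ε M η δ Y i j) i t =
      stripBarrier ε M η δ Y i 0 - 2 * η - η * ε - δ * ((ε * i) ^ 2 + Y ^ 2) := by
  simp only [boundaryOperator, stripBarrier]
  push_cast
  field_simp
  ring

end StripBarrier

/-- Approximate subsolutions on `[0, T]` of the linearized lattice system: the residuals and the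
initial data are at most `η`, the zeroth-order coefficient is `K`, and the values are at most `M`.
The boundary inequality is only required where `e` is positive, which is all that the nonlinear
system provides. -/
structure IsApproxSubsolution (ε T K η M : ℝ) (e : ℤ → ℕ → ℝ → ℝ) : Prop where
  continuousOn : ∀ i j, ContinuousOn (e i j) (Icc 0 T)
  le : ∀ i j, ∀ t ∈ Icc 0 T, e i j t ≤ M
  interior : ∀ i j, ∀ t ∈ Icc 0 T, -η ≤ discreteLaplacian ε e i j t
  boundary : ∀ i, ∀ t ∈ Ioc 0 T, 0 < e i 0 t →
    ∃ d, HasDerivAt (e i 0) d t ∧ d ≤ boundaryOperator ε e i t + K * e i 0 t + η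
  initial : ∀ i, e i 0 0 ≤ η

namespace IsApproxSubsolution

variable {ε T K η M : ℝ} {e : ℤ → ℕ → ℝ → ℝ}

lemma mono {η' M' : ℝ} (he : IsApproxSubsolution ε T K η M e) (hη : η ≤ η') (hM : M ≤ M') :
    IsApproxSubsolution ε T K η' M' e where
  continuousOn := he.continuousOn
  le i j t ht := (he.le i j t ht).trans hM
  interior i j t ht := (neg_le_neg hη).trans (he.interior i j t ht)
  boundary i t ht hpos :=
    let ⟨d, hd, hle⟩ := he.boundary i t ht hpos
    ⟨d, hd, by linarith⟩
  initial i := (he.initial i).trans hη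

lemma exp_mul_le (he : IsApproxSubsolution ε T K η M e) (hM : 0 ≤ M) (hK : 0 ≤ K) (i : ℤ) (j : ℕ)
    {t : ℝ} (ht : t ∈ Icc 0 T) : Real.exp (-(K + 1) * t) * e i j t ≤ M :=
  (mul_le_mul_of_nonneg_left (he.le i j t ht) (Real.exp_pos _).le).trans
    (mul_le_of_le_one_left hM (Real.exp_le_one_iff.2 (by nlinarith [ht.1])))

/-- The factor `exp (-(K + 1) t)` turns the zeroth-order term into a damping term, which is what
lets a barrier that does not depend on time work. -/
lemma exists_hasDerivAt_exp_mul_le (he : IsApproxSubsolution ε T K η M e) (hη : 0 ≤ η) (hK : 0 ≤ K)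
    (i : ℤ) {t : ℝ} (ht : t ∈ Ioc 0 T) (hpos : 0 < e i 0 t) :
    ∃ d, HasDerivAt (fun s => Real.exp (-(K + 1) * s) * e i 0 s) d t ∧
      d ≤ Real.exp (-(K + 1) * t) * (boundaryOperator ε e i t - e i 0 t) + η := by
  obtain ⟨d, hd, hdle⟩ := he.boundary i t ht hpos
  have hexp : HasDerivAt (fun s => Real.exp (-(K + 1) * s))
      (Real.exp (-(K + 1) * t) * -(K + 1)) t := by
    simpa only [id, mul_one] using ((hasDerivAt_id t).const_mul (-(K + 1))).exp
  have hexp_le : Real.exp (-(K + 1) * t) ≤ 1 := Real.exp_le_one_iff.2 (by nlinarith [ht.1])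
  refine ⟨_, hexp.mul hd, ?_⟩
  nlinarith [mul_le_mul_of_nonneg_left hdle (Real.exp_pos (-(K + 1) * t)).le]

lemma exp_mul_le_stripBarrier (he : IsApproxSubsolution ε T K η M e) (hε : 0 < ε) (hη : 0 < η)
    (hM : 0 ≤ M) (hK : 0 ≤ K) {n : ℕ} (hn : 0 < n) {δ : ℝ} (hδ : 0 < δ)
    {i : ℤ} {j : ℕ} {t : ℝ} (hj : j ≤ n) (ht : t ∈ Icc 0 T) :
    Real.exp (-(K + 1) * t) * e i j t ≤ stripBarrier ε M η δ (ε * n) i j := by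
  set E : ℝ → ℝ := fun s => Real.exp (-(K + 1) * s)
  set B : ℤ → ℕ → ℝ → ℝ := fun i j _ => stripBarrier ε M η δ (ε * n) i j
  have hE_pos : ∀ s, 0 < E s := fun s => Real.exp_pos _
  have hB_gt : ∀ i j s, j ≤ n → 2 * η + δ * (ε * i) ^ 2 < B i j s := fun i j _ hj =>
    two_mul_add_lt_stripBarrier hε hM hη hδ.le (by positivity) i (by gcongr)
  refine sub_nonpos.1 (strip_maximum_principle (f := fun i j s => E s * e i j s - B i j s) hε
    (fun i j => ?_) ?_ (fun i j _ s hs => ?_) (fun i s hs hpos => ?_) (fun i s hs => ?_)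
    (fun i => ?_) hj ht)
  · exact ((by fun_prop : Continuous E).continuousOn.mul (he.continuousOn i j)).sub
      continuousOn_const
  · refine (finite_setOf_intCast_sq_le (M / (δ * ε ^ 2))).subset ?_
    rintro i ⟨j, hj, s, hs, hpos⟩
    rw [mem_ofPred_eq, le_div_iff₀ (by positivity)]
    nlinarith [he.exp_mul_le hM hK i j hs, hB_gt i j s hj]
  · have hE_le : E s ≤ 1 := Real.exp_le_one_iff.2 (by nlinarith [hs.1])
    rw [discreteLaplacian_sub, discreteLaplacian_mul, discreteLaplacian_stripBarrier hε.ne']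
    nlinarith [he.interior i j s hs, hE_pos s]
  · have he_pos : 0 < e i 0 s :=
      pos_of_mul_pos_right (by nlinarith [hB_gt i 0 s (Nat.zero_le n)]) (hE_pos s).le
    obtain ⟨d, hd, hdle⟩ := he.exists_hasDerivAt_exp_mul_le hη.le hK i hs he_pos
    refine ⟨d, hd.sub_const _, ?_⟩
    rw [boundaryOperator_sub, boundaryOperator_mul, boundaryOperator_stripBarrier hε.ne']
    have hδ_term : 0 ≤ δ * ((ε * i) ^ 2 + (ε * n) ^ 2) := by positivity
    have hηε : 0 < η * ε := by positivity
    linarith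
  · exact sub_nonpos.2 ((he.exp_mul_le hM hK i n hs).trans
      (le_stripBarrier_top hε hM hη.le hδ.le i hn))
  · have hstart : E 0 * e i 0 0 ≤ η := by simpa [E] using he.initial i
    have hδ_term : 0 ≤ δ * (ε * i) ^ 2 := by positivity
    linarith [hB_gt i 0 0 (Nat.zero_le n)]

theorem le_exp_mul (he : IsApproxSubsolution ε T K η M e) (hε : 0 < ε) (hη : 0 < η) (hM : 0 ≤ M)
    (hK : 0 ≤ K) {n : ℕ} (hn : 0 < n) {i : ℤ} {j : ℕ} {t : ℝ} (hj : j ≤ n) (ht : t ∈ Icc 0 T) :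
    e i j t ≤ Real.exp ((K + 1) * t) *
      (M / (ε * n) * (1 + ε * j) + 2 * η * (1 + ε * n + ε * n * (ε * j))) := by
  have hlim : Tendsto (fun δ => stripBarrier ε M η δ (ε * n) i j) (𝓝[>] 0)
      (𝓝 (stripBarrier ε M η 0 (ε * n) i j)) := by
    refine tendsto_nhdsWithin_of_tendsto_nhds (Continuous.tendsto ?_ 0)
    unfold stripBarrier
    fun_prop
  have hbarrier : Real.exp (-(K + 1) * t) * e i j t ≤ stripBarrier ε M η 0 (ε * n) i j := by
    refine ge_of_tendsto hlim ?_
    filter_upwards [self_mem_nhdsWithin] with δ hδ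
    exact he.exp_mul_le_stripBarrier hε hη hM hK hn hδ hj ht
  calc e i j t = Real.exp ((K + 1) * t) * (Real.exp (-(K + 1) * t) * e i j t) := by
        rw [neg_mul, Real.exp_neg, mul_inv_cancel_left₀ (Real.exp_pos _).ne']
    _ ≤ _ := by
        gcongr
        exact hbarrier.trans (stripBarrier_zero_le hη.le i j)

theorem nonpos (he : IsApproxSubsolution ε T K 0 M e) (hε : 0 < ε) (hK : 0 ≤ K)
    (i : ℤ) (j : ℕ) {t : ℝ} (ht : t ∈ Icc 0 T) : e i j t ≤ 0 := by
  have hbound : ∀ n : ℕ, 0 < n → j ≤ n → e i j t ≤ Real.exp ((K + 1) * t) *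
      (max M 0 / (ε * n) * (1 + ε * j) + 2 * (1 / n / n) * (1 + ε * n + ε * n * (ε * j))) :=
    fun n hn hj => (he.mono (by positivity) (le_max_left M 0)).le_exp_mul hε (by positivity)
      (le_max_right M 0) hK hn hj ht
  have hlim : Tendsto (fun n : ℕ => Real.exp ((K + 1) * t) *
      (max M 0 / (ε * n) * (1 + ε * j) + 2 * (1 / n / n) * (1 + ε * n + ε * n * (ε * j)))) atTop
      (𝓝 0) := by
    have hinv : Tendsto (fun n : ℕ => (1 : ℝ) / n) atTop (𝓝 0) :=
      tendsto_one_div_atTop_nhds_zero_nat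
    have := (((hinv.const_mul (max M 0 / ε * (1 + ε * j))).add
      ((hinv.mul hinv).const_mul 2)).add (hinv.const_mul (2 * (ε + ε * (ε * j))))).const_mul
      (Real.exp ((K + 1) * t))
    simp only [mul_zero, add_zero] at this
    refine this.congr' ?_
    filter_upwards [eventually_gt_atTop 0] with n hn
    have : (n : ℝ) ≠ 0 := by positivity
    field_simp
    ring
  refine ge_of_tendsto hlim ?_
  filter_upwards [eventually_gt_atTop 0, eventually_ge_atTop j] with n hn hj using hbound n hn hj

end IsApproxSubsolution

theorem discrete_maximum_principle {w : ℤ → ℕ → ℝ} {M m : ℝ} (hbd : ∀ i j, w i j ≤ M)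
    (hsub : ∀ i j, 4 * w i (j + 1) ≤
      w (i + 1) (j + 1) + w (i - 1) (j + 1) + w i (j + 2) + w i j)
    (hm : ∀ i, w i 0 ≤ m) (i : ℤ) (j : ℕ) : w i j ≤ m := by
  have h : IsApproxSubsolution 1 0 0 0 (M - m) fun i j _ => w i j - m :=
    { continuousOn := fun i j => continuousOn_const
      le := fun i j t _ => sub_le_sub_right (hbd i j) m
      interior := fun i j t _ => by unfold discreteLaplacian; linarith [hsub i j]
      boundary := fun i t ht => absurd (ht.1.trans_le ht.2) (lt_irrefl _)
      initial := fun i => sub_nonpos.2 (hm i) }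
  exact sub_nonpos.1 (h.nonpos one_pos le_rfl i j (left_mem_Icc.2 le_rfl))

/-! ### Viscosity solutions of scalar evolution equations -/

/-- The penalization `β * exp (n * (s - y))` with `n` large is negligible to the left of `y` and
huge to the right, so that `v - ψ` has an interior maximum, where `ψ' > 0`. -/
theorem antitoneOn_of_forall_isLocalMax {v : ℝ → ℝ} {a b : ℝ} (hv : ContinuousOn v (Ioo a b))
    (htest : ∀ t ∈ Ioo a b, ∀ ψ : ℝ → ℝ, ContDiff ℝ 1 ψ →
      IsLocalMax (fun s => v s - ψ s) t → deriv ψ t ≤ 0) : AntitoneOn v (Ioo a b) := by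
  intro x hx y hy hxy
  by_contra! hlt
  have hxy' : x < y := hxy.lt_of_ne fun h => hlt.ne (congrArg v h)
  obtain ⟨c, hyc, hcb⟩ := exists_between hy.2
  obtain ⟨β, hβ_pos, hβ⟩ : ∃ β > 0, v x < v y - β :=
    ⟨(v y - v x) / 2, half_pos (sub_pos.2 hlt), by linarith⟩
  obtain ⟨n, hn⟩ := exists_nat_gt (max 0 ((v c - v y) / (β * (c - y))))
  have hn_pos : (0 : ℝ) < n := (le_max_left _ _).trans_lt hn
  have hβc : 0 < β * (c - y) := mul_pos hβ_pos (sub_pos.2 hyc)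
  have hn_c : v c - v y < β * (n * (c - y)) := by
    have := (div_lt_iff₀ hβc).1 ((le_max_right _ _).trans_lt hn)
    linarith
  set ψ : ℝ → ℝ := fun s => β * Real.exp (n * (s - y))
  have hψ_smooth : ContDiff ℝ 1 ψ := by fun_prop
  have hψ_deriv : ∀ s, HasDerivAt ψ (β * (Real.exp (n * (s - y)) * (n * 1))) s := fun s =>
    ((((hasDerivAt_id s).sub_const y).const_mul (n : ℝ)).exp).const_mul β
  have hψ_y : ψ y = β := by simp [ψ]
  obtain ⟨t, ht, hmax⟩ := isCompact_Icc.exists_isMaxOn (nonempty_Icc.2 (hxy.trans hyc.le))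
    ((hv.mono fun s hs => ⟨hx.1.trans_le hs.1, hs.2.trans_lt hcb⟩).sub
      (hψ_smooth.continuous.continuousOn (s := Icc x c)))
  have hmax_y : v y - β ≤ v t - ψ t := hψ_y ▸ isMaxOn_iff.1 hmax y ⟨hxy, hyc.le⟩
  have htx : t ≠ x := by
    rintro rfl
    have : 0 < ψ t := by positivity
    linarith
  have htc : t ≠ c := by
    rintro rfl
    have := mul_le_mul_of_nonneg_left (Real.add_one_le_exp (n * (t - y))) hβ_pos.le
    linarith
  have ht' : t ∈ Ioo x c := ⟨ht.1.lt_of_ne' htx, ht.2.lt_of_ne htc⟩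
  have hle := htest t ⟨hx.1.trans ht'.1, ht'.2.trans hcb⟩ ψ hψ_smooth
    (hmax.isLocalMax (Icc_mem_nhds ht'.1 ht'.2))
  rw [(hψ_deriv t).deriv] at hle
  exact hle.not_gt (by positivity)

theorem antitoneOn_sub_of_viscosity_subsolution {u Φ : ℝ → ℝ} {a b : ℝ}
    (hu : ContinuousOn u (Ioo a b)) (hΦ : ContDiff ℝ 1 Φ)
    (hsub : ∀ t ∈ Ioo a b, ∀ φ : ℝ → ℝ, ContDiff ℝ 1 φ → IsLocalMax (fun s => u s - φ s) t →
      deriv φ t ≤ deriv Φ t) : AntitoneOn (fun s => u s - Φ s) (Ioo a b) := by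
  refine antitoneOn_of_forall_isLocalMax (hu.sub hΦ.continuous.continuousOn)
    fun t ht ψ hψ hloc => ?_
  have hle := hsub t ht (fun s => Φ s + ψ s) (hΦ.add hψ) (by simpa only [sub_sub] using hloc)
  rw [deriv_fun_add (hΦ.differentiable one_ne_zero t) (hψ.differentiable one_ne_zero t)] at hle
  linarith

theorem exists_contDiff_deriv_eqOn {F : ℝ → ℝ} {s : Set ℝ} {t : ℝ} (hs : s ∈ 𝓝 t)
    (hF : ContinuousOn F s) :
    ∃ a b, t ∈ Ioo a b ∧ Ioo a b ⊆ s ∧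
      ∃ Φ : ℝ → ℝ, ContDiff ℝ 1 Φ ∧ EqOn (deriv Φ) F (Ioo a b) := by
  obtain ⟨a, b, ht, hIcc, hab⟩ := exists_Icc_mem_subset_of_mem_nhds hs
  obtain ⟨a', b', ht', hab'⟩ := mem_nhds_iff_exists_Ioo_subset.1 hIcc
  have hle : a ≤ b := ht.1.trans ht.2
  have hf : Continuous (IccExtend hle (domRestrict (Icc a b) F)) :=
    (continuousOn_iff_continuous_domRestrict.1 (hF.mono hab)).Icc_extend'
  have hderiv : ∀ r, HasDerivAt (fun r => ∫ x in a..r, IccExtend hle (domRestrict (Icc a b) F) x)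
      (IccExtend hle (domRestrict (Icc a b) F) r) r := fun r =>
    (hf.integral_hasStrictDerivAt a r).hasDerivAt
  refine ⟨a', b', ht', hab'.trans hab, _, contDiff_one_iff_deriv.2
    ⟨fun r => (hderiv r).differentiableAt, ?_⟩, fun r hr => ?_⟩
  · rwa [funext fun r => (hderiv r).deriv]
  · exact (hderiv r).deriv.trans (IccExtend_of_mem hle _ (hab' hr))

theorem hasDerivAt_of_viscosity_solution {u F : ℝ → ℝ} {s : Set ℝ} {t : ℝ} (hs : s ∈ 𝓝 t)
    (hu : ContinuousOn u s) (hF : ContinuousOn F s)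
    (hsub : ∀ r ∈ s, ∀ φ : ℝ → ℝ, ContDiff ℝ 1 φ → IsLocalMax (fun x => u x - φ x) r →
      deriv φ r ≤ F r)
    (hsuper : ∀ r ∈ s, ∀ φ : ℝ → ℝ, ContDiff ℝ 1 φ → IsLocalMin (fun x => u x - φ x) r →
      F r ≤ deriv φ r) : HasDerivAt u (F t) t := by
  obtain ⟨a, b, ht, hab, Φ, hΦ, hΦF⟩ := exists_contDiff_deriv_eqOn hs hF
  have hsub_Φ : AntitoneOn (fun r => u r - Φ r) (Ioo a b) :=
    antitoneOn_sub_of_viscosity_subsolution (hu.mono hab) hΦ fun r hr φ hφ hloc =>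
      (hsub r (hab hr) φ hφ hloc).trans (hΦF hr).ge
  have hsuper_Φ : AntitoneOn (fun r => -u r - -Φ r) (Ioo a b) :=
    antitoneOn_sub_of_viscosity_subsolution (hu.mono hab).neg hΦ.neg fun r hr φ hφ hloc => by
      have hle := hsuper r (hab hr) (fun x => -φ x) hφ.neg
        (by simpa only [neg_sub, sub_neg_eq_add, add_comm] using hloc.neg)
      rw [deriv.fun_neg] at hle ⊢
      linarith [hΦF hr]
  have hconst : ∀ r ∈ Ioo a b, u r = Φ r + (u t - Φ t) := fun r hr => by
    rcases le_total r t with hrt | hrt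
    · linarith [hsub_Φ hr ht hrt, hsuper_Φ hr ht hrt]
    · linarith [hsub_Φ ht hr hrt, hsuper_Φ ht hr hrt]
  rw [← hΦF ht]
  exact ((hΦ.differentiable one_ne_zero t).hasDerivAt.add_const _).congr_of_eventuallyEq
    (eventually_of_mem (Ioo_mem_nhds ht.1 ht.2) hconst)

/-! ### Stresses and potentials -/

/-- The regularity of the stress, of the forces derived from the potentials and of the initial data
on which the analysis of both systems rests. -/
structure IsBoundedLipschitz (f : ℝ → ℝ) : Prop where
  bounded : ∃ C, ∀ x, |f x| ≤ C
  lipschitz : ∃ K, LipschitzWith K f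

namespace IsBoundedLipschitz

variable {f : ℝ → ℝ}

lemma continuous (hf : IsBoundedLipschitz f) : Continuous f :=
  hf.lipschitz.choose_spec.continuous

lemma exists_abs_sub_le (hf : IsBoundedLipschitz f) :
    ∃ K, 0 ≤ K ∧ ∀ x y, |f x - f y| ≤ K * |x - y| :=
  let ⟨K, hK⟩ := hf.lipschitz
  ⟨K, K.2, fun x y => hK.dist_le_mul x y⟩

lemma const_mul (hf : IsBoundedLipschitz f) (c : ℝ) : IsBoundedLipschitz fun x => c * f x where
  bounded :=
    let ⟨C, hC⟩ := hf.bounded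
    ⟨|c| * C, fun x => (abs_mul c _).trans_le (mul_le_mul_of_nonneg_left (hC x) (abs_nonneg c))⟩
  lipschitz :=
    let ⟨_, hK⟩ := hf.lipschitz
    ⟨_, (lipschitzWith_smul c).comp hK⟩

lemma comp_const_mul (hf : IsBoundedLipschitz f) (c : ℝ) :
    IsBoundedLipschitz fun x => f (c * x) where
  bounded := hf.bounded.imp fun _ hC x => hC (c * x)
  lipschitz :=
    let ⟨_, hK⟩ := hf.lipschitz
    ⟨_, hK.comp (lipschitzWith_smul c)⟩

lemma of_abs_deriv_le {C D : ℝ} (hd : Differentiable ℝ f) (hC : ∀ x, |f x| ≤ C)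
    (hD : ∀ x, |deriv f x| ≤ D) : IsBoundedLipschitz f where
  bounded := ⟨C, hC⟩
  lipschitz := ⟨D.toNNReal, lipschitzWith_of_nnnorm_deriv_le hd fun x => by
    rw [← NNReal.coe_le_coe, Real.coe_toNNReal D ((abs_nonneg _).trans (hD x))]
    exact hD x⟩

lemma of_periodic {c : ℝ} (hf : ContDiff ℝ 1 f) (hp : Function.Periodic f c) (hc : c ≠ 0) :
    IsBoundedLipschitz f := by
  have hp' : Function.Periodic (deriv f) c := fun x => by
    rw [← deriv_comp_add_const, funext hp]
  obtain ⟨C, hC⟩ := (hp.isBounded_of_continuous hc hf.continuous).exists_norm_le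
  obtain ⟨D, hD⟩ := (hp'.isBounded_of_continuous hc (hf.continuous_deriv le_rfl)).exists_norm_le
  exact of_abs_deriv_le (hf.differentiable one_ne_zero) (fun x => hC _ ⟨x, rfl⟩)
    fun x => hD _ ⟨x, rfl⟩

end IsBoundedLipschitz

/-- A potential whose force `-W'` is bounded and Lipschitz. -/
structure IsLipschitzPotential (W : ℝ → ℝ) : Prop where
  differentiable : Differentiable ℝ W
  deriv : IsBoundedLipschitz (deriv W)

lemma AdmissibleStress.isBoundedLipschitz {σ : ℝ → ℝ} (hσ : AdmissibleStress σ) :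
    IsBoundedLipschitz σ := by
  obtain ⟨hd, -, C, -, hC⟩ := hσ
  refine .of_abs_deriv_le (C := C) (D := C) hd (fun x => ?_) (fun x => ?_) <;>
    linarith [hC x, abs_nonneg (σ x), abs_nonneg (deriv σ x), abs_nonneg (deriv (deriv σ) x)]

lemma PeriodicPotential.isLipschitzPotential {W : ℝ → ℝ} (hW : PeriodicPotential W) :
    IsLipschitzPotential W where
  differentiable := hW.regular.differentiable three_ne_zero
  deriv := by
    refine .of_periodic (c := 1) ?_ (fun x => ?_) one_ne_zero
    · exact ((contDiff_succ_iff_deriv (n := 2)).1 hW.regular).2.2.of_le one_le_two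
    · rw [← deriv_comp_add_const, funext hW.periodic]

lemma IsLipschitzPotential.of_const_mul {W : ℝ → ℝ} {c : ℝ} (hc : c ≠ 0)
    (hW : IsLipschitzPotential fun a => c * W a) : IsLipschitzPotential W where
  differentiable := by simpa [hc] using hW.differentiable.const_mul c⁻¹
  deriv := by
    have h := hW.deriv.const_mul c⁻¹
    simpa only [deriv_const_mul_field, inv_mul_cancel_left₀ hc] using h

lemma IsLipschitzPotential.contDiff {W : ℝ → ℝ} (hW : IsLipschitzPotential W) : ContDiff ℝ 1 W :=
  contDiff_one_iff_deriv.2 ⟨hW.differentiable, hW.deriv.continuous⟩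

lemma LocallyHarmonicPotential.isLipschitzPotential_of_const_mul {W : ℝ → ℝ} {c : ℝ}
    (hW : LocallyHarmonicPotential fun a => c * W a) (hc : c ≠ 0) : IsLipschitzPotential W :=
  .of_const_mul hc hW.1.isLipschitzPotential

lemma exists_lipschitzWith_force {σ w : ℝ → ℝ} (hσ : IsBoundedLipschitz σ)
    (hw : IsBoundedLipschitz w) (ε₂ : ℝ) :
    ∃ K C, LipschitzWith K (fun p : ℝ × ℝ => 2 * ε₂ * σ (ε₂ * p.1) - w p.2) ∧
      ∀ p : ℝ × ℝ, |2 * ε₂ * σ (ε₂ * p.1) - w p.2| ≤ C := by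
  have hσ' := (hσ.comp_const_mul ε₂).const_mul (2 * ε₂)
  obtain ⟨Kσ, hKσ⟩ := hσ'.lipschitz
  obtain ⟨Cσ, hCσ⟩ := hσ'.bounded
  obtain ⟨Kw, hKw⟩ := hw.lipschitz
  obtain ⟨Cw, hCw⟩ := hw.bounded
  exact ⟨_, Cσ + Cw, (hKσ.comp .prod_fst).sub (hKw.comp .prod_snd),
    fun p => (abs_sub _ _).trans (add_le_add (hCσ p.1) (hCw p.2))⟩

/-! ### Solutions of the lattice system are classical -/

namespace IsLatticeSolution

variable {ε ε₂ : ℝ} {σ Weps : ℝ → ℝ} {u₀ : Plane → ℝ} {u : ℤ → ℕ → ℝ → ℝ}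

lemma continuousOn (hu : IsLatticeSolution ε ε₂ σ Weps u₀ u) (i : ℤ) (j : ℕ) :
    ContinuousOn (u i j) (Ici 0) :=
  continuousOn_iff_lower_upperSemicontinuousOn.2 ⟨hu.super.lsc i j, hu.sub.usc i j⟩

lemma initial_eq (hu : IsLatticeSolution ε ε₂ σ Weps u₀ u) (i : ℤ) :
    u i 0 0 = u₀ (latticePoint ε i 0) :=
  le_antisymm (hu.sub.initial i) (hu.super.initial i)

lemma discreteLaplacian_eq_zero (hu : IsLatticeSolution ε ε₂ σ Weps u₀ u) (i : ℤ) (j : ℕ) {t : ℝ}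
    (ht : 0 ≤ t) : discreteLaplacian ε u i j t = 0 := by
  have hcont : ContinuousOn (discreteLaplacian ε u i j) (Ici 0) := by
    have := hu.continuousOn
    unfold discreteLaplacian
    fun_prop
  have hpos : EqOn (discreteLaplacian ε u i j) 0 (Ioi 0) := fun s hs =>
    le_antisymm (hu.super.interior i j s hs) (hu.sub.interior i j s hs)
  exact hpos.of_subset_closure hcont continuousOn_const Ioi_subset_Ici_self (closure_Ioi 0).ge ht

theorem hasDerivAt (hu : IsLatticeSolution ε ε₂ σ Weps u₀ u) (hW : Continuous (deriv Weps)) (i : ℤ)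
    {t : ℝ} (ht : 0 < t) : HasDerivAt (u i 0) (boundaryForce ε ε₂ σ Weps u i t) t := by
  have hcont : ∀ i j, ContinuousOn (u i j) (Ioi 0) := fun i j =>
    (hu.continuousOn i j).mono Ioi_subset_Ici_self
  refine hasDerivAt_of_viscosity_solution (Ioi_mem_nhds ht) (hcont i 0) ?_
    (hu.sub.boundary i) (hu.super.boundary i)
  have hforce : ContinuousOn (fun s => deriv Weps (u i 0 s)) (Ioi 0) :=
    hW.comp_continuousOn (hcont i 0)
  unfold boundaryForce boundaryOperator
  fun_prop

end IsLatticeSolution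

/-! ### Weighted contractions and globally Lipschitz evolution equations -/

/-- The bound is the fixed point of `D ↦ B + q * D`. -/
theorem norm_sub_le_of_weighted_contraction {α E : Type*} [NormedAddCommGroup E] {w : α → ℝ}
    (hw : ∀ a, 0 < w a) {T : (α → E) → α → E} {u v : α → E} {B C q : ℝ} (hq1 : q < 1)
    (hlip : ∀ D, (∀ a, ‖v a - u a‖ ≤ D * w a) → ∀ a, ‖T v a - T u a‖ ≤ q * D * w a)
    (hu : T u = u) (hv : ∀ a, ‖v a - T v a‖ ≤ B * w a) (huv : ∀ a, ‖v a - u a‖ ≤ C * w a) (a : α) :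
    ‖v a - u a‖ ≤ B / (1 - q) * w a := by
  have : Nonempty α := ⟨a⟩
  have hbdd : BddAbove (range fun a => ‖v a - u a‖ / w a) :=
    ⟨C, forall_mem_range.2 fun a => (div_le_iff₀ (hw a)).2 (huv a)⟩
  have hsup : ∀ a, ‖v a - u a‖ ≤ (⨆ a, ‖v a - u a‖ / w a) * w a := fun a =>
    (div_le_iff₀ (hw a)).1 (le_ciSup hbdd a)
  have hself : (⨆ a, ‖v a - u a‖ / w a) ≤ B + q * ⨆ a, ‖v a - u a‖ / w a :=
    ciSup_le fun a => (div_le_iff₀ (hw a)).2 <| by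
      have h := hlip _ hsup a
      rw [hu] at h
      linarith [norm_sub_le_norm_sub_add_norm_sub (v a) (T v a) (u a), hv a]
  refine (hsup a).trans (mul_le_mul_of_nonneg_right ?_ (hw a).le)
  rw [le_div_iff₀ (by linarith)]
  linarith

/-- Dividing by the weight `w` turns `T` into a contraction of the bounded continuous functions. -/
theorem exists_fixedPoint_of_weighted_contraction {α E : Type*} [TopologicalSpace α]
    [NormedAddCommGroup E] [NormedSpace ℝ E] [CompleteSpace E] {w : α → ℝ} (hw : Continuous w)
    (hw_pos : ∀ a, 0 < w a) {T : (α → E) → α → E} {A q : ℝ} (hq : 0 ≤ q) (hq1 : q < 1)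
    (hcont : ∀ u, Continuous u → Continuous (T u)) (hzero : ∀ a, ‖T 0 a‖ ≤ A * w a)
    (hlip : ∀ u v, Continuous u → Continuous v → ∀ D, (∀ a, ‖u a - v a‖ ≤ D * w a) →
      ∀ a, ‖T u a - T v a‖ ≤ q * D * w a) :
    ∃ u, Continuous u ∧ (∃ C, ∀ a, ‖u a‖ ≤ C * w a) ∧ T u = u := by
  have hnorm_le : ∀ a (x : E) D, ‖(w a)⁻¹ • x‖ ≤ D ↔ ‖x‖ ≤ D * w a := fun a x D => by
    rw [norm_smul, Real.norm_of_nonneg (inv_nonneg.2 (hw_pos a).le), inv_mul_le_iff₀ (hw_pos a),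
      mul_comm]
  set U : (α →ᵇ E) → α → E := fun c a => w a • c a
  have hU : ∀ c, Continuous (U c) := fun c => hw.smul c.continuous
  have hU_sub : ∀ c c' a, ‖U c a - U c' a‖ ≤ dist c c' * w a := fun c c' a => by
    rw [← smul_sub, norm_smul, Real.norm_of_nonneg (hw_pos a).le, mul_comm, ← dist_eq_norm]
    exact mul_le_mul_of_nonneg_right (c.dist_coe_le_dist a) (hw_pos a).le
  have hTU : ∀ c a, ‖(w a)⁻¹ • T (U c) a‖ ≤ A + q * dist c 0 := fun c a => by
    rw [hnorm_le]
    have h := hlip (U c) 0 (hU c) continuous_zero (dist c 0)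
      (fun a => by simpa [U] using hU_sub c 0 a) a
    linarith [norm_le_norm_add_norm_sub' (T (U c) a) (T 0 a), hzero a]
  have hTU_cont : ∀ c, Continuous fun a => (w a)⁻¹ • T (U c) a := fun c =>
    (hw.inv₀ fun a => (hw_pos a).ne').smul (hcont _ (hU c))
  set Ψ : (α →ᵇ E) → α →ᵇ E := fun c => .ofNormedAddCommGroup _ (hTU_cont c) _ (hTU c)
  have hΨ : ContractingWith ⟨q, hq⟩ Ψ := by
    refine ⟨hq1, LipschitzWith.of_dist_le_mul fun c c' => ?_⟩
    refine (BoundedContinuousFunction.dist_le (by positivity)).2 fun a => ?_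
    change dist ((w a)⁻¹ • T (U c) a) ((w a)⁻¹ • T (U c') a) ≤ q * dist c c'
    rw [dist_eq_norm, ← smul_sub, hnorm_le]
    exact hlip _ _ (hU c) (hU c') _ (hU_sub c c') a
  set c₀ : α →ᵇ E := hΨ.fixedPoint
  refine ⟨U c₀, hU c₀, ⟨‖c₀‖, fun a => by simpa [U] using hU_sub c₀ 0 a⟩, funext fun a => ?_⟩
  have hc₀ : c₀ a = (w a)⁻¹ • T (U c₀) a := (DFunLike.congr_fun hΨ.fixedPoint_isFixedPt a).symm
  simp only [U, hc₀, smul_inv_smul₀ (hw_pos a).ne']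

theorem norm_integral_le_half_mul_exp {E : Type*} [NormedAddCommGroup E] [NormedSpace ℝ E]
    {f : ℝ → E} {K D t : ℝ} (hK : 0 ≤ K) (hD : 0 ≤ D) (ht : 0 ≤ t)
    (hf : ∀ s ∈ Icc 0 t, ‖f s‖ ≤ K * (D * Real.exp ((2 * K + 1) * s))) :
    ‖∫ s in (0 : ℝ)..t, f s‖ ≤ 1 / 2 * D * Real.exp ((2 * K + 1) * t) := by
  set l : ℝ := 2 * K + 1
  have hl : 0 < l := by positivity
  have hderiv : ∀ s, HasDerivAt (fun s => K * D / l * Real.exp (l * s))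
      (K * (D * Real.exp (l * s))) s := fun s => by
    have := (((hasDerivAt_id s).const_mul l).exp).const_mul (K * D / l)
    refine this.congr_deriv ?_
    simp only [id, mul_one]
    field_simp
  have hInt : IntervalIntegrable (fun s => K * (D * Real.exp (l * s))) volume 0 t :=
    (by fun_prop : Continuous _).intervalIntegrable 0 t
  calc ‖∫ s in (0 : ℝ)..t, f s‖ ≤ ∫ s in (0 : ℝ)..t, K * (D * Real.exp (l * s)) :=
        intervalIntegral.norm_integral_le_of_norm_le ht
          (Eventually.of_forall fun s hs => hf s (Ioc_subset_Icc_self hs)) hInt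
    _ = K * D / l * Real.exp (l * t) - K * D / l * Real.exp (l * 0) :=
        intervalIntegral.integral_eq_sub_of_hasDerivAt (fun s _ => hderiv s) hInt
    _ ≤ K / l * D * Real.exp (l * t) := by
        have : 0 ≤ K * D / l * Real.exp (l * 0) := by positivity
        have h : K / l * D * Real.exp (l * t) = K * D / l * Real.exp (l * t) := by ring
        linarith
    _ ≤ _ := by
        have : K / l ≤ 1 / 2 := (div_le_div_iff₀ hl two_pos).2 (by linarith)
        gcongr

theorem exists_global_solution_of_lipschitz {E : Type*} [NormedAddCommGroup E] [NormedSpace ℝ E]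
    [CompleteSpace E] {F : E → E} {K : NNReal} (hF : LipschitzWith K F) (y₀ : E) :
    ∃ y : ℝ → E, Continuous y ∧ y 0 = y₀ ∧ ∀ t > 0, HasDerivAt y (F (y t)) t := by
  set w : ℝ → ℝ := fun t => Real.exp ((2 * K + 1) * max t 0)
  set T : (ℝ → E) → ℝ → E := fun y t => y₀ + ∫ s in (0 : ℝ)..max t 0, F (y s)
  have hInt : ∀ y, Continuous y → ∀ a b, IntervalIntegrable (fun s => F (y s)) volume a b :=
    fun y hy => (hF.continuous.comp hy).intervalIntegrable
  have hcont : ∀ y, Continuous y → Continuous (T y) := fun y hy =>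
    continuous_const.add
      ((intervalIntegral.continuous_primitive (hInt y hy) 0).comp (by fun_prop))
  have hzero : ∀ t, ‖T 0 t‖ ≤ (‖y₀‖ + ‖F 0‖) * w t := fun t => by
    simp only [T, Pi.zero_apply, intervalIntegral.integral_const, sub_zero]
    have ht : 0 ≤ max t 0 := le_max_right t 0
    have hexp : max t 0 + 1 ≤ w t :=
      le_trans (by nlinarith [K.2, mul_nonneg K.2 ht]) (Real.add_one_le_exp _)
    grw [norm_add_le, norm_smul, Real.norm_of_nonneg ht, ← hexp]
    nlinarith [norm_nonneg y₀, norm_nonneg (F 0), mul_nonneg ht (norm_nonneg y₀)]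
  have hlip : ∀ u v, Continuous u → Continuous v → ∀ D, (∀ t, ‖u t - v t‖ ≤ D * w t) →
      ∀ t, ‖T u t - T v t‖ ≤ 1 / 2 * D * w t := fun u v hu hv D hD t => by
    have hD0 : 0 ≤ D := nonneg_of_mul_nonneg_left ((norm_nonneg _).trans (hD 0)) (Real.exp_pos _)
    rw [add_sub_add_left_eq_sub, ← intervalIntegral.integral_sub
      (hInt u hu _ _) (hInt v hv _ _)]
    refine norm_integral_le_half_mul_exp K.2 hD0 (le_max_right t 0) fun s hs => ?_
    refine (hF.norm_sub_le (u s) (v s)).trans (mul_le_mul_of_nonneg_left ?_ K.2)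
    simpa only [w, max_eq_left hs.1] using hD s
  obtain ⟨y, hy, -, hfix⟩ := exists_fixedPoint_of_weighted_contraction (w := w) (T := T)
    (by fun_prop) (fun t => Real.exp_pos _) (by norm_num) (by norm_num) hcont hzero hlip
  have hy_eq : ∀ t, 0 ≤ t → y t = y₀ + ∫ s in (0 : ℝ)..t, F (y s) := fun t ht => by
    simpa only [T, max_eq_left ht] using (congrFun hfix t).symm
  refine ⟨y, hy, by simpa using hy_eq 0 le_rfl, fun t ht => ?_⟩
  refine HasDerivAt.congr_of_eventuallyEq (((hF.continuous.comp hy).integral_hasStrictDerivAt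
    0 t).hasDerivAt.const_add y₀) ?_
  filter_upwards [lt_mem_nhds ht] with s hs using hy_eq s hs.le

/-! ### Discrete harmonic extension -/

/-- Jacobi iterates, started from the constant `M` above the boundary, for the discrete Dirichlet
problem with boundary values `b`. -/
noncomputable def jacobiIterate (b : ℤ → ℝ) (M : ℝ) : ℕ → ℤ → ℕ → ℝ
  | _, i, 0 => b i
  | 0, _, _ + 1 => M
  | n + 1, i, j + 1 => (jacobiIterate b M n (i + 1) (j + 1) + jacobiIterate b M n (i - 1) (j + 1) +
      jacobiIterate b M n i (j + 2) + jacobiIterate b M n i j) / 4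

lemma jacobiIterate_boundary (b : ℤ → ℝ) (M : ℝ) (n : ℕ) (i : ℤ) :
    jacobiIterate b M n i 0 = b i := by
  cases n <;> rw [jacobiIterate]

lemma jacobiIterate_succ (b : ℤ → ℝ) (M : ℝ) (n : ℕ) (i : ℤ) (j : ℕ) :
    jacobiIterate b M (n + 1) i (j + 1) = (jacobiIterate b M n (i + 1) (j + 1) +
      jacobiIterate b M n (i - 1) (j + 1) + jacobiIterate b M n i (j + 2) +
      jacobiIterate b M n i j) / 4 := by
  rw [jacobiIterate]

section JacobiBounds

variable {b : ℤ → ℝ} {M : ℝ}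

lemma abs_jacobiIterate_le (hb : ∀ i, |b i| ≤ M) (n : ℕ) (i : ℤ) (j : ℕ) :
    |jacobiIterate b M n i j| ≤ M := by
  induction n generalizing i j with
  | zero =>
    cases j with
    | zero => exact (jacobiIterate_boundary b M 0 i).symm ▸ hb i
    | succ j => rw [jacobiIterate, abs_of_nonneg ((abs_nonneg _).trans (hb 0))]
  | succ n ih =>
    cases j with
    | zero => exact (jacobiIterate_boundary b M _ i).symm ▸ hb i
    | succ j =>
      have hE := abs_le.1 (ih (i + 1) (j + 1))
      have hW := abs_le.1 (ih (i - 1) (j + 1))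
      have hN := abs_le.1 (ih i (j + 2))
      have hS := abs_le.1 (ih i j)
      rw [jacobiIterate_succ, abs_le]
      constructor <;> linarith

lemma antitone_jacobiIterate (hb : ∀ i, |b i| ≤ M) (i : ℤ) (j : ℕ) :
    Antitone fun n => jacobiIterate b M n i j := by
  refine antitone_nat_of_succ_le fun n => ?_
  induction n generalizing i j with
  | zero =>
    cases j with
    | zero => simp only [jacobiIterate_boundary, le_refl]
    | succ j => exact (le_abs_self _).trans (abs_jacobiIterate_le hb 1 i (j + 1))
  | succ n ih =>
    cases j with
    | zero => simp only [jacobiIterate_boundary, le_refl]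
    | succ j =>
      linarith [jacobiIterate_succ b M (n + 1) i j, jacobiIterate_succ b M n i j,
        ih (i + 1) (j + 1), ih (i - 1) (j + 1), ih i (j + 2), ih i j]

end JacobiBounds

/-- The bounded discrete harmonic function on `ℤ × ℕ` with boundary values `b`. -/
noncomputable def harmonicExtension (b : ℤ →ᵇ ℝ) (i : ℤ) (j : ℕ) : ℝ :=
  ⨅ n, jacobiIterate b ‖b‖ n i j

section HarmonicExtension

variable (b b' : ℤ →ᵇ ℝ) (i : ℤ) (j : ℕ)

lemma tendsto_jacobiIterate :
    Tendsto (fun n => jacobiIterate b ‖b‖ n i j) atTop (𝓝 (harmonicExtension b i j)) :=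
  tendsto_atTop_ciInf (antitone_jacobiIterate b.norm_coe_le_norm i j)
    ⟨-‖b‖, forall_mem_range.2 fun n => (abs_le.1 (abs_jacobiIterate_le b.norm_coe_le_norm n i j)).1⟩

lemma harmonicExtension_boundary : harmonicExtension b i 0 = b i := by
  simp only [harmonicExtension, jacobiIterate_boundary, ciInf_const]

lemma abs_harmonicExtension_le : |harmonicExtension b i j| ≤ ‖b‖ :=
  le_of_tendsto' (tendsto_jacobiIterate b i j).abs fun n =>
    abs_jacobiIterate_le b.norm_coe_le_norm n i j

lemma harmonicExtension_mean_value :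
    4 * harmonicExtension b i (j + 1) = harmonicExtension b (i + 1) (j + 1) +
      harmonicExtension b (i - 1) (j + 1) + harmonicExtension b i (j + 2) +
      harmonicExtension b i j := by
  have hmean := ((((tendsto_jacobiIterate b (i + 1) (j + 1)).add
    (tendsto_jacobiIterate b (i - 1) (j + 1))).add (tendsto_jacobiIterate b i (j + 2))).add
    (tendsto_jacobiIterate b i j)).div_const 4
  have hsucc := (tendsto_jacobiIterate b i (j + 1)).comp (tendsto_add_atTop_nat 1)
  have := tendsto_nhds_unique hsucc (hmean.congr fun n => (jacobiIterate_succ b ‖b‖ n i j).symm)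
  linarith

lemma harmonicExtension_sub_le :
    harmonicExtension b i j - harmonicExtension b' i j ≤ ‖b - b'‖ := by
  refine discrete_maximum_principle (M := ‖b‖ + ‖b'‖)
    (w := fun i j => harmonicExtension b i j - harmonicExtension b' i j)
    (fun i j => ?_) (fun i j => ?_) (fun i => ?_) i j
  · linarith [(abs_le.1 (abs_harmonicExtension_le b i j)).2,
      (abs_le.1 (abs_harmonicExtension_le b' i j)).1]
  · linarith [harmonicExtension_mean_value b i j, harmonicExtension_mean_value b' i j]
  · rw [harmonicExtension_boundary, harmonicExtension_boundary]
    exact (le_abs_self _).trans ((b - b').norm_coe_le_norm i)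

lemma abs_harmonicExtension_sub_le :
    |harmonicExtension b i j - harmonicExtension b' i j| ≤ ‖b - b'‖ :=
  abs_sub_le_iff.2 ⟨harmonicExtension_sub_le b b' i j,
    norm_sub_rev b b' ▸ harmonicExtension_sub_le b' b i j⟩

lemma continuous_harmonicExtension : Continuous fun b => harmonicExtension b i j :=
  (LipschitzWith.of_dist_le' (K := 1) fun b b' => by
    rw [Real.dist_eq, dist_eq_norm, one_mul]
    exact abs_harmonicExtension_sub_le b b' i j).continuous

end HarmonicExtension

/-! ### Well-posedness of the lattice system -/

lemma abs_boundaryOperator_le {ε D t : ℝ} (hε : 0 < ε) {u : ℤ → ℕ → ℝ → ℝ} {i : ℤ}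
    (hu : ∀ i j, |u i j t| ≤ D) : |boundaryOperator ε u i t| ≤ 1 / ε * (6 * D) := by
  rw [boundaryOperator, abs_mul, abs_of_pos (by positivity : 0 < 1 / ε)]
  gcongr
  have h := fun i j => abs_le.1 (hu i j)
  rw [abs_le]
  constructor <;> linarith [h i 0, h (i + 1) 0, h (i - 1) 0, h i 1]

lemma boundaryForce_sub (ε ε₂ : ℝ) (σ Weps : ℝ → ℝ) (u v : ℤ → ℕ → ℝ → ℝ) (i : ℤ) (t : ℝ) :
    boundaryForce ε ε₂ σ Weps u i t - boundaryForce ε ε₂ σ Weps v i t =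
      boundaryOperator ε (fun i j s => u i j s - v i j s) i t -
        (deriv Weps (u i 0 t) - deriv Weps (v i 0 t)) := by
  rw [boundaryOperator_sub, boundaryForce, boundaryForce]
  ring

theorem exists_lipschitz_boundaryForce {ε : ℝ} (hε : 0 < ε) (ε₂ : ℝ) {σ Weps : ℝ → ℝ}
    (hσ : ∃ C, ∀ x, |σ x| ≤ C) (hW : IsBoundedLipschitz (deriv Weps)) :
    ∃ (K : NNReal) (F : (ℤ →ᵇ ℝ) → ℤ →ᵇ ℝ), LipschitzWith K F ∧
      ∀ b i t, F b i = boundaryForce ε ε₂ σ Weps (fun i j _ => harmonicExtension b i j) i t := by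
  obtain ⟨C, hC⟩ := hσ
  obtain ⟨B, hB⟩ := hW.bounded
  obtain ⟨K, hK, hlip⟩ := hW.exists_abs_sub_le
  have hbound : ∀ (b : ℤ →ᵇ ℝ) (i : ℤ),
      ‖boundaryForce ε ε₂ σ Weps (fun i j _ => harmonicExtension b i j) i 0‖ ≤
        |2 * ε₂| * C + B + 1 / ε * (6 * ‖b‖) := fun b i => by
    rw [boundaryForce]
    refine norm_add_le_of_le (norm_sub_le_of_le ?_ (hB _))
      (abs_boundaryOperator_le hε (abs_harmonicExtension_le b))
    rw [norm_mul]
    exact mul_le_mul_of_nonneg_left (hC _) (abs_nonneg _)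
  have hK' : 0 ≤ 6 / ε + K := by positivity
  refine ⟨⟨6 / ε + K, hK'⟩, fun b =>
    .ofNormedAddCommGroup _ continuous_of_discreteTopology _ (hbound b), ?_, fun _ _ _ => rfl⟩
  refine LipschitzWith.of_dist_le_mul fun b b' => ?_
  refine (BoundedContinuousFunction.dist_le (mul_nonneg hK' dist_nonneg)).2 fun i => ?_
  rw [dist_eq_norm b b', Real.dist_eq, BoundedContinuousFunction.coe_ofNormedAddCommGroup,
    BoundedContinuousFunction.coe_ofNormedAddCommGroup, boundaryForce_sub]
  calc _ ≤ 1 / ε * (6 * ‖b - b'‖) + K * ‖b - b'‖ := by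
        refine (abs_sub _ _).trans (add_le_add
          (abs_boundaryOperator_le hε (abs_harmonicExtension_sub_le b b')) ((hlip _ _).trans ?_))
        exact mul_le_mul_of_nonneg_left (abs_harmonicExtension_sub_le b b' i 0) hK
    _ = (6 / ε + K) * ‖b - b'‖ := by ring

/-- Approximate solutions on `[0, T]`, bounded by `M`, of the lattice system in which the stress and
the potential together exert the force `F i` at the site `i`, with initial data `b`: all residuals
are at most `η`. -/
structure IsApproxLatticeSolution (ε T η M : ℝ) (F : ℤ → ℝ → ℝ) (b : ℤ → ℝ)
    (u : ℤ → ℕ → ℝ → ℝ) : Prop where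
  continuousOn : ∀ i j, ContinuousOn (u i j) (Icc 0 T)
  abs_apply_le : ∀ i j, ∀ t ∈ Icc 0 T, |u i j t| ≤ M
  interior : ∀ i j, ∀ t ∈ Icc 0 T, |discreteLaplacian ε u i j t| ≤ η
  boundary : ∀ i, ∀ t ∈ Ioc 0 T, ∃ d, HasDerivAt (u i 0) d t ∧
    |d - (F i (u i 0 t) + boundaryOperator ε u i t)| ≤ η
  initial : ∀ i, |u i 0 0 - b i| ≤ η

theorem IsApproxLatticeSolution.isApproxSubsolution_sub {ε T η η' M M' K : ℝ} {F : ℤ → ℝ → ℝ}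
    {b : ℤ → ℝ} {u v : ℤ → ℕ → ℝ → ℝ} (hu : IsApproxLatticeSolution ε T η M F b u)
    (hv : IsApproxLatticeSolution ε T η' M' F b v) (hF : ∀ i r s, |F i r - F i s| ≤ K * |r - s|) :
    IsApproxSubsolution ε T K (η + η') (M + M') fun i j t => u i j t - v i j t where
  continuousOn i j := (hu.continuousOn i j).sub (hv.continuousOn i j)
  le i j t ht := by
    linarith [(abs_le.1 (hu.abs_apply_le i j t ht)).2, (abs_le.1 (hv.abs_apply_le i j t ht)).1]
  interior i j t ht := by
    rw [discreteLaplacian_sub]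
    linarith [(abs_le.1 (hu.interior i j t ht)).1, (abs_le.1 (hv.interior i j t ht)).2]
  boundary i t ht hpos := by
    obtain ⟨d, hd, hdu⟩ := hu.boundary i t ht
    obtain ⟨d', hd', hdv⟩ := hv.boundary i t ht
    refine ⟨d - d', hd.sub hd', ?_⟩
    have hforce := abs_of_pos hpos ▸ hF i (u i 0 t) (v i 0 t)
    rw [boundaryOperator_sub]
    linarith [le_of_abs_le hforce, le_of_abs_le hdu, neg_le_of_abs_le hdv]
  initial i := by
    linarith [(abs_le.1 (hu.initial i)).2, (abs_le.1 (hv.initial i)).1]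

namespace IsLatticeSolution

variable {ε ε₂ : ℝ} {σ Weps : ℝ → ℝ} {u₀ : Plane → ℝ} {u v : ℤ → ℕ → ℝ → ℝ}

lemma of_hasDerivAt (hcont : ∀ i j, ContinuousOn (u i j) (Ici 0))
    (hlap : ∀ i j, ∀ t > 0, discreteLaplacian ε u i j t = 0)
    (hderiv : ∀ i, ∀ t > 0, HasDerivAt (u i 0) (boundaryForce ε ε₂ σ Weps u i t) t)
    (hinit : ∀ i, u i 0 0 = u₀ (latticePoint ε i 0))
    (hbdd : ∀ T : ℝ, ∃ C : ℝ, ∀ i j, ∀ t ∈ Icc 0 T, |u i j t| ≤ C) :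
    IsLatticeSolution ε ε₂ σ Weps u₀ u := by
  have htest : ∀ i, ∀ t > 0, ∀ φ : ℝ → ℝ, ContDiff ℝ 1 φ →
      IsLocalExtr (fun s => u i 0 s - φ s) t → boundaryForce ε ε₂ σ Weps u i t = deriv φ t :=
    fun i t ht φ hφ hloc => sub_eq_zero.1 <| hloc.hasDerivAt_eq_zero <|
      (hderiv i t ht).sub (hφ.differentiable one_ne_zero t).hasDerivAt
  exact
    { sub :=
        { usc := fun i j => (hcont i j).upperSemicontinuousOn
          interior := fun i j t ht => (hlap i j t ht).ge
          boundary := fun i t ht φ hφ hmax => (htest i t ht φ hφ hmax.isExtr).ge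
          initial := fun i => (hinit i).le }
      super :=
        { lsc := fun i j => (hcont i j).lowerSemicontinuousOn
          interior := fun i j t ht => (hlap i j t ht).le
          boundary := fun i t ht φ hφ hmin => (htest i t ht φ hφ hmin.isExtr).le
          initial := fun i => (hinit i).ge }
      bounded := hbdd }

lemma isApproxLatticeSolution (hu : IsLatticeSolution ε ε₂ σ Weps u₀ u)
    (hWeps : Continuous (deriv Weps)) {W : ℝ → ℝ} {T κ B : ℝ} (hκ : 0 ≤ κ)
    (hW : ∀ a, |deriv W a - deriv Weps a| ≤ κ) (hB : ∀ i j, ∀ t ∈ Icc 0 T, |u i j t| ≤ B) :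
    IsApproxLatticeSolution ε T κ B (fun i r => 2 * ε₂ * σ (ε₂ * (ε * i)) - deriv W r)
      (fun i => u₀ (latticePoint ε i 0)) u where
  continuousOn i j := (hu.continuousOn i j).mono Icc_subset_Ici_self
  abs_apply_le := hB
  interior i j t ht := by rwa [hu.discreteLaplacian_eq_zero i j ht.1, abs_zero]
  boundary i t ht := by
    refine ⟨_, hu.hasDerivAt hWeps i ht.1, ?_⟩
    rw [boundaryForce, add_sub_add_right_eq_sub, sub_sub_sub_cancel_left]
    exact hW _
  initial i := by rwa [hu.initial_eq, sub_self, abs_zero]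

theorem le (hε : 0 < ε) (hW : IsBoundedLipschitz (deriv Weps))
    (hu : IsLatticeSolution ε ε₂ σ Weps u₀ u) (hv : IsLatticeSolution ε ε₂ σ Weps u₀ v)
    (i : ℤ) (j : ℕ) {t : ℝ} (ht : 0 ≤ t) : u i j t ≤ v i j t := by
  obtain ⟨K, hK, hlip⟩ := hW.exists_abs_sub_le
  have happrox : ∀ w, IsLatticeSolution ε ε₂ σ Weps u₀ w → ∃ B, IsApproxLatticeSolution ε t 0 B
      (fun i r => 2 * ε₂ * σ (ε₂ * (ε * i)) - deriv Weps r) (fun i => u₀ (latticePoint ε i 0)) w :=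
    fun w hw => (hw.bounded t).imp fun B hB =>
      hw.isApproxLatticeSolution hW.continuous le_rfl (by simp) hB
  obtain ⟨B, hu⟩ := happrox u hu
  obtain ⟨B', hv⟩ := happrox v hv
  have hsub := hu.isApproxSubsolution_sub hv fun i a b => by
    rw [sub_sub_sub_cancel_left, abs_sub_comm]
    exact hlip a b
  rw [add_zero] at hsub
  exact sub_nonpos.1 (hsub.nonpos hε hK i j ⟨ht, le_rfl⟩)

end IsLatticeSolution

theorem exists_isLatticeSolution {ε ε₂ : ℝ} (hε : 0 < ε) {σ Weps : ℝ → ℝ} {u₀ : Plane → ℝ}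
    (hσ : ∃ C, ∀ x, |σ x| ≤ C) (hW : IsBoundedLipschitz (deriv Weps))
    (hu₀ : ∃ C, ∀ i, |u₀ (latticePoint ε i 0)| ≤ C) :
    ∃ u, IsLatticeSolution ε ε₂ σ Weps u₀ u := by
  obtain ⟨K, F, hF, hF_eq⟩ := exists_lipschitz_boundaryForce hε ε₂ hσ hW
  obtain ⟨C, hC⟩ := hu₀
  obtain ⟨y, hy, hy0, hy_deriv⟩ := exists_global_solution_of_lipschitz hF
    (.ofNormedAddCommGroup (fun i => u₀ (latticePoint ε i 0)) continuous_of_discreteTopology C hC)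
  have hbdry : ∀ i t, harmonicExtension (y t) i 0 = y t i := fun i t =>
    harmonicExtension_boundary (y t) i
  refine ⟨fun i j t => harmonicExtension (y t) i j, .of_hasDerivAt
    (fun i j => ((continuous_harmonicExtension i j).comp hy).continuousOn) (fun i j t _ => ?_)
    (fun i t ht => ?_) (fun i => ?_) (fun T => ?_)⟩
  · refine mul_eq_zero_of_right _ ?_
    linarith [harmonicExtension_mean_value (y t) i j]
  · have h := (BoundedContinuousFunction.evalCLM ℝ i).hasFDerivAt.comp_hasDerivAt t (hy_deriv t ht)
    simp only [hbdry]
    exact h.congr_deriv (hF_eq (y t) i t)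
  · rw [hbdry, hy0]
    rfl
  · obtain ⟨C, hC⟩ := isCompact_Icc.exists_bound_of_continuousOn (hy.continuousOn (s := Icc 0 T))
    exact ⟨C, fun i j t ht => (abs_harmonicExtension_le (y t) i j).trans (hC t ht)⟩

/-! ### Poisson averages -/

/-- The density of the standard Cauchy distribution, i.e. the Poisson kernel at height one. -/
noncomputable def cauchyDensity (z : ℝ) : ℝ := Real.pi⁻¹ * (1 + z ^ 2)⁻¹

lemma cauchyDensity_nonneg (z : ℝ) : 0 ≤ cauchyDensity z := by
  unfold cauchyDensity; positivity

lemma cauchyDensity_neg (z : ℝ) : cauchyDensity (-z) = cauchyDensity z := by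
  simp [cauchyDensity]

lemma continuous_cauchyDensity : Continuous cauchyDensity :=
  continuous_const.mul ((by fun_prop : Continuous fun z : ℝ => 1 + z ^ 2).inv₀
    fun z => by positivity)

lemma integrable_cauchyDensity : Integrable cauchyDensity :=
  integrable_inv_one_add_sq.const_mul _

lemma integral_cauchyDensity : ∫ z, cauchyDensity z = 1 := by
  unfold cauchyDensity
  rw [integral_const_mul, integral_univ_inv_one_add_sq, inv_mul_cancel₀ Real.pi_ne_zero]

lemma integrable_cauchyDensity_mul {f : ℝ → ℝ} {M : ℝ} (hf : Continuous f)
    (hM : ∀ z, |f z| ≤ M) : Integrable fun z => cauchyDensity z * f z :=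
  integrable_cauchyDensity.mul_bdd (c := M) hf.aestronglyMeasurable (Eventually.of_forall hM)

lemma norm_cauchyDensity_mul_le {a b : ℝ} (z : ℝ) (h : |a| ≤ b) :
    ‖cauchyDensity z * a‖ ≤ cauchyDensity z * b := by
  rw [norm_mul, Real.norm_of_nonneg (cauchyDensity_nonneg z)]
  exact mul_le_mul_of_nonneg_left h (cauchyDensity_nonneg z)

lemma abs_integral_cauchyDensity_mul_le {f : ℝ → ℝ} {M : ℝ} (hM : ∀ z, |f z| ≤ M) :
    |∫ z, cauchyDensity z * f z| ≤ M := by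
  have h := norm_integral_le_of_norm_le (integrable_cauchyDensity.mul_const M)
    (Eventually.of_forall fun z => norm_cauchyDensity_mul_le z (hM z))
  rwa [integral_mul_const, integral_cauchyDensity, one_mul] at h

lemma continuous_integral_cauchyDensity_mul {α : Type*} [TopologicalSpace α]
    [FirstCountableTopology α] {f : α → ℝ → ℝ} {M : ℝ}
    (hf : Continuous fun p : α × ℝ => f p.1 p.2) (hM : ∀ a z, |f a z| ≤ M) :
    Continuous fun a => ∫ z, cauchyDensity z * f a z := by
  refine continuous_of_dominated (bound := fun z => cauchyDensity z * M) (fun a => ?_)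
    (fun a => Eventually.of_forall fun z => norm_cauchyDensity_mul_le z (hM a z))
    (integrable_cauchyDensity.mul_const M) (Eventually.of_forall fun z => ?_)
  · exact (continuous_cauchyDensity.mul (hf.comp (.prodMk_right a))).aestronglyMeasurable
  · exact continuous_const.mul (hf.comp (.prodMk_left z))

/-- The Poisson integral of `h` at the point `(x, τ)`, rescaled so that it makes sense, and equals
`h x`, at `τ = 0`. -/
noncomputable def poissonAvg (τ : ℝ) (h : ℝ → ℝ) (x : ℝ) : ℝ :=
  ∫ z, cauchyDensity z * h (x + τ * z)

/-- The derivative of the Poisson integral of `h` in the direction normal to the boundary. -/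
noncomputable def poissonDeriv (τ : ℝ) (h : ℝ → ℝ) (x : ℝ) : ℝ :=
  τ⁻¹ * ∫ z, cauchyDensity z * ((z ^ 2 - 1) / (z ^ 2 + 1) * h (x + τ * z))

lemma poissonAvg_zero (h : ℝ → ℝ) (x : ℝ) : poissonAvg 0 h x = h x := by
  simp only [poissonAvg, zero_mul, add_zero, integral_mul_const, integral_cauchyDensity, one_mul]

lemma abs_poissonAvg_sub_le {h h' : ℝ → ℝ} {τ τ' x x' M M' : ℝ} {D : ℝ → ℝ}
    (hc : Continuous h) (hc' : Continuous h') (hM : ∀ w, |h w| ≤ M) (hM' : ∀ w, |h' w| ≤ M')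
    (hDi : Integrable fun z => cauchyDensity z * D z)
    (hD : ∀ z, |h (x + τ * z) - h' (x' + τ' * z)| ≤ D z) :
    |poissonAvg τ h x - poissonAvg τ' h' x'| ≤ ∫ z, cauchyDensity z * D z := by
  unfold poissonAvg
  rw [← integral_sub (integrable_cauchyDensity_mul (by fun_prop) fun z => hM _)
    (integrable_cauchyDensity_mul (by fun_prop) fun z => hM' _)]
  simp only [← mul_sub]
  exact norm_integral_le_of_norm_le hDi
    (Eventually.of_forall fun z => norm_cauchyDensity_mul_le z (hD z))

lemma abs_poissonAvg_sub_le_const {h h' : ℝ → ℝ} {τ τ' x x' M M' D : ℝ}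
    (hc : Continuous h) (hc' : Continuous h') (hM : ∀ w, |h w| ≤ M) (hM' : ∀ w, |h' w| ≤ M')
    (hD : ∀ z, |h (x + τ * z) - h' (x' + τ' * z)| ≤ D) :
    |poissonAvg τ h x - poissonAvg τ' h' x'| ≤ D := by
  have := abs_poissonAvg_sub_le hc hc' hM hM' (integrable_cauchyDensity.mul_const D) hD
  rwa [integral_mul_const, integral_cauchyDensity, one_mul] at this

lemma abs_poissonAvg_le {h : ℝ → ℝ} {M : ℝ} (hM : ∀ w, |h w| ≤ M) (τ x : ℝ) :
    |poissonAvg τ h x| ≤ M :=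
  abs_integral_cauchyDensity_mul_le fun _ => hM _

lemma abs_sq_sub_div_le_one (z : ℝ) : |(z ^ 2 - 1) / (z ^ 2 + 1)| ≤ 1 := by
  rw [abs_div, abs_of_pos (by positivity : 0 < z ^ 2 + 1), div_le_one (by positivity), abs_le]
  constructor <;> nlinarith [sq_nonneg z]

lemma continuous_sq_sub_div : Continuous fun z : ℝ => (z ^ 2 - 1) / (z ^ 2 + 1) :=
  Continuous.div (by fun_prop) (by fun_prop) fun z => by positivity

section Continuity

variable {α : Type*} [TopologicalSpace α] [FirstCountableTopology α] {h : α → ℝ → ℝ}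
  {τ x : α → ℝ} {M : ℝ}

lemma continuous_poissonAvg (hh : Continuous fun p : α × ℝ => h p.1 p.2)
    (hM : ∀ a w, |h a w| ≤ M) (hτ : Continuous τ) (hx : Continuous x) :
    Continuous fun a => poissonAvg (τ a) (h a) (x a) :=
  continuous_integral_cauchyDensity_mul
    (hh.comp (by fun_prop : Continuous fun p : α × ℝ => (p.1, x p.1 + τ p.1 * p.2)))
    fun _ _ => hM _ _

lemma continuousOn_poissonDeriv (hh : Continuous fun p : α × ℝ => h p.1 p.2)
    (hM : ∀ a w, |h a w| ≤ M) (hτ : Continuous τ) (hx : Continuous x) :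
    ContinuousOn (fun a => poissonDeriv (τ a) (h a) (x a)) {a | τ a ≠ 0} := by
  refine (hτ.continuousOn.inv₀ fun a ha => ha).mul (Continuous.continuousOn
    (continuous_integral_cauchyDensity_mul (M := M) ?_ fun a z => ?_))
  · exact (continuous_sq_sub_div.comp continuous_snd).mul
      (hh.comp (by fun_prop : Continuous fun p : α × ℝ => (p.1, x p.1 + τ p.1 * p.2)))
  · rw [abs_mul]
    exact (mul_le_of_le_one_left (abs_nonneg _) (abs_sq_sub_div_le_one z)).trans (hM _ _)

end Continuity

/-! ### The Poisson kernel as a function of a complex variable -/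

/-- The Poisson kernel of the half-plane. -/
noncomputable def poissonKer (z : ℂ) : ℝ := -(Real.pi⁻¹ * (z⁻¹).im)

/-- The normal derivative of the Poisson kernel of the half-plane. -/
noncomputable def poissonKerDeriv (z : ℂ) : ℝ := Real.pi⁻¹ * ((z ^ 2)⁻¹).re

lemma poissonKer_eq (z : ℂ) : poissonKer z = Real.pi⁻¹ * (z.im / ‖z‖ ^ 2) := by
  rw [poissonKer, Complex.inv_im, Complex.normSq_eq_norm_sq]
  ring

lemma poissonKer_mk (a : ℝ) {τ : ℝ} (hτ : 0 < τ) :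
    poissonKer ⟨a, τ⟩ = τ⁻¹ * cauchyDensity (a / τ) := by
  rw [poissonKer_eq, ← Complex.normSq_eq_norm_sq, Complex.normSq_mk, cauchyDensity]
  field_simp
  ring

lemma poissonKerDeriv_mk (a : ℝ) {τ : ℝ} (hτ : 0 < τ) : poissonKerDeriv ⟨a, τ⟩ =
    τ⁻¹ * (τ⁻¹ * (cauchyDensity (a / τ) * (((a / τ) ^ 2 - 1) / ((a / τ) ^ 2 + 1)))) := by
  have : 0 < a ^ 2 + τ ^ 2 := by positivity
  rw [poissonKerDeriv, Complex.inv_re, map_pow, Complex.normSq_mk, cauchyDensity,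
    sq (Complex.mk a τ), Complex.mul_re]
  field_simp
  ring

lemma integrable_poissonKer (x : ℝ) {τ : ℝ} (hτ : 0 < τ) :
    Integrable fun w : ℝ => poissonKer ⟨x - w, τ⟩ := by
  simp_rw [poissonKer_mk _ hτ]
  exact ((integrable_cauchyDensity.comp_div hτ.ne').comp_sub_left x).const_mul _

lemma integral_cauchyDensity_mul_comp_add_mul (f h : ℝ → ℝ) (x : ℝ) {τ : ℝ} (hτ : 0 < τ) :
    ∫ z, cauchyDensity z * (f (z ^ 2) * h (x + τ * z)) =
      ∫ w, τ⁻¹ * cauchyDensity ((x - w) / τ) * f (((x - w) / τ) ^ 2) * h w := by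
  have hz : ∀ z, (x - (x + τ * z)) / τ = -z := fun z => by field_simp; ring
  have hsubst := Measure.integral_comp_mul_left (fun w =>
    cauchyDensity ((x - (x + w)) / τ) * (f (((x - (x + w)) / τ) ^ 2) * h (x + w))) τ
  simp only [hz, cauchyDensity_neg, neg_sq, abs_of_pos (inv_pos.2 hτ), smul_eq_mul] at hsubst
  rw [hsubst, integral_add_left_eq_self (fun w =>
    cauchyDensity ((x - w) / τ) * (f (((x - w) / τ) ^ 2) * h w)), ← integral_const_mul]
  simp only [mul_assoc]

lemma poissonAvg_eq_integral_poissonKer (h : ℝ → ℝ) (x : ℝ) {τ : ℝ} (hτ : 0 < τ) :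
    poissonAvg τ h x = ∫ w, poissonKer ⟨x - w, τ⟩ * h w := by
  simpa only [one_mul, mul_one, poissonAvg, poissonKer_mk _ hτ] using
    integral_cauchyDensity_mul_comp_add_mul (fun _ => 1) h x hτ

lemma poissonDeriv_eq_integral_poissonKerDeriv (h : ℝ → ℝ) (x : ℝ) {τ : ℝ} (hτ : 0 < τ) :
    poissonDeriv τ h x = ∫ w, poissonKerDeriv ⟨x - w, τ⟩ * h w := by
  rw [poissonDeriv, integral_cauchyDensity_mul_comp_add_mul (fun s => (s - 1) / (s + 1)) h x hτ,
    ← integral_const_mul]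
  simp only [poissonKerDeriv_mk _ hτ, mul_assoc]

lemma integral_poissonKer (x : ℝ) {τ : ℝ} (hτ : 0 < τ) :
    ∫ w, poissonKer ⟨x - w, τ⟩ = 1 := by
  simpa only [poissonAvg, mul_one, integral_cauchyDensity] using
    (poissonAvg_eq_integral_poissonKer (fun _ => 1) x hτ).symm

lemma integrable_poissonKer_mul {h : ℝ → ℝ} {M : ℝ} (hc : Continuous h) (hM : ∀ w, |h w| ≤ M)
    (x : ℝ) {τ : ℝ} (hτ : 0 < τ) : Integrable fun w : ℝ => poissonKer ⟨x - w, τ⟩ * h w :=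
  (integrable_poissonKer x hτ).mul_bdd (c := M) hc.aestronglyMeasurable (Eventually.of_forall hM)

lemma integrable_poissonKerDeriv_mul {h : ℝ → ℝ} {M : ℝ} (hc : Continuous h)
    (hM : ∀ w, |h w| ≤ M) (x : ℝ) {τ : ℝ} (hτ : 0 < τ) :
    Integrable fun w : ℝ => poissonKerDeriv ⟨x - w, τ⟩ * h w := by
  refine Integrable.mul_bdd (c := M) ?_ hc.aestronglyMeasurable (Eventually.of_forall hM)
  simp_rw [poissonKerDeriv_mk _ hτ]
  refine ((((integrable_cauchyDensity.comp_div hτ.ne').comp_sub_left x).mul_bdd (c := 1) ?_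
    (Eventually.of_forall fun w => abs_sq_sub_div_le_one _)).const_mul _).const_mul _
  exact (continuous_sq_sub_div.comp
    (by fun_prop : Continuous fun w : ℝ => (x - w) / τ)).aestronglyMeasurable

lemma abs_integral_mul_le_of_abs_le_poissonKer {κ h : ℝ → ℝ} {M C x τ : ℝ} (hτ : 0 < τ)
    (hM : ∀ w, |h w| ≤ M) (hκ : ∀ w, |κ w| ≤ C * poissonKer ⟨x - w, τ⟩) :
    |∫ w, κ w * h w| ≤ C * M := by
  have hbound : ∀ w, ‖κ w * h w‖ ≤ poissonKer ⟨x - w, τ⟩ * (C * M) := fun w => calc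
    ‖κ w * h w‖ = |κ w| * |h w| := abs_mul _ _
    _ ≤ C * poissonKer ⟨x - w, τ⟩ * M :=
      mul_le_mul (hκ w) (hM w) (abs_nonneg _) ((abs_nonneg _).trans (hκ w))
    _ = _ := by ring
  have h := norm_integral_le_of_norm_le ((integrable_poissonKer x hτ).mul_const _)
    (Eventually.of_forall hbound)
  rwa [integral_mul_const, integral_poissonKer x hτ, one_mul] at h

lemma abs_im_le_poissonKer {z ζ : ℂ} {C : ℝ} (h : ‖ζ‖ ≤ C * (z.im / ‖z‖ ^ 2)) :
    |-(Real.pi⁻¹ * ζ.im)| ≤ C * poissonKer z := by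
  have hpi : (0 : ℝ) < Real.pi⁻¹ := by positivity
  rw [poissonKer_eq, abs_neg, abs_mul, abs_of_pos hpi]
  calc Real.pi⁻¹ * |ζ.im| ≤ Real.pi⁻¹ * (C * (z.im / ‖z‖ ^ 2)) := by
        gcongr; exact (Complex.abs_im_le_norm ζ).trans h
    _ = _ := by ring

section KernelEstimates

variable {z ζ : ℂ} {ε : ℝ}

lemma im_le_norm (z : ℂ) : z.im ≤ ‖z‖ :=
  (le_abs_self _).trans (Complex.abs_im_le_norm z)

lemma half_im_le_norm_add (hζ : ‖ζ‖ ≤ z.im / 2) : z.im / 2 ≤ ‖z + ζ‖ := by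
  have h := norm_sub_norm_le z (-ζ)
  rw [norm_neg, sub_neg_eq_add] at h
  linarith [im_le_norm z]

lemma add_ne_zero_of_norm_le (hz : 0 < z.im) (hζ : ‖ζ‖ ≤ z.im / 2) : z + ζ ≠ 0 :=
  norm_pos_iff.1 ((half_pos hz).trans_le (half_im_le_norm_add hζ))

lemma sub_ne_zero_of_norm_le (hz : 0 < z.im) (hζ : ‖ζ‖ ≤ z.im / 2) : z - ζ ≠ 0 := by
  rw [sub_eq_add_neg]
  exact add_ne_zero_of_norm_le hz (by rwa [norm_neg])

lemma ne_zero_of_im_pos (hz : 0 < z.im) : z ≠ 0 := by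
  rintro rfl
  exact hz.ne' rfl

lemma inv_add_inv_add_sub_two_mul_inv (hz : 0 < z.im) (hζ : ‖ζ‖ ≤ z.im / 2) :
    (z + ζ)⁻¹ + (z - ζ)⁻¹ - 2 * z⁻¹ = 2 * ζ ^ 2 / (z * (z ^ 2 - ζ ^ 2)) := by
  have hz0 := ne_zero_of_im_pos hz
  have hadd := add_ne_zero_of_norm_le hz hζ
  have hsub := sub_ne_zero_of_norm_le hz hζ
  rw [sq_sub_sq]
  field_simp
  ring

lemma norm_pow_half_le_norm_pow_sub_pow (hζ : ‖ζ‖ ≤ z.im / 2) {n : ℕ} (hn : n ≠ 0) :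
    ‖z‖ ^ n / 2 ≤ ‖z ^ n - ζ ^ n‖ := by
  have hpow : ‖ζ‖ ^ n ≤ ‖z‖ ^ n / 2 := calc
    ‖ζ‖ ^ n ≤ (‖z‖ / 2) ^ n := by gcongr; linarith [im_le_norm z]
    _ = ‖z‖ ^ n / 2 ^ n := div_pow _ _ _
    _ ≤ ‖z‖ ^ n / 2 := by gcongr; exact le_self_pow₀ one_le_two hn
  have h := norm_sub_norm_le (z ^ n) (ζ ^ n)
  rw [norm_pow, norm_pow] at h
  linarith

lemma norm_second_difference_inv_le (hz : 0 < z.im) (hζ : ‖ζ‖ ≤ z.im / 2) :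
    ‖(z + ζ)⁻¹ + (z - ζ)⁻¹ - 2 * z⁻¹‖ ≤ 4 * ‖ζ‖ ^ 2 / z.im ^ 2 * (z.im / ‖z‖ ^ 2) := by
  have hz' := im_le_norm z
  have hnorm : 0 < ‖z‖ := hz.trans_le hz'
  rw [inv_add_inv_add_sub_two_mul_inv hz hζ, norm_div, norm_mul, norm_mul, norm_pow,
    Complex.norm_ofNat]
  calc 2 * ‖ζ‖ ^ 2 / (‖z‖ * ‖z ^ 2 - ζ ^ 2‖) ≤ 2 * ‖ζ‖ ^ 2 / (z.im * (‖z‖ ^ 2 / 2)) := by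
        gcongr
        exact norm_pow_half_le_norm_pow_sub_pow hζ two_ne_zero
    _ = _ := by field_simp; ring

lemma discrete_laplacian_inv_eq (hz : 0 < z.im) (hζ : ‖ζ‖ ≤ z.im / 2) :
    (z + ζ)⁻¹ + (z - ζ)⁻¹ + (z + ζ * Complex.I)⁻¹ + (z - ζ * Complex.I)⁻¹ - 4 * z⁻¹ =
      4 * ζ ^ 4 / (z * (z ^ 4 - ζ ^ 4)) := by
  have hz0 := ne_zero_of_im_pos hz
  have hζI : ‖ζ * Complex.I‖ ≤ z.im / 2 := by rwa [norm_mul, Complex.norm_I, mul_one]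
  have hre := inv_add_inv_add_sub_two_mul_inv hz hζ
  have him := inv_add_inv_add_sub_two_mul_inv hz hζI
  rw [mul_pow, Complex.I_sq, mul_neg_one, sub_neg_eq_add] at him
  have hsub : z ^ 2 - ζ ^ 2 ≠ 0 := by
    rw [sq_sub_sq]
    exact mul_ne_zero (add_ne_zero_of_norm_le hz hζ) (sub_ne_zero_of_norm_le hz hζ)
  have hadd : z ^ 2 + ζ ^ 2 ≠ 0 := by
    rw [← sub_neg_eq_add, ← mul_neg_one (ζ ^ 2), ← Complex.I_sq, ← mul_pow, sq_sub_sq]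
    exact mul_ne_zero (add_ne_zero_of_norm_le hz hζI) (sub_ne_zero_of_norm_le hz hζI)
  calc _ = 2 * ζ ^ 2 / (z * (z ^ 2 - ζ ^ 2)) + 2 * -ζ ^ 2 / (z * (z ^ 2 + ζ ^ 2)) := by
        rw [← hre, ← him]; ring
    _ = 4 * ζ ^ 4 / (z * ((z ^ 2 - ζ ^ 2) * (z ^ 2 + ζ ^ 2))) := by field_simp; ring
    _ = _ := by ring_nf

lemma norm_discrete_laplacian_inv_le (hz : 0 < z.im) (hζ : ‖ζ‖ ≤ z.im / 2) :
    ‖(z + ζ)⁻¹ + (z - ζ)⁻¹ + (z + ζ * Complex.I)⁻¹ + (z - ζ * Complex.I)⁻¹ - 4 * z⁻¹‖ ≤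
      8 * ‖ζ‖ ^ 4 / z.im ^ 4 * (z.im / ‖z‖ ^ 2) := by
  have hz' := im_le_norm z
  have hnorm : 0 < ‖z‖ := hz.trans_le hz'
  have hden : z.im ^ 2 * ‖z‖ ^ 2 / 2 ≤ ‖z ^ 4 - ζ ^ 4‖ := calc
    z.im ^ 2 * ‖z‖ ^ 2 / 2 ≤ ‖z‖ ^ 2 * ‖z‖ ^ 2 / 2 := by gcongr
    _ = ‖z‖ ^ 4 / 2 := by ring
    _ ≤ _ := norm_pow_half_le_norm_pow_sub_pow hζ four_ne_zero
  rw [discrete_laplacian_inv_eq hz hζ, norm_div, norm_mul, norm_mul, norm_pow, Complex.norm_ofNat]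
  calc 4 * ‖ζ‖ ^ 4 / (‖z‖ * ‖z ^ 4 - ζ ^ 4‖)
      ≤ 4 * ‖ζ‖ ^ 4 / (z.im * (z.im ^ 2 * ‖z‖ ^ 2 / 2)) := by gcongr
    _ = _ := by field_simp; ring

lemma norm_taylor_inv_le (hz : 0 < z.im) (hζ : ‖ζ‖ ≤ z.im / 2) :
    ‖(z + ζ)⁻¹ - z⁻¹ + ζ * (z ^ 2)⁻¹‖ ≤ 2 * ‖ζ‖ ^ 2 / z.im ^ 2 * (z.im / ‖z‖ ^ 2) := by
  have hz0 := ne_zero_of_im_pos hz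
  have hadd := add_ne_zero_of_norm_le hz hζ
  have heq : (z + ζ)⁻¹ - z⁻¹ + ζ * (z ^ 2)⁻¹ = ζ ^ 2 / (z ^ 2 * (z + ζ)) := by
    field_simp
    ring
  rw [heq, norm_div, norm_mul, norm_pow, norm_pow]
  calc ‖ζ‖ ^ 2 / (‖z‖ ^ 2 * ‖z + ζ‖) ≤ ‖ζ‖ ^ 2 / (‖z‖ ^ 2 * (z.im / 2)) := by
        gcongr
        exact half_im_le_norm_add hζ
    _ = _ := by field_simp

end KernelEstimates

section AverageEstimates

variable {h : ℝ → ℝ} {M x y ε : ℝ}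

lemma mk_sub_add_complex (x y w : ℝ) (ζ : ℂ) :
    (⟨x + ζ.re - w, y + ζ.im⟩ : ℂ) = ⟨x - w, y⟩ + ζ :=
  Complex.ext (add_sub_right_comm x ζ.re w) rfl

lemma abs_sum_mul_poissonAvg_le {ι : Type*} {s : Finset ι} {c : ι → ℝ} {ζ : ι → ℂ} {C : ℝ}
    (hc : Continuous h) (hM : ∀ w, |h w| ≤ M) (hy : 0 < y) (hζ : ∀ k ∈ s, 0 < y + (ζ k).im)
    (hC : ∀ z : ℂ, z.im = y → ‖∑ k ∈ s, c k * (z + ζ k)⁻¹‖ ≤ C * (z.im / ‖z‖ ^ 2)) :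
    |∑ k ∈ s, c k * poissonAvg (y + (ζ k).im) h (x + (ζ k).re)| ≤ C * M := by
  have heq : ∑ k ∈ s, c k * poissonAvg (y + (ζ k).im) h (x + (ζ k).re) =
      ∫ w, (∑ k ∈ s, c k * poissonKer (⟨x - w, y⟩ + ζ k)) * h w := by
    simp only [Finset.sum_mul, mul_assoc, ← mk_sub_add_complex]
    rw [integral_finsetSum _ fun k hk => (integrable_poissonKer_mul hc hM _ (hζ k hk)).const_mul _]
    exact Finset.sum_congr rfl fun k hk => by
      rw [integral_const_mul, poissonAvg_eq_integral_poissonKer h _ (hζ k hk)]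
  have hker : ∀ z : ℂ, ∑ k ∈ s, c k * poissonKer (z + ζ k) =
      -(Real.pi⁻¹ * (∑ k ∈ s, c k * (z + ζ k)⁻¹).im) := fun z => by
    simp only [poissonKer, Complex.im_sum, Complex.im_ofReal_mul, Finset.mul_sum,
      ← Finset.sum_neg_distrib]
    exact Finset.sum_congr rfl fun k _ => by ring
  rw [heq]
  refine abs_integral_mul_le_of_abs_le_poissonKer (x := x) hy hM fun w => ?_
  rw [hker]
  exact abs_im_le_poissonKer (hC _ rfl)

lemma abs_second_difference_poissonAvg_le (hc : Continuous h) (hM : ∀ w, |h w| ≤ M)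
    (hy : 0 < y) (hε : |ε| ≤ y / 2) :
    |poissonAvg y h (x + ε) + poissonAvg y h (x - ε) - 2 * poissonAvg y h x| ≤
      4 * ε ^ 2 / y ^ 2 * M := by
  have hζ : ∀ k ∈ Finset.univ, 0 < y + ((![(ε : ℂ), -ε, 0] : Fin 3 → ℂ) k).im := fun k _ => by
    fin_cases k <;> simpa using hy
  have h := abs_sum_mul_poissonAvg_le (C := 4 * ε ^ 2 / y ^ 2) (c := ![1, 1, -2]) (x := x)
    hc hM hy hζ fun z hz => by
      subst hz
      simpa [Fin.sum_univ_three, sub_eq_add_neg] using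
        norm_second_difference_inv_le (z := z) (ζ := ε) hy (by simpa using hε)
  simpa [Fin.sum_univ_three, sub_eq_add_neg] using h

lemma abs_discrete_laplacian_poissonAvg_le (hc : Continuous h) (hM : ∀ w, |h w| ≤ M)
    (hy : 0 < y) (hε : |ε| ≤ y / 2) :
    |poissonAvg y h (x + ε) + poissonAvg y h (x - ε) + poissonAvg (y + ε) h x +
      poissonAvg (y - ε) h x - 4 * poissonAvg y h x| ≤ 8 * ε ^ 4 / y ^ 4 * M := by
  have hεy := abs_le.1 hε
  have hζ : ∀ k ∈ Finset.univ, 0 < y + ((![(ε : ℂ), -ε, ε * Complex.I, -(ε * Complex.I), 0] :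
      Fin 5 → ℂ) k).im := fun k _ => by
    fin_cases k <;> simp <;> linarith
  have hpow : |ε| ^ 4 = ε ^ 4 := by rw [← abs_pow, abs_of_nonneg (by positivity)]
  have h := abs_sum_mul_poissonAvg_le (C := 8 * ε ^ 4 / y ^ 4) (c := ![1, 1, 1, 1, -4]) (x := x)
    hc hM hy hζ fun z hz => by
      subst hz
      simpa [Fin.sum_univ_five, sub_eq_add_neg, hpow] using
        norm_discrete_laplacian_inv_le (z := z) (ζ := ε) hy (by simpa using hε)
  simpa [Fin.sum_univ_five, sub_eq_add_neg] using h

lemma abs_taylor_poissonAvg_le (hc : Continuous h) (hM : ∀ w, |h w| ≤ M)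
    (hy : 0 < y) (hε : |ε| ≤ y / 2) :
    |poissonAvg (y + ε) h x - poissonAvg y h x - ε * poissonDeriv y h x| ≤
      2 * ε ^ 2 / y ^ 2 * M := by
  have hyε : 0 < y + ε := by linarith [(abs_le.1 hε).1]
  have hInt := integrable_poissonKer_mul hc hM x hy
  have hInt_add := integrable_poissonKer_mul hc hM x hyε
  have hInt_deriv := (integrable_poissonKerDeriv_mul hc hM x hy).const_mul ε
  have heq : poissonAvg (y + ε) h x - poissonAvg y h x - ε * poissonDeriv y h x =
      ∫ w, (poissonKer ⟨x - w, y + ε⟩ - poissonKer ⟨x - w, y⟩ -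
        ε * poissonKerDeriv ⟨x - w, y⟩) * h w := by
    rw [poissonAvg_eq_integral_poissonKer h _ hy, poissonAvg_eq_integral_poissonKer h _ hyε,
      poissonDeriv_eq_integral_poissonKerDeriv h _ hy, ← integral_const_mul, sub_sub,
      ← integral_add hInt hInt_deriv, ← integral_sub hInt_add (hInt.fun_add hInt_deriv)]
    congr 1 with w
    ring
  rw [heq]
  refine abs_integral_mul_le_of_abs_le_poissonKer (x := x) hy hM fun w => ?_
  have hbound := abs_im_le_poissonKer (norm_taylor_inv_le (z := ⟨x - w, y⟩) (ζ := ε * Complex.I)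
    hy (by simpa using hε))
  have hshift : (⟨x - w, y + ε⟩ : ℂ) = ⟨x - w, y⟩ + ε * Complex.I := by
    apply Complex.ext <;> simp
  have hI : ‖(ε : ℂ) * Complex.I‖ ^ 2 = ε ^ 2 := by simp
  rw [hI, Complex.add_im, Complex.sub_im, mul_assoc, Complex.im_ofReal_mul, Complex.I_mul_im]
    at hbound
  rw [hshift]
  refine le_of_eq_of_le (congrArg _ ?_) hbound
  simp only [poissonKer, poissonKerDeriv]
  ring

end AverageEstimates

/-! ### Duhamel's formula -/

/-- The harmonic extension, at the point `(x, y)` and at time `t`, of the solution of the linear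
evolution equation `v_t = ∂v/∂y + G` on the boundary with initial data `g`. -/
noncomputable def duhamel (g : ℝ → ℝ) (G : ℝ → ℝ → ℝ) (x y t : ℝ) : ℝ :=
  poissonAvg (t + y) g x + ∫ s in (0 : ℝ)..t, poissonAvg (t - s + y) (fun w => G w s) x

/-- Initial data and a forcing term that are continuous and bounded by `M`, so that all integrals in
Duhamel's formula converge. -/
structure IsBoundedSource (g : ℝ → ℝ) (G : ℝ → ℝ → ℝ) (M : ℝ) : Prop where
  continuous_initial : Continuous g
  abs_initial_le : ∀ w, |g w| ≤ M
  continuous_forcing : Continuous fun p : ℝ × ℝ => G p.1 p.2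
  abs_forcing_le : ∀ w s, |G w s| ≤ M

lemma abs_add_integral_le {a C t : ℝ} {f : ℝ → ℝ} (ht : 0 ≤ t) (ha : |a| ≤ C)
    (hf : ∀ s ∈ Icc 0 t, |f s| ≤ C) : |a + ∫ s in (0 : ℝ)..t, f s| ≤ C * (1 + t) := by
  have hInt : ‖∫ s in (0 : ℝ)..t, f s‖ ≤ C * |t - 0| :=
    intervalIntegral.norm_integral_le_of_norm_le_const fun s hs =>
      hf s (Ioc_subset_Icc_self (uIoc_of_le ht ▸ hs))
  rw [sub_zero, abs_of_nonneg ht, Real.norm_eq_abs] at hInt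
  linarith [abs_add_le a (∫ s in (0 : ℝ)..t, f s)]

namespace IsBoundedSource

variable {g g' : ℝ → ℝ} {G G' : ℝ → ℝ → ℝ} {M M' : ℝ}

lemma nonneg (h : IsBoundedSource g G M) : 0 ≤ M :=
  (abs_nonneg _).trans (h.abs_initial_le 0)

lemma continuous_forcing_slice (h : IsBoundedSource g G M) (s : ℝ) : Continuous fun w => G w s :=
  h.continuous_forcing.comp (.prodMk_left s)

lemma continuous_poissonAvg_forcing (h : IsBoundedSource g G M) {α : Type*} [TopologicalSpace α]
    [FirstCountableTopology α] {τ x s : α → ℝ} (hτ : Continuous τ) (hx : Continuous x)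
    (hs : Continuous s) : Continuous fun a => poissonAvg (τ a) (fun w => G w (s a)) (x a) :=
  continuous_poissonAvg (h := fun a w => G w (s a))
    (h.continuous_forcing.comp (continuous_snd.prodMk (hs.comp continuous_fst)))
    (fun _ _ => h.abs_forcing_le _ _) hτ hx

lemma intervalIntegrable_poissonAvg (h : IsBoundedSource g G M) (x y t a b : ℝ) :
    IntervalIntegrable (fun s => poissonAvg (t - s + y) (fun w => G w s) x) volume a b :=
  (h.continuous_poissonAvg_forcing (by fun_prop) continuous_const
    continuous_id).intervalIntegrable a b

lemma continuous_duhamel (h : IsBoundedSource g G M) :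
    Continuous fun p : ℝ × ℝ × ℝ => duhamel g G p.1 p.2.1 p.2.2 := by
  refine Continuous.add ?_ ?_
  · have hg : Continuous fun p : (ℝ × ℝ × ℝ) × ℝ => g p.2 :=
      h.continuous_initial.comp continuous_snd
    exact continuous_poissonAvg hg (fun _ => h.abs_initial_le) (by fun_prop) (by fun_prop)
  · have hG : Continuous fun q : (ℝ × ℝ × ℝ) × ℝ =>
        poissonAvg (q.1.2.2 - q.2 + q.1.2.1) (fun w => G w q.2) q.1.1 :=
      h.continuous_poissonAvg_forcing (by fun_prop) (by fun_prop) (by fun_prop)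
    exact intervalIntegral.continuous_parametric_intervalIntegral_of_continuous hG (by fun_prop)

lemma abs_duhamel_le (h : IsBoundedSource g G M) (x y : ℝ) {t : ℝ} (ht : 0 ≤ t) :
    |duhamel g G x y t| ≤ M * (1 + t) :=
  abs_add_integral_le ht (abs_poissonAvg_le h.abs_initial_le _ _) fun _ _ =>
    abs_poissonAvg_le (h.abs_forcing_le · _) _ _

lemma duhamel_sub_duhamel (h : IsBoundedSource g G M) (h' : IsBoundedSource g' G' M')
    (x x' y y' t : ℝ) : duhamel g G x y t - duhamel g' G' x' y' t =
      (poissonAvg (t + y) g x - poissonAvg (t + y') g' x') +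
        ∫ s in (0 : ℝ)..t, (poissonAvg (t - s + y) (fun w => G w s) x -
          poissonAvg (t - s + y') (fun w => G' w s) x') := by
  rw [intervalIntegral.integral_sub (h.intervalIntegrable_poissonAvg _ _ _ _ _)
    (h'.intervalIntegrable_poissonAvg _ _ _ _ _)]
  exact add_sub_add_comm _ _ _ _

lemma sum_mul_duhamel (h : IsBoundedSource g G M) {ι : Type*} (σ : Finset ι) (c x y : ι → ℝ)
    (t : ℝ) : ∑ k ∈ σ, c k * duhamel g G (x k) (y k) t =
      (∑ k ∈ σ, c k * poissonAvg (t + y k) g (x k)) +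
        ∫ s in (0 : ℝ)..t, ∑ k ∈ σ, c k * poissonAvg (t - s + y k) (fun w => G w s) (x k) := by
  rw [intervalIntegral.integral_finsetSum fun k _ =>
    (h.intervalIntegrable_poissonAvg _ _ _ _ _).const_mul _]
  simp only [duhamel, mul_add, Finset.sum_add_distrib, intervalIntegral.integral_const_mul]

end IsBoundedSource

/-! ### Mild solutions -/

section MildSolution

variable {g : ℝ → ℝ} {F : ℝ × ℝ → ℝ} {M : ℝ} {K : NNReal}

/-- The map whose fixed points are the mild solutions of `u_t = ∂u/∂y + F(x, u)` with initial data
`g`, that is, the solutions in the sense of Duhamel's formula. Functions of `(x, t)` are extended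
to negative times by their values at time `0`. -/
noncomputable def mildMap (g : ℝ → ℝ) (F : ℝ × ℝ → ℝ) (u : ℝ × ℝ → ℝ) (p : ℝ × ℝ) : ℝ :=
  duhamel g (fun w s => F (w, u (w, s))) p.1 0 (max p.2 0)

/-- The weight for which `mildMap` is a contraction when `F` is `K`-Lipschitz. -/
noncomputable def mildWeight (K : NNReal) (p : ℝ × ℝ) : ℝ := Real.exp ((2 * K + 1) * max p.2 0)

lemma mildWeight_pos (K : NNReal) (p : ℝ × ℝ) : 0 < mildWeight K p := Real.exp_pos _

lemma one_add_max_le_mildWeight (K : NNReal) (p : ℝ × ℝ) : 1 + max p.2 0 ≤ mildWeight K p := by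
  have hK := mul_nonneg K.coe_nonneg (le_max_right p.2 0)
  have hexp := Real.add_one_le_exp ((2 * K + 1) * max p.2 0)
  change 1 + max p.2 0 ≤ Real.exp _
  linarith

lemma isBoundedSource_comp (hg : Continuous g) (hgM : ∀ w, |g w| ≤ M) (hF : Continuous F)
    (hFM : ∀ p, |F p| ≤ M) {u : ℝ × ℝ → ℝ} (hu : Continuous u) :
    IsBoundedSource g (fun w s => F (w, u (w, s))) M :=
  ⟨hg, hgM, by fun_prop, fun _ _ => hFM _⟩

lemma norm_mildMap_sub_le (hg : Continuous g) (hgM : ∀ w, |g w| ≤ M) (hF : LipschitzWith K F)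
    (hFM : ∀ p, |F p| ≤ M) {u v : ℝ × ℝ → ℝ} (hu : Continuous u) (hv : Continuous v) {D : ℝ}
    (huv : ∀ p, ‖u p - v p‖ ≤ D * mildWeight K p) (p : ℝ × ℝ) :
    ‖mildMap g F u p - mildMap g F v p‖ ≤ 1 / 2 * D * mildWeight K p := by
  have hsu := isBoundedSource_comp hg hgM hF.continuous hFM hu
  have hsv := isBoundedSource_comp hg hgM hF.continuous hFM hv
  have hD : 0 ≤ D :=
    nonneg_of_mul_nonneg_left ((norm_nonneg _).trans (huv 0)) (mildWeight_pos K 0)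
  rw [mildMap, mildMap, hsu.duhamel_sub_duhamel hsv, sub_self, zero_add]
  refine norm_integral_le_half_mul_exp K.2 hD (le_max_right _ _) fun s hs => ?_
  refine abs_poissonAvg_sub_le_const (hsu.continuous_forcing_slice s)
    (hsv.continuous_forcing_slice s) (fun _ => hFM _) (fun _ => hFM _) fun z => ?_
  set w := p.1 + (max p.2 0 - s + 0) * z
  calc |F (w, u (w, s)) - F (w, v (w, s))|
      ≤ K * ‖(w, u (w, s)) - (w, v (w, s))‖ := hF.norm_sub_le _ _
    _ = K * ‖u (w, s) - v (w, s)‖ := by simp [Prod.norm_def]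
    _ ≤ K * (D * Real.exp ((2 * K + 1) * s)) := by
        refine mul_le_mul_of_nonneg_left ?_ K.2
        simpa only [mildWeight, max_eq_left hs.1] using huv (w, s)

lemma norm_mildMap_translate_sub_le (hg : LipschitzWith K g) (hgM : ∀ w, |g w| ≤ M)
    (hF : LipschitzWith K F) (hFM : ∀ p, |F p| ≤ M) {u : ℝ × ℝ → ℝ} (hu : Continuous u) (a : ℝ)
    (p : ℝ × ℝ) :
    ‖mildMap g F u (p.1 + a, p.2) - mildMap g F (fun q => u (q.1 + a, q.2)) p‖ ≤
      K * |a| * mildWeight K p := by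
  have hs := isBoundedSource_comp hg.continuous hgM hF.continuous hFM hu
  have hs' := isBoundedSource_comp (u := fun q => u (q.1 + a, q.2)) hg.continuous hgM
    hF.continuous hFM (by fun_prop)
  have hshift : ∀ τ z, p.1 + a + τ * z - (p.1 + τ * z) = a := fun τ z => by ring
  rw [mildMap, mildMap, hs.duhamel_sub_duhamel hs']
  refine (abs_add_integral_le (C := K * |a|) (le_max_right _ _) ?_ fun s _ => ?_).trans
    (mul_le_mul_of_nonneg_left (one_add_max_le_mildWeight K p) (by positivity))
  · refine abs_poissonAvg_sub_le_const hg.continuous hg.continuous hgM hgM fun z => ?_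
    set τ := max p.2 0 + 0
    simpa only [Real.norm_eq_abs, hshift] using hg.norm_sub_le (p.1 + a + τ * z) (p.1 + τ * z)
  · refine abs_poissonAvg_sub_le_const (hs.continuous_forcing_slice s)
      (hs'.continuous_forcing_slice s) (fun _ => hFM _) (fun _ => hFM _) fun z => ?_
    set τ := max p.2 0 - s + 0
    have hF_shift := hF.norm_sub_le (p.1 + a + τ * z, u (p.1 + a + τ * z, s))
      (p.1 + τ * z, u (p.1 + a + τ * z, s))
    simpa [Prod.norm_def, hshift, add_right_comm] using hF_shift

lemma exists_fixedPoint_mildMap (hg : Continuous g) (hgM : ∀ w, |g w| ≤ M)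
    (hF : LipschitzWith K F) (hFM : ∀ p, |F p| ≤ M) :
    ∃ u, Continuous u ∧ (∃ C, ∀ p, ‖u p‖ ≤ C * mildWeight K p) ∧ mildMap g F u = u := by
  have hsource := fun u hu => isBoundedSource_comp (u := u) hg hgM hF.continuous hFM hu
  have hw : Continuous (mildWeight K) := by unfold mildWeight; fun_prop
  refine exists_fixedPoint_of_weighted_contraction hw (mildWeight_pos K) (A := M) (q := 1 / 2)
    (by norm_num) (by norm_num) (fun u hu => ?_) (fun p => ?_)
    fun u v hu hv D => norm_mildMap_sub_le hg hgM hF hFM hu hv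
  · exact (hsource u hu).continuous_duhamel.comp
      (by fun_prop : Continuous fun p : ℝ × ℝ => (p.1, (0 : ℝ), max p.2 0))
  · have h := hsource 0 continuous_zero
    exact (h.abs_duhamel_le _ _ (le_max_right _ _)).trans
      (mul_le_mul_of_nonneg_left (one_add_max_le_mildWeight K p) h.nonneg)

lemma norm_sub_le_of_mildMap_eq (hg : LipschitzWith K g) (hgM : ∀ w, |g w| ≤ M)
    (hF : LipschitzWith K F) (hFM : ∀ p, |F p| ≤ M) {u : ℝ × ℝ → ℝ} {C : ℝ} (hu : Continuous u)
    (huC : ∀ p, ‖u p‖ ≤ C * mildWeight K p) (hfix : mildMap g F u = u) (a : ℝ) (p : ℝ × ℝ) :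
    ‖u (p.1 + a, p.2) - u p‖ ≤ K * |a| / (1 - 1 / 2) * mildWeight K p := by
  set v : ℝ × ℝ → ℝ := fun q => u (q.1 + a, q.2)
  have hv : Continuous v := by fun_prop
  refine norm_sub_le_of_weighted_contraction (v := v) (C := C + C) (mildWeight_pos K)
    (by norm_num : (1 / 2 : ℝ) < 1)
    (fun D hD => norm_mildMap_sub_le hg.continuous hgM hF hFM hv hu hD) hfix (fun q => ?_)
    (fun q => ?_) p
  · have h := norm_mildMap_translate_sub_le hg hgM hF hFM hu a q
    rwa [hfix] at h
  · rw [add_mul]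
    exact (norm_sub_le _ _).trans (add_le_add (huC (q.1 + a, q.2)) (huC q))

lemma exists_lipschitzWith_of_mildMap_eq (hg : LipschitzWith K g) (hgM : ∀ w, |g w| ≤ M)
    (hF : LipschitzWith K F) (hFM : ∀ p, |F p| ≤ M) {u : ℝ × ℝ → ℝ} {C : ℝ} (hu : Continuous u)
    (huC : ∀ p, ‖u p‖ ≤ C * mildWeight K p) (hfix : mildMap g F u = u) (T : ℝ) :
    ∃ L : NNReal, ∀ s ∈ Icc 0 T, LipschitzWith L fun w => u (w, s) := by
  refine ⟨Real.toNNReal (K / (1 - 1 / 2) * mildWeight K (0, T)), fun s hs =>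
    .of_dist_le' fun w w' => ?_⟩
  have h := norm_sub_le_of_mildMap_eq hg hgM hF hFM hu huC hfix (w - w') (w', s)
  have hweight : mildWeight K (w', s) ≤ mildWeight K (0, T) :=
    Real.exp_le_exp.2 (mul_le_mul_of_nonneg_left (max_le_max_right 0 hs.2) (by positivity))
  rw [add_sub_cancel] at h
  rw [dist_eq_norm, Real.dist_eq]
  calc ‖u (w, s) - u (w', s)‖ ≤ K * |w - w'| / (1 - 1 / 2) * mildWeight K (w', s) := h
    _ ≤ K * |w - w'| / (1 - 1 / 2) * mildWeight K (0, T) :=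
      mul_le_mul_of_nonneg_left hweight (by norm_num; positivity)
    _ = _ := by ring

/-- Sources for which Duhamel's formula solves the boundary problem: bounded, jointly continuous,
and Lipschitz continuous in space locally uniformly in time. -/
structure IsDuhamelData (g : ℝ → ℝ) (G : ℝ → ℝ → ℝ) (M : ℝ) : Prop
    extends IsBoundedSource g G M where
  lipschitz : ∀ T, ∃ L : NNReal, LipschitzWith L g ∧ ∀ s ∈ Icc 0 T, LipschitzWith L fun w => G w s

theorem exists_isDuhamelData (hg : IsBoundedLipschitz g) (hF : LipschitzWith K F)
    (hFM : ∀ p, |F p| ≤ M) :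
    ∃ G M', IsDuhamelData g G M' ∧ ∀ x t, 0 ≤ t → G x t = F (x, duhamel g G x 0 t) := by
  obtain ⟨⟨Mg, hgM⟩, Kg, hg⟩ := hg
  replace hg := hg.weaken (le_max_left Kg K)
  replace hF := hF.weaken (le_max_right Kg K)
  replace hgM := fun w => (hgM w).trans (le_max_left Mg M)
  replace hFM := fun p => (hFM p).trans (le_max_right Mg M)
  obtain ⟨u, hu, ⟨C, huC⟩, hfix⟩ := exists_fixedPoint_mildMap hg.continuous hgM hF hFM
  refine ⟨fun w s => F (w, u (w, s)), _,
    ⟨isBoundedSource_comp hg.continuous hgM hF.continuous hFM hu, fun T => ?_⟩, fun x t ht => ?_⟩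
  · obtain ⟨L, hL⟩ := exists_lipschitzWith_of_mildMap_eq hg hgM hF hFM hu huC hfix T
    exact ⟨max (max Kg K) (max Kg K * max 1 L), hg.weaken (le_max_left _ _), fun s hs =>
      (hF.comp (LipschitzWith.id.prodMk (hL s hs))).weaken (le_max_right _ _)⟩
  · have h := congrFun hfix (x, t)
    simp only [mildMap, max_eq_left ht] at h
    rw [h]

end MildSolution

/-! ### Differential properties of Duhamel's formula -/

lemma hasDerivAt_integral_diagonal {q : ℝ → ℝ → ℝ} (hq : Continuous fun p : ℝ × ℝ => q p.1 p.2)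
    (t : ℝ) : HasDerivAt (fun δ => ∫ s in t..(t + δ), q δ s) (q 0 t) 0 := by
  rw [hasDerivAt_iff_isLittleO_nhds_zero, Asymptotics.isLittleO_iff]
  intro c hc
  obtain ⟨r, hr, hball⟩ := Metric.continuousAt_iff.1 (hq.continuousAt (x := (0, t))) c hc
  filter_upwards [Metric.ball_mem_nhds (0 : ℝ) hr] with δ hδ
  have hδ' : |δ| < r := by simpa using hδ
  have heq : (∫ s in t..(t + (0 + δ)), q (0 + δ) s) - (∫ s in t..(t + 0), q 0 s) - δ • q 0 t =
      ∫ s in t..(t + δ), (q δ s - q 0 t) := by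
    have hqδ : Continuous fun s => q δ s := hq.comp (.prodMk_right δ)
    rw [intervalIntegral.integral_sub (hqδ.intervalIntegrable _ _)
      (continuous_const.intervalIntegrable _ _)]
    simp
  have hclose : ∀ s ∈ uIoc t (t + δ), ‖q δ s - q 0 t‖ ≤ c := fun s hs => by
    have hs' : |s - t| ≤ |δ| := by
      simpa using abs_sub_left_of_mem_uIcc (uIoc_subset_uIcc hs)
    have hdist : dist (δ, s) ((0 : ℝ), t) < r := by
      rw [Prod.dist_eq, max_lt_iff, Real.dist_eq, Real.dist_eq, sub_zero]
      exact ⟨hδ', hs'.trans_lt hδ'⟩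
    exact (hball hdist).le
  rw [heq]
  simpa using intervalIntegral.norm_integral_le_of_norm_le_const hclose

lemma hasDerivAt_zero_of_abs_sub_le_sq {f : ℝ → ℝ} {d A : ℝ}
    (h : ∀ᶠ δ in 𝓝 0, |f δ - f 0 - δ * d| ≤ A * δ ^ 2) : HasDerivAt f d 0 := by
  rw [hasDerivAt_iff_isLittleO_nhds_zero]
  refine Asymptotics.IsBigO.trans_isLittleO (g := fun δ : ℝ => δ ^ 2) (.of_bound A ?_)
    (Asymptotics.isLittleO_pow_id one_lt_two)
  filter_upwards [h] with δ hδ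
  simpa using hδ

/-- The derivative of `duhamel g G` in the direction normal to the boundary. -/
noncomputable def duhamelDeriv (g : ℝ → ℝ) (G : ℝ → ℝ → ℝ) (x y t : ℝ) : ℝ :=
  poissonDeriv (t + y) g x + ∫ s in (0 : ℝ)..t, poissonDeriv (t - s + y) (fun w => G w s) x

namespace IsBoundedSource

variable {g : ℝ → ℝ} {G : ℝ → ℝ → ℝ} {M x y t ε : ℝ}

lemma intervalIntegrable_poissonDeriv (h : IsBoundedSource g G M) (x : ℝ) (hy : 0 < y)
    (ht : 0 ≤ t) :
    IntervalIntegrable (fun s => poissonDeriv (t - s + y) (fun w => G w s) x) volume 0 t := by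
  have hcont := continuousOn_poissonDeriv (h := fun s w => G w s) (τ := fun s => t - s + y)
    (x := fun _ => x) (h.continuous_forcing.comp continuous_swap)
    (fun s w => h.abs_forcing_le w s) (by fun_prop) continuous_const
  refine (hcont.mono fun s hs => ?_).intervalIntegrable
  rw [uIcc_of_le ht] at hs
  exact (by linarith [hs.2] : 0 < t - s + y).ne'

lemma abs_sum_mul_duhamel_le (h : IsBoundedSource g G M) {ι : Type*} (σ : Finset ι)
    (c x y : ι → ℝ) {C : ℝ} (ht : 0 ≤ t) (hC : ∀ f, Continuous f → (∀ w, |f w| ≤ M) → ∀ τ, 0 ≤ τ →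
      |∑ k ∈ σ, c k * poissonAvg (τ + y k) f (x k)| ≤ C) :
    |∑ k ∈ σ, c k * duhamel g G (x k) (y k) t| ≤ C * (1 + t) := by
  rw [h.sum_mul_duhamel]
  exact abs_add_integral_le ht (hC g h.continuous_initial h.abs_initial_le t ht) fun s hs =>
    hC _ (h.continuous_forcing_slice s) (h.abs_forcing_le · s) (t - s) (sub_nonneg.2 hs.2)

lemma abs_discrete_laplacian_duhamel_le (h : IsBoundedSource g G M) (hy : 0 < y) (ht : 0 ≤ t)
    (hε : |ε| ≤ y / 2) :
    |duhamel g G (x + ε) y t + duhamel g G (x - ε) y t + duhamel g G x (y + ε) t +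
      duhamel g G x (y - ε) t - 4 * duhamel g G x y t| ≤ 8 * ε ^ 4 / y ^ 4 * M * (1 + t) := by
  have hM := h.nonneg
  have hsum := h.abs_sum_mul_duhamel_le Finset.univ ![1, 1, 1, 1, -4] ![x + ε, x - ε, x, x, x]
    ![y, y, y + ε, y - ε, y] (C := 8 * ε ^ 4 / y ^ 4 * M) ht fun f hf hfM τ hτ => by
      have hf_le := abs_discrete_laplacian_poissonAvg_le (x := x) hf hfM (by linarith : 0 < τ + y)
        (by linarith : |ε| ≤ (τ + y) / 2)
      have hmono : 8 * ε ^ 4 / (τ + y) ^ 4 * M ≤ 8 * ε ^ 4 / y ^ 4 * M := by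
        gcongr; linarith
      simpa [Fin.sum_univ_five, sub_eq_add_neg, add_assoc] using hf_le.trans hmono
  simpa [Fin.sum_univ_five, sub_eq_add_neg, add_assoc] using hsum

lemma abs_second_difference_duhamel_le (h : IsBoundedSource g G M) (hy : 0 < y) (ht : 0 ≤ t)
    (hε : |ε| ≤ y / 2) :
    |duhamel g G (x + ε) y t + duhamel g G (x - ε) y t - 2 * duhamel g G x y t| ≤
      4 * ε ^ 2 / y ^ 2 * M * (1 + t) := by
  have hM := h.nonneg
  have hsum := h.abs_sum_mul_duhamel_le Finset.univ ![1, 1, -2] ![x + ε, x - ε, x]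
    (fun _ => y) (C := 4 * ε ^ 2 / y ^ 2 * M) ht fun f hf hfM τ hτ => by
      have hf_le := abs_second_difference_poissonAvg_le (x := x) hf hfM (by linarith : 0 < τ + y)
        (by linarith : |ε| ≤ (τ + y) / 2)
      have hmono : 4 * ε ^ 2 / (τ + y) ^ 2 * M ≤ 4 * ε ^ 2 / y ^ 2 * M := by
        gcongr; linarith
      simpa [Fin.sum_univ_three, sub_eq_add_neg, add_assoc] using hf_le.trans hmono
  simpa [Fin.sum_univ_three, sub_eq_add_neg, add_assoc] using hsum

lemma abs_taylor_duhamel_le (h : IsBoundedSource g G M) (hy : 0 < y) (ht : 0 ≤ t)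
    (hε : |ε| ≤ y / 2) :
    |duhamel g G x (y + ε) t - duhamel g G x y t - ε * duhamelDeriv g G x y t| ≤
      2 * ε ^ 2 / y ^ 2 * M * (1 + t) := by
  have hM := h.nonneg
  have havg : ∀ τ, 0 ≤ τ → ∀ f, Continuous f → (∀ w, |f w| ≤ M) →
      |poissonAvg (τ + (y + ε)) f x - poissonAvg (τ + y) f x - ε * poissonDeriv (τ + y) f x| ≤
        2 * ε ^ 2 / y ^ 2 * M := fun τ hτ f hf hfM => by
    rw [← add_assoc]
    refine (abs_taylor_poissonAvg_le hf hfM (by linarith) (by linarith)).trans ?_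
    gcongr
    linarith
  have heq : duhamel g G x (y + ε) t - duhamel g G x y t - ε * duhamelDeriv g G x y t =
      (poissonAvg (t + (y + ε)) g x - poissonAvg (t + y) g x - ε * poissonDeriv (t + y) g x) +
        ∫ s in (0 : ℝ)..t, (poissonAvg (t - s + (y + ε)) (fun w => G w s) x -
          poissonAvg (t - s + y) (fun w => G w s) x -
          ε * poissonDeriv (t - s + y) (fun w => G w s) x) := by
    have hInt := fun y => h.intervalIntegrable_poissonAvg x y t 0 t
    rw [intervalIntegral.integral_sub ((hInt _).sub (hInt _))
      ((h.intervalIntegrable_poissonDeriv x hy ht).const_mul ε),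
      intervalIntegral.integral_sub (hInt _) (hInt _), intervalIntegral.integral_const_mul,
      duhamel, duhamel, duhamelDeriv]
    ring
  rw [heq]
  exact abs_add_integral_le ht (havg t ht g h.continuous_initial h.abs_initial_le) fun s hs =>
    havg (t - s) (sub_nonneg.2 hs.2) _ (h.continuous_forcing_slice s) (h.abs_forcing_le · s)

lemma hasDerivAt_duhamel_normal (h : IsBoundedSource g G M) (hy : 0 < y) (ht : 0 ≤ t) :
    HasDerivAt (fun δ => duhamel g G x (y + δ) t) (duhamelDeriv g G x y t) 0 := by
  refine hasDerivAt_zero_of_abs_sub_le_sq (A := 2 / y ^ 2 * M * (1 + t)) ?_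
  filter_upwards [Metric.closedBall_mem_nhds (0 : ℝ) (half_pos hy)] with δ hδ
  have hδy : |δ| ≤ y / 2 := by simpa using hδ
  rw [add_zero]
  exact (h.abs_taylor_duhamel_le hy ht hδy).trans_eq (by ring)

lemma duhamel_time_add (h : IsBoundedSource g G M) (x y t δ : ℝ) :
    duhamel g G x y (t + δ) = duhamel g G x (y + δ) t +
      ∫ s in t..(t + δ), poissonAvg (t + δ - s + y) (fun w => G w s) x := by
  have hInt := h.intervalIntegrable_poissonAvg x y (t + δ)
  have heq : ∀ s, t + δ - s + y = t - s + (y + δ) := fun s => by ring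
  rw [duhamel, duhamel, ← intervalIntegral.integral_add_adjacent_intervals (hInt 0 t)
    (hInt t (t + δ)), ← add_assoc, add_right_comm t δ y, add_assoc t y δ]
  simp only [heq]

/-- Moving time forward raises the height at which everything already emitted is evaluated. -/
lemma hasDerivAt_duhamel_time (h : IsBoundedSource g G M) (hy : 0 < y) (ht : 0 ≤ t) :
    HasDerivAt (fun s => duhamel g G x y s)
      (duhamelDeriv g G x y t + poissonAvg y (fun w => G w t) x) t := by
  have hdiag := hasDerivAt_integral_diagonal (q := fun δ s => poissonAvg (t + δ - s + y)
    (fun w => G w s) x) (h.continuous_poissonAvg_forcing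
      (by fun_prop : Continuous fun p : ℝ × ℝ => t + p.1 - p.2 + y) continuous_const
      continuous_snd) t
  have hadd : HasDerivAt (fun δ => duhamel g G x y (t + δ))
      (duhamelDeriv g G x y t + poissonAvg y (fun w => G w t) x) 0 := by
    simp only [h.duhamel_time_add]
    simpa using (h.hasDerivAt_duhamel_normal hy ht).fun_add hdiag
  have hshift := HasDerivAt.comp_sub_const t t ((sub_self t).symm ▸ hadd)
  simp only [add_sub_cancel] at hshift
  exact hshift

end IsBoundedSource

/-! ### Moduli of continuity -/

/-- A modulus of continuity for the Poisson averages, as functions of the height, of functions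
bounded by `M` and Lipschitz continuous with constant `L`. -/
noncomputable def poissonModulus (M L δ : ℝ) : ℝ :=
  ∫ z, cauchyDensity z * min (2 * M) (L * (|δ| * |z|))

section PoissonModulus

variable {M L : ℝ}

lemma abs_poissonModulus_integrand_le (hM : 0 ≤ M) (hL : 0 ≤ L) (δ z : ℝ) :
    |min (2 * M) (L * (|δ| * |z|))| ≤ 2 * M := by
  rw [abs_of_nonneg (by positivity)]
  exact min_le_left _ _

lemma continuous_poissonModulus (hM : 0 ≤ M) (hL : 0 ≤ L) : Continuous (poissonModulus M L) :=
  continuous_integral_cauchyDensity_mul (by fun_prop) (abs_poissonModulus_integrand_le hM hL)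

lemma poissonModulus_zero (hM : 0 ≤ M) : poissonModulus M L 0 = 0 := by
  simp [poissonModulus, hM]

lemma poissonModulus_nonneg (hM : 0 ≤ M) (hL : 0 ≤ L) (δ : ℝ) : 0 ≤ poissonModulus M L δ :=
  integral_nonneg fun z => mul_nonneg (cauchyDensity_nonneg z) (by positivity)

end PoissonModulus

lemma abs_poissonAvg_add_sub_le {f : ℝ → ℝ} {M : ℝ} {L : NNReal} (hM : ∀ w, |f w| ≤ M)
    (hL : LipschitzWith L f) (τ δ x : ℝ) :
    |poissonAvg (τ + δ) f x - poissonAvg τ f x| ≤ poissonModulus M L δ := by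
  have hM0 : 0 ≤ M := (abs_nonneg _).trans (hM 0)
  refine abs_poissonAvg_sub_le hL.continuous hL.continuous hM hM (integrable_cauchyDensity_mul
    (by fun_prop) (abs_poissonModulus_integrand_le hM0 L.2 δ)) fun z => le_min ?_ ?_
  · linarith [abs_sub (f (x + (τ + δ) * z)) (f (x + τ * z)), hM (x + (τ + δ) * z), hM (x + τ * z)]
  · have hshift : x + (τ + δ) * z - (x + τ * z) = δ * z := by ring
    simpa [hshift] using hL.norm_sub_le (x + (τ + δ) * z) (x + τ * z)

lemma IsBoundedSource.abs_duhamel_shift_sub_le {g : ℝ → ℝ} {G : ℝ → ℝ → ℝ} {M t : ℝ} {L : NNReal}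
    (h : IsBoundedSource g G M) (hg : LipschitzWith L g) (ht : 0 ≤ t)
    (hG : ∀ s ∈ Icc 0 t, LipschitzWith L fun w => G w s) (x y δ : ℝ) :
    |duhamel g G x (y + δ) t - duhamel g G x y t| ≤ poissonModulus M L δ * (1 + t) := by
  rw [h.duhamel_sub_duhamel h]
  simp only [← add_assoc]
  exact abs_add_integral_le ht (abs_poissonAvg_add_sub_le h.abs_initial_le hg _ δ x) fun s hs =>
    abs_poissonAvg_add_sub_le (h.abs_forcing_le · s) (hG s hs) _ δ x

/-! ### Test functions -/

theorem tendsto_second_difference {f : ℝ → ℝ} (hf : ContDiff ℝ 2 f) (x : ℝ) :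
    Tendsto (fun s => (f (x + s) + f (x - s) - 2 * f x) / s ^ 2) (𝓝[≠] 0)
      (𝓝 (deriv (deriv f) x)) := by
  have htaylor : (fun y => f y - (f x + (y - x) * deriv f x +
      (y - x) ^ 2 / 2 * deriv (deriv f) x)) =o[𝓝 x] fun y => (y - x) ^ 2 := by
    refine (taylor_isLittleO_univ (x₀ := x) (n := 2) hf).congr_left fun y => ?_
    simp only [taylorWithinEval_succ, taylor_within_zero_eval, iteratedDerivWithin_univ,
      iteratedDeriv_succ, iteratedDeriv_zero, Nat.cast_zero, zero_add, Nat.factorial,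
      Nat.cast_one, smul_eq_mul]
    ring
  have hright := htaylor.comp_tendsto (k := fun s => x + s) (l' := 𝓝 0)
    (Continuous.tendsto' (by fun_prop) _ _ (add_zero x))
  have hleft := htaylor.comp_tendsto (k := fun s => x - s) (l' := 𝓝 0)
    (Continuous.tendsto' (by fun_prop) _ _ (sub_zero x))
  have hsum := (hright.congr_right (g₂ := fun s => s ^ 2) fun s => by simp).add
    (hleft.congr_right (g₂ := fun s => s ^ 2) fun s => by simp)
  have hlim := ((hsum.mono (nhdsWithin_le_nhds (s := {0}ᶜ))).tendsto_div_nhds_zero).add_const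
    (deriv (deriv f) x)
  rw [zero_add] at hlim
  refine hlim.congr' ?_
  filter_upwards [self_mem_nhdsWithin] with s hs
  have hs0 : s ≠ 0 := hs
  simp only [Function.comp_apply]
  field_simp
  ring

section Line

variable {E : Type*} [NormedAddCommGroup E] [NormedSpace ℝ E]

lemma hasDerivAt_comp_line {F : Type*} [NormedAddCommGroup F] [NormedSpace ℝ F] {Φ : E → F}
    (hΦ : Differentiable ℝ Φ) (p v : E) (s : ℝ) :
    HasDerivAt (fun s : ℝ => Φ (p + s • v)) (fderiv ℝ Φ (p + s • v) v) s := by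
  have hline : HasDerivAt (fun s : ℝ => p + s • v) v s := by
    simpa using ((hasDerivAt_id s).smul_const v).const_add p
  exact (hΦ (p + s • v)).hasFDerivAt.comp_hasDerivAt s hline

lemma deriv_deriv_comp_line {Φ : E → ℝ} (hΦ : ContDiff ℝ 2 Φ) (p v : E) :
    deriv (deriv fun s : ℝ => Φ (p + s • v)) 0 = iteratedFDeriv ℝ 2 Φ p ![v, v] := by
  have hfirst : (deriv fun s : ℝ => Φ (p + s • v)) = fun s => fderiv ℝ Φ (p + s • v) v :=
    funext fun s => (hasDerivAt_comp_line (hΦ.differentiable two_ne_zero) p v s).deriv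
  have hdiff : Differentiable ℝ (fderiv ℝ Φ) :=
    (hΦ.fderiv_right (m := 1) (by norm_num)).differentiable one_ne_zero
  have hsecond := (hasDerivAt_comp_line hdiff p v 0).clm_apply (hasDerivAt_const (0 : ℝ) v)
  rw [zero_smul, add_zero, map_zero, add_zero] at hsecond
  rw [hfirst, iteratedFDeriv_two_apply, hsecond.deriv]
  rfl

end Line

/-- The unit vector along the boundary of the half-plane. -/
noncomputable abbrev unitX : Plane := EuclideanSpace.single 0 1

/-- The unit vector normal to the boundary of the half-plane, pointing into the half-plane. -/
noncomputable abbrev unitY : Plane := EuclideanSpace.single 1 1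

lemma laplacian_eq_sum_deriv_deriv {ψ : Plane → ℝ} (hψ : ContDiff ℝ 2 ψ) (X : Plane) :
    Laplacian.laplacian ψ X = deriv (deriv fun s : ℝ => ψ (X + s • unitX)) 0 +
      deriv (deriv fun s : ℝ => ψ (X + s • unitY)) 0 := by
  rw [InnerProductSpace.laplacian_eq_iteratedFDeriv_orthonormalBasis ψ
    (EuclideanSpace.basisFun (Fin 2) ℝ), deriv_deriv_comp_line hψ, deriv_deriv_comp_line hψ]
  simp

theorem laplacian_nonneg_of_isLocalMax {f ψ : Plane → ℝ} {X : Plane} (hψ : ContDiff ℝ 2 ψ) {C : ℝ}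
    (hf : ∀ᶠ s in 𝓝[>] (0 : ℝ), -(C * s ^ 4) ≤ f (X + s • unitX) + f (X - s • unitX) +
      f (X + s • unitY) + f (X - s • unitY) - 4 * f X)
    (hmax : IsLocalMax (fun Y => f Y - ψ Y) X) : 0 ≤ Laplacian.laplacian ψ X := by
  have hline : ∀ v : Plane, Tendsto (fun s : ℝ => (ψ (X + s • v) + ψ (X - s • v) - 2 * ψ X) / s ^ 2)
      (𝓝[>] 0) (𝓝 (deriv (deriv fun s : ℝ => ψ (X + s • v)) 0)) := fun v => by
    have hc : ContDiff ℝ 2 fun s : ℝ => ψ (X + s • v) := hψ.comp (by fun_prop)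
    simpa [sub_eq_add_neg] using (tendsto_second_difference hc 0).mono_left (nhdsGT_le_nhdsNE 0)
  have hmax_line : ∀ v : Plane, ∀ᶠ s in 𝓝[>] (0 : ℝ), f (X + s • v) - ψ (X + s • v) ≤ f X - ψ X :=
    fun v => ((Continuous.tendsto' (by fun_prop) _ _ (by simp) :
      Tendsto (fun s : ℝ => X + s • v) (𝓝 0) (𝓝 X)).mono_left nhdsWithin_le_nhds).eventually hmax
  have hlow : Tendsto (fun s : ℝ => -(C * s ^ 2)) (𝓝[>] 0) (𝓝 0) :=
    (Continuous.tendsto' (by fun_prop) _ _ (by simp)).mono_left nhdsWithin_le_nhds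
  rw [laplacian_eq_sum_deriv_deriv hψ]
  refine le_of_tendsto_of_tendsto hlow ((hline unitX).add (hline unitY)) ?_
  filter_upwards [hf, hmax_line unitX, hmax_line (-unitX), hmax_line unitY, hmax_line (-unitY),
    self_mem_nhdsWithin] with s hs hright hleft hup hdown hs0
  have hs_pos : 0 < s := hs0
  rw [smul_neg, ← sub_eq_add_neg] at hleft hdown
  rw [← add_div, le_div_iff₀ (by positivity)]
  linarith

section TestFunction

variable {φ χ : Plane → ℝ → ℝ}

lemma contDiff_space_slice (hφ : ContDiff ℝ 2 fun p : Plane × ℝ => φ p.1 p.2) (t : ℝ) :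
    ContDiff ℝ 2 fun Y => φ Y t :=
  hφ.comp (contDiff_id.prodMk contDiff_const)

lemma spaceLaplacian_eq_iteratedFDeriv (hφ : ContDiff ℝ 2 fun p : Plane × ℝ => φ p.1 p.2)
    (X : Plane) (t : ℝ) : spaceLaplacian φ X t =
      iteratedFDeriv ℝ 2 (fun p : Plane × ℝ => φ p.1 p.2) (X, t) ![(unitX, 0), (unitX, 0)] +
      iteratedFDeriv ℝ 2 (fun p : Plane × ℝ => φ p.1 p.2) (X, t) ![(unitY, 0), (unitY, 0)] := by
  rw [spaceLaplacian, laplacian_eq_sum_deriv_deriv (contDiff_space_slice hφ t),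
    ← deriv_deriv_comp_line hφ, ← deriv_deriv_comp_line hφ]
  simp

lemma continuous_spaceLaplacian (hφ : ContDiff ℝ 2 fun p : Plane × ℝ => φ p.1 p.2) :
    Continuous fun p : Plane × ℝ => spaceLaplacian φ p.1 p.2 := by
  have happly : ∀ v : Fin 2 → Plane × ℝ,
      Continuous fun p => iteratedFDeriv ℝ 2 (fun p : Plane × ℝ => φ p.1 p.2) p v := fun v =>
    (ContinuousMultilinearMap.apply ℝ (fun _ : Fin 2 => Plane × ℝ) ℝ v).continuous.comp
      (hφ.continuous_iteratedFDeriv le_rfl)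
  simp only [spaceLaplacian_eq_iteratedFDeriv hφ]
  exact (happly _).add (happly _)

lemma spaceLaplacian_add (hφ : ContDiff ℝ 2 fun p : Plane × ℝ => φ p.1 p.2)
    (hχ : ContDiff ℝ 2 fun p : Plane × ℝ => χ p.1 p.2) (X : Plane) (t : ℝ) :
    spaceLaplacian (fun Y s => φ Y s + χ Y s) X t =
      spaceLaplacian φ X t + spaceLaplacian χ X t :=
  ContDiffAt.laplacian_add (contDiff_space_slice hφ t).contDiffAt
    (contDiff_space_slice hχ t).contDiffAt

lemma spaceLaplacian_neg (φ : Plane → ℝ → ℝ) (X : Plane) (t : ℝ) :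
    spaceLaplacian (fun Y s => -φ Y s) X t = -spaceLaplacian φ X t :=
  congrFun (InnerProductSpace.laplacian_neg (f := fun Y => φ Y t)) X

lemma hasDerivAt_time (hφ : ContDiff ℝ 2 fun p : Plane × ℝ => φ p.1 p.2) (X : Plane) (t : ℝ) :
    HasDerivAt (fun s => φ X s) (fderiv ℝ (fun p : Plane × ℝ => φ p.1 p.2) (X, t) (0, 1)) t :=
  (hφ.differentiable two_ne_zero (X, t)).hasFDerivAt.comp_hasDerivAt t
    ((hasDerivAt_const t X).prodMk (hasDerivAt_id t))

lemma hasDerivAt_space (hφ : ContDiff ℝ 2 fun p : Plane × ℝ => φ p.1 p.2) (X v : Plane) (t : ℝ) :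
    HasDerivAt (fun s : ℝ => φ (X + s • v) t)
      (fderiv ℝ (fun p : Plane × ℝ => φ p.1 p.2) (X, t) (v, 0)) 0 := by
  simpa using hasDerivAt_comp_line (hφ.differentiable two_ne_zero) (X, t) (v, 0) 0

/-- The linear part `φ_t - ∂φ/∂X₂` of the boundary condition. -/
noncomputable def transportTerm (φ : Plane → ℝ → ℝ) (X : Plane) (t : ℝ) : ℝ :=
  deriv (fun s => φ X s) t - lineDeriv ℝ (fun Y => φ Y t) X unitY

lemma transportTerm_eq_fderiv (hφ : ContDiff ℝ 2 fun p : Plane × ℝ => φ p.1 p.2) (X : Plane)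
    (t : ℝ) : transportTerm φ X t = fderiv ℝ (fun p : Plane × ℝ => φ p.1 p.2) (X, t) (0, 1) -
      fderiv ℝ (fun p : Plane × ℝ => φ p.1 p.2) (X, t) (unitY, 0) :=
  congrArg₂ (· - ·) (hasDerivAt_time hφ X t).deriv (hasDerivAt_space hφ X unitY t).deriv

lemma continuous_transportTerm (hφ : ContDiff ℝ 2 fun p : Plane × ℝ => φ p.1 p.2) :
    Continuous fun p : Plane × ℝ => transportTerm φ p.1 p.2 := by
  have hfderiv := hφ.continuous_fderiv two_ne_zero
  simp only [transportTerm_eq_fderiv hφ]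
  exact (hfderiv.clm_apply continuous_const).sub (hfderiv.clm_apply continuous_const)

lemma transportTerm_add (hφ : ContDiff ℝ 2 fun p : Plane × ℝ => φ p.1 p.2)
    (hχ : ContDiff ℝ 2 fun p : Plane × ℝ => χ p.1 p.2) (X : Plane) (t : ℝ) :
    transportTerm (fun Y s => φ Y s + χ Y s) X t = transportTerm φ X t + transportTerm χ X t := by
  rw [transportTerm_eq_fderiv hφ, transportTerm_eq_fderiv hχ, transportTerm_eq_fderiv (hφ.add hχ),
    fderiv_fun_add (hφ.differentiable two_ne_zero _) (hχ.differentiable two_ne_zero _),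
    add_apply, add_apply]
  ring

lemma transportTerm_neg (φ : Plane → ℝ → ℝ) (X : Plane) (t : ℝ) :
    transportTerm (fun Y s => -φ Y s) X t = -transportTerm φ X t := by
  simp only [transportTerm, lineDeriv, deriv.fun_neg]
  ring

lemma boundaryResidual_eq (ε₂ : ℝ) (σ W : ℝ → ℝ) (φ : Plane → ℝ → ℝ) (r : ℝ) (X : Plane) (t : ℝ) :
    boundaryResidual ε₂ σ W φ r X t =
      transportTerm φ X t - (2 * ε₂ * σ (ε₂ * X 0) - deriv W r) := by
  rw [boundaryResidual, transportTerm]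
  ring

end TestFunction

/-- A `C²` function with a strict minimum at `(X₀, t₀)` whose first and second derivatives vanish
there: added to a test function, it makes a local maximum strict. -/
noncomputable def quartic (X₀ : Plane) (t₀ : ℝ) (X : Plane) (t : ℝ) : ℝ :=
  ‖X - X₀‖ ^ 4 + (t - t₀) ^ 4

section Quartic

variable (X₀ : Plane) (t₀ : ℝ)

lemma contDiff_quartic : ContDiff ℝ 2 fun p : Plane × ℝ => quartic X₀ t₀ p.1 p.2 := by
  have hnorm : ContDiff ℝ 2 fun p : Plane × ℝ => ‖p.1 - X₀‖ ^ 2 :=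
    (contDiff_fst.sub contDiff_const).norm_sq ℝ
  have heq : (fun p : Plane × ℝ => quartic X₀ t₀ p.1 p.2) =
      fun p => (‖p.1 - X₀‖ ^ 2) ^ 2 + (p.2 - t₀) ^ 4 := by
    ext p
    rw [quartic, ← pow_mul]
  rw [heq]
  fun_prop

lemma quartic_self : quartic X₀ t₀ X₀ t₀ = 0 := by simp [quartic]

lemma quartic_pos {p : Plane × ℝ} (hp : p ≠ (X₀, t₀)) : 0 < quartic X₀ t₀ p.1 p.2 := by
  rcases eq_or_ne p.1 X₀ with hX | hX
  · have ht : p.2 - t₀ ≠ 0 := sub_ne_zero.2 fun ht => hp (Prod.ext hX ht)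
    rw [quartic]
    positivity
  · have hnorm : 0 < ‖p.1 - X₀‖ := norm_pos_iff.2 (sub_ne_zero.2 hX)
    rw [quartic]
    positivity

lemma quartic_line (v : Plane) :
    (fun s : ℝ => quartic X₀ t₀ (X₀ + s • v) t₀) = fun s => ‖v‖ ^ 4 * s ^ 4 := by
  ext s
  simp [quartic, norm_smul, mul_pow, mul_comm, Even.pow_abs (⟨2, rfl⟩ : Even 4)]

lemma spaceLaplacian_quartic : spaceLaplacian (quartic X₀ t₀) X₀ t₀ = 0 := by
  have hsecond : ∀ v : Plane, deriv (deriv fun s : ℝ => quartic X₀ t₀ (X₀ + s • v) t₀) 0 = 0 :=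
    fun v => by
      have hfirst : (deriv fun s : ℝ => ‖v‖ ^ 4 * s ^ 4) = fun s => ‖v‖ ^ 4 * (4 * s ^ 3) := by
        ext s
        simp
      rw [quartic_line, hfirst]
      simp
  rw [spaceLaplacian, laplacian_eq_sum_deriv_deriv
    (contDiff_space_slice (contDiff_quartic X₀ t₀) t₀), hsecond, hsecond, add_zero]

lemma transportTerm_quartic : transportTerm (quartic X₀ t₀) X₀ t₀ = 0 := by
  simp only [transportTerm, lineDeriv, quartic_line]
  simp [quartic]

end Quartic

/-! ### Duhamel's formula gives viscosity solutions -/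

section StrictMaximum

variable {α β : Type*} [TopologicalSpace α] [TopologicalSpace β] {S : Set α} {p₀ : α}

lemma exists_isCompact_mem_nhdsWithin [LocallyCompactSpace α] (hS : IsLocallyClosed S)
    (hp₀ : p₀ ∈ S) {u : Set α} (hu : u ∈ 𝓝[S] p₀) :
    ∃ K ⊆ S ∩ u, IsCompact K ∧ K ∈ 𝓝[S] p₀ := by
  obtain ⟨U, Z, hU, hZ, rfl⟩ := hS
  obtain ⟨v, hv, hvu⟩ := mem_nhdsWithin_iff_exists_mem_nhds_inter.1 hu
  obtain ⟨K, hK_nhds, hK_sub, hK⟩ := local_compact_nhds (inter_mem (hU.mem_nhds hp₀.1) hv)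
  refine ⟨K ∩ Z, fun p hp => ?_, hK.inter_right hZ, ?_⟩
  · have hpS : p ∈ U ∩ Z := ⟨(hK_sub hp.1).1, hp.2⟩
    exact ⟨hpS, hvu ⟨(hK_sub hp.1).2, hpS⟩⟩
  · filter_upwards [mem_nhdsWithin_of_mem_nhds hK_nhds, self_mem_nhdsWithin] with p hpK hpS
    exact ⟨hpK, hpS.2⟩

theorem eventually_exists_isLocalMaxOn [LocallyCompactSpace α] {F : β → α → ℝ} {b₀ : β}
    (hF : Continuous fun q : β × α => F q.1 q.2) (hS : IsLocallyClosed S) (hp₀ : p₀ ∈ S)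
    (hstrict : ∀ᶠ p in 𝓝[S] p₀, p ≠ p₀ → F b₀ p < F b₀ p₀) {P : β → α → Prop}
    (hP : ∀ᶠ q in 𝓝 b₀ ×ˢ 𝓝[S] p₀, P q.1 q.2) :
    ∀ᶠ b in 𝓝 b₀, ∃ p ∈ S, P b p ∧ IsLocalMaxOn (F b) S p := by
  obtain ⟨K, hK_sub, hK, hK_nhds⟩ := exists_isCompact_mem_nhdsWithin hS hp₀ hstrict
  obtain ⟨Q, hQ, R, hR, hQR⟩ := eventually_prod_iff.1 hP
  obtain ⟨U, hU, hp₀U, hU_sub⟩ :=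
    mem_nhdsWithin.1 (hR.and (eventually_eventually_nhdsWithin.2 hK_nhds))
  have hlt : ∀ᶠ b in 𝓝 b₀, ∀ p ∈ K \ U, F b p < F b p₀ :=
    (hK.diff hU).eventually_forall_of_forall_eventually fun p hp =>
      (hF.tendsto (b₀, p)).eventually_lt
        ((hF.comp (continuous_fst.prodMk continuous_const)).tendsto (b₀, p))
        ((hK_sub hp.1).2 fun h => hp.2 (h ▸ hp₀U))
  filter_upwards [hlt, hQ] with b hb hQb
  have hp₀K : p₀ ∈ K := mem_of_mem_nhdsWithin hp₀ hK_nhds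
  obtain ⟨p, hpK, hp_max⟩ := hK.exists_isMaxOn ⟨p₀, hp₀K⟩ (hF.comp (.prodMk_right b)).continuousOn
  have hpU : p ∈ U := by_contra fun hpU => (hb p ⟨hpK, hpU⟩).not_ge (hp_max hp₀K)
  obtain ⟨hRp, hKp⟩ := hU_sub ⟨hpU, (hK_sub hpK).1⟩
  exact ⟨p, (hK_sub hpK).1, hQR hQb hRp, hKp.mono fun q hq => hp_max hq⟩

end StrictMaximum

lemma deriv_nonpos_of_isLocalMaxOn_Ici {f : ℝ → ℝ} {d t : ℝ} (hf : HasDerivAt f d t)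
    (hmax : IsLocalMaxOn f (Ici t) t) : d ≤ 0 := by
  have hcone : (1 : ℝ) ∈ posTangentConeAt (Ici t) t := by
    refine mem_posTangentConeAt_of_segment_subset ((convex_Ici t).segment_subset self_mem_Ici ?_)
    simp
  simpa using hmax.hasFDerivWithinAt_nonpos hf.hasFDerivAt.hasFDerivWithinAt hcone

lemma continuous_plane_apply (k : Fin 2) : Continuous fun X : Plane => X k := by fun_prop

lemma isClosed_omegaBar : IsClosed OmegaBar :=
  isClosed_le continuous_const (continuous_plane_apply 1)

lemma isLocallyClosed_omegaBar_prod_Ioi : IsLocallyClosed (OmegaBar ×ˢ Ioi (0 : ℝ)) :=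
  ⟨univ ×ˢ Ioi 0, OmegaBar ×ˢ univ, isOpen_univ.prod isOpen_Ioi,
    isClosed_omegaBar.prod isClosed_univ, by rw [prod_inter_prod, univ_inter, inter_univ]⟩

section LocalMaxOn

variable {f : Plane × ℝ → ℝ} {X : Plane} {t : ℝ}

lemma isLocalMax_space_of_isLocalMaxOn (hX : 0 < X 1) (ht : 0 < t)
    (hmax : IsLocalMaxOn f (OmegaBar ×ˢ Ioi 0) (X, t)) : IsLocalMax (fun Y => f (Y, t)) X := by
  have hX_nhds : OmegaBar ∈ 𝓝 X :=
    mem_of_superset ((isOpen_lt continuous_const (continuous_plane_apply 1)).mem_nhds hX)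
      fun Y (hY : 0 < Y 1) => hY.le
  have hloc : IsLocalMax f (X, t) := hmax.isLocalMax (prod_mem_nhds hX_nhds (Ioi_mem_nhds ht))
  exact (Continuous.prodMk_left t).continuousAt.eventually hloc

lemma isLocalMax_time_of_isLocalMaxOn (hX : 0 ≤ X 1) (ht : 0 < t)
    (hmax : IsLocalMaxOn f (OmegaBar ×ˢ Ioi 0) (X, t)) : IsLocalMax (fun s => f (X, s)) t := by
  have htendsto : Tendsto (fun s => (X, s)) (𝓝 t) (𝓝[OmegaBar ×ˢ Ioi 0] (X, t)) :=
    tendsto_nhdsWithin_iff.2 ⟨(Continuous.prodMk_right X).tendsto t,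
      mem_of_superset (Ioi_mem_nhds ht) fun _ hs => ⟨hX, hs⟩⟩
  exact htendsto.eventually hmax

lemma isLocalMaxOn_normal_of_isLocalMaxOn (hX : 0 ≤ X 1) (ht : 0 < t)
    (hmax : IsLocalMaxOn f (OmegaBar ×ˢ Ioi 0) (X, t)) :
    IsLocalMaxOn (fun s : ℝ => f (X + s • unitY, t)) (Ici 0) 0 := by
  have htendsto : Tendsto (fun s : ℝ => (X + s • unitY, t)) (𝓝[≥] 0)
      (𝓝[OmegaBar ×ˢ Ioi 0] (X, t)) := by
    refine tendsto_nhdsWithin_iff.2 ⟨?_, ?_⟩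
    · exact (Continuous.tendsto' (by fun_prop) _ _ (by simp)).mono_left nhdsWithin_le_nhds
    · filter_upwards [self_mem_nhdsWithin] with s hs
      have hs0 : 0 ≤ s := hs
      exact ⟨by simpa [OmegaBar] using add_nonneg hX hs0, ht⟩
  have hle := htendsto.eventually hmax
  simpa [IsLocalMaxOn, IsMaxFilter] using hle

end LocalMaxOn

section Viscosity

variable {g : ℝ → ℝ} {G : ℝ → ℝ → ℝ} {M t : ℝ} {X : Plane} {φ : Plane → ℝ → ℝ}

lemma duhamel_neg (g : ℝ → ℝ) (G : ℝ → ℝ → ℝ) (x y t : ℝ) :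
    duhamel (fun w => -g w) (fun w s => -G w s) x y t = -duhamel g G x y t := by
  simp only [duhamel, poissonAvg, mul_neg, integral_neg, intervalIntegral.integral_neg, neg_add]

namespace IsBoundedSource

lemma neg (h : IsBoundedSource g G M) :
    IsBoundedSource (fun w => -g w) (fun w s => -G w s) M where
  continuous_initial := h.continuous_initial.neg
  abs_initial_le w := (abs_neg _).trans_le (h.abs_initial_le w)
  continuous_forcing := h.continuous_forcing.neg
  abs_forcing_le w s := (abs_neg _).trans_le (h.abs_forcing_le w s)

lemma spaceLaplacian_nonneg (h : IsBoundedSource g G M) {δ : ℝ} (hX : 0 < X 1) (hδ : 0 ≤ δ)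
    (ht : 0 < t) (hφ : ContDiff ℝ 2 fun p : Plane × ℝ => φ p.1 p.2)
    (hmax : IsLocalMaxOn (fun p : Plane × ℝ => duhamel g G (p.1 0) (p.1 1 + δ) p.2 - φ p.1 p.2)
      (OmegaBar ×ˢ Ioi 0) (X, t)) : 0 ≤ spaceLaplacian φ X t := by
  have hXδ : 0 < X 1 + δ := by positivity
  refine laplacian_nonneg_of_isLocalMax (f := fun Y => duhamel g G (Y 0) (Y 1 + δ) t)
    (C := 8 / (X 1 + δ) ^ 4 * M * (1 + t)) (contDiff_space_slice hφ t) ?_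
    (isLocalMax_space_of_isLocalMaxOn hX ht hmax)
  filter_upwards [Ioo_mem_nhdsGT (half_pos hXδ)] with s hs
  have hsecond := neg_le_of_abs_le (h.abs_discrete_laplacian_duhamel_le (x := X 0) hXδ ht.le
    ((abs_of_pos hs.1).trans_le hs.2.le))
  simp only [PiLp.add_apply, PiLp.sub_apply, PiLp.smul_apply, PiLp.single_apply, Fin.isValue,
    smul_eq_mul, if_true, one_ne_zero, zero_ne_one, if_false, mul_one, mul_zero, add_zero, sub_zero,
    add_right_comm _ s δ, sub_add_eq_add_sub]
  exact (by ring : _ = _).trans_le hsecond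

theorem viscosity_test_of_pos (h : IsBoundedSource g G M) {δ : ℝ} (hδ : 0 < δ) (hX : 0 ≤ X 1)
    (ht : 0 < t) (hφ : ContDiff ℝ 2 fun p : Plane × ℝ => φ p.1 p.2)
    (hmax : IsLocalMaxOn (fun p : Plane × ℝ => duhamel g G (p.1 0) (p.1 1 + δ) p.2 - φ p.1 p.2)
      (OmegaBar ×ˢ Ioi 0) (X, t)) :
    0 ≤ spaceLaplacian φ X t ∨
      transportTerm φ X t ≤ poissonAvg (X 1 + δ) (fun w => G w t) (X 0) := by
  have hXδ : 0 < X 1 + δ := add_pos_of_nonneg_of_pos hX hδ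
  rcases hX.lt_or_eq with hX_pos | _
  · exact .inl (h.spaceLaplacian_nonneg hX_pos hδ.le ht hφ hmax)
  · right
    have htime := (isLocalMax_time_of_isLocalMaxOn hX ht hmax).hasDerivAt_eq_zero
      ((h.hasDerivAt_duhamel_time (x := X 0) hXδ ht.le).fun_sub (hasDerivAt_time hφ X t))
    have hnormal_max := isLocalMaxOn_normal_of_isLocalMaxOn hX ht hmax
    simp only [PiLp.add_apply, PiLp.smul_apply, PiLp.single_apply, Fin.isValue, smul_eq_mul,
      if_true, zero_ne_one, if_false, mul_one, mul_zero, add_zero,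
      add_right_comm _ _ δ] at hnormal_max
    have hnormal := deriv_nonpos_of_isLocalMaxOn_Ici
      ((h.hasDerivAt_duhamel_normal (x := X 0) hXδ ht.le).fun_sub
        (hasDerivAt_space hφ X unitY t)) hnormal_max
    rw [transportTerm_eq_fderiv hφ]
    linarith

/-- The formula is smooth at heights `δ > 0` only, so the maximum is moved to such heights. -/
theorem viscosity_test_of_strict (h : IsBoundedSource g G M) (hX : 0 ≤ X 1) (ht : 0 < t)
    (hφ : ContDiff ℝ 2 fun p : Plane × ℝ => φ p.1 p.2)
    (hmax : ∀ᶠ p in 𝓝[OmegaBar ×ˢ Ioi 0] (X, t), p ≠ (X, t) →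
      duhamel g G (p.1 0) (p.1 1) p.2 - φ p.1 p.2 < duhamel g G (X 0) (X 1) t - φ X t) :
    0 ≤ spaceLaplacian φ X t ∨ transportTerm φ X t ≤ poissonAvg (X 1) (fun w => G w t) (X 0) := by
  by_contra! hcon
  let F : ℝ → Plane × ℝ → ℝ := fun δ p => duhamel g G (p.1 0) (p.1 1 + δ) p.2 - φ p.1 p.2
  have hF : Continuous fun q : ℝ × Plane × ℝ => F q.1 q.2 :=
    (h.continuous_duhamel.comp (by fun_prop : Continuous fun q : ℝ × Plane × ℝ =>
      (q.2.1 0, q.2.1 1 + q.1, q.2.2))).sub (hφ.continuous.comp continuous_snd)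
  have hforcing : Continuous fun q : ℝ × Plane × ℝ =>
      poissonAvg (q.2.1 1 + q.1) (fun w => G w q.2.2) (q.2.1 0) :=
    h.continuous_poissonAvg_forcing (by fun_prop) (by fun_prop) (by fun_prop)
  let U : Set (ℝ × Plane × ℝ) := {q | spaceLaplacian φ q.2.1 q.2.2 < 0} ∩
    {q | poissonAvg (q.2.1 1 + q.1) (fun w => G w q.2.2) (q.2.1 0) < transportTerm φ q.2.1 q.2.2}
  have hU : U ∈ 𝓝 (0, X, t) := by
    refine (IsOpen.inter ?_ ?_).mem_nhds ⟨hcon.1, ?_⟩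
    · exact isOpen_lt ((continuous_spaceLaplacian hφ).comp continuous_snd) continuous_const
    · exact isOpen_lt hforcing ((continuous_transportTerm hφ).comp continuous_snd)
    · simpa only [mem_ofPred_eq, add_zero] using hcon.2
  have hU_prod : U ∈ 𝓝 (0 : ℝ) ×ˢ 𝓝[OmegaBar ×ˢ Ioi 0] (X, t) := by
    rw [nhds_prod_eq] at hU
    exact Filter.prod_mono le_rfl nhdsWithin_le_nhds hU
  have hexists : ∀ᶠ δ in 𝓝 (0 : ℝ), ∃ p ∈ OmegaBar ×ˢ Ioi (0 : ℝ), (δ, p) ∈ U ∧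
      IsLocalMaxOn (F δ) (OmegaBar ×ˢ Ioi 0) p :=
    eventually_exists_isLocalMaxOn hF isLocallyClosed_omegaBar_prod_Ioi (mk_mem_prod hX ht)
      (by simpa only [F, add_zero] using hmax) hU_prod
  obtain ⟨δ, ⟨⟨Y, s⟩, ⟨hY, hs⟩, ⟨hlaplacian, htransport⟩, hδ_max⟩, hδ⟩ :=
    ((hexists.filter_mono (nhdsWithin_le_nhds (s := Ioi 0))).and self_mem_nhdsWithin).exists
  exact (h.viscosity_test_of_pos hδ hY hs hφ hδ_max).elim
    (not_le_of_gt hlaplacian) (not_le_of_gt htransport)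

theorem viscosity_test (h : IsBoundedSource g G M) (hX : 0 ≤ X 1) (ht : 0 < t)
    (hφ : ContDiff ℝ 2 fun p : Plane × ℝ => φ p.1 p.2)
    (hmax : IsLocalMaxOn (fun p : Plane × ℝ => duhamel g G (p.1 0) (p.1 1) p.2 - φ p.1 p.2)
      (OmegaBar ×ˢ Ioi 0) (X, t)) :
    0 ≤ spaceLaplacian φ X t ∨ transportTerm φ X t ≤ poissonAvg (X 1) (fun w => G w t) (X 0) := by
  have hquartic := contDiff_quartic X t
  have htest := h.viscosity_test_of_strict (φ := fun Y s => φ Y s + quartic X t Y s) hX ht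
    (hφ.add hquartic) <| by
    filter_upwards [hmax] with p hp hne
    have hpos := quartic_pos X t hne
    rw [quartic_self]
    linarith
  rwa [spaceLaplacian_add hφ hquartic, spaceLaplacian_quartic, add_zero,
    transportTerm_add hφ hquartic, transportTerm_quartic, add_zero] at htest

end IsBoundedSource

section Solution

variable {ε₂ : ℝ} {σ W : ℝ → ℝ} {u₀ : Plane → ℝ}

lemma IsBoundedSource.isPNSubsolution (h : IsBoundedSource g G M)
    (hg : ∀ X : Plane, X 1 = 0 → g (X 0) ≤ u₀ X)
    (hG : ∀ x t, 0 ≤ t → G x t ≤ 2 * ε₂ * σ (ε₂ * x) - deriv W (duhamel g G x 0 t)) :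
    IsPNSubsolution ε₂ σ W u₀ fun X t => duhamel g G (X 0) (X 1) t where
  usc := Continuous.upperSemicontinuous (h.continuous_duhamel.comp
    (by fun_prop : Continuous fun p : Plane × ℝ => (p.1 0, p.1 1, p.2)))
    |>.upperSemicontinuousOn _
  interior X hX t ht φ hφ hmax :=
    neg_nonpos.2 (h.spaceLaplacian_nonneg hX le_rfl ht hφ (by simpa only [add_zero] using hmax))
  boundary X hX t ht φ hφ hmax := by
    rw [min_le_iff, neg_nonpos, boundaryResidual_eq, sub_nonpos, hX]
    have htest := h.viscosity_test hX.ge ht hφ hmax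
    rw [hX, poissonAvg_zero] at htest
    exact htest.imp_right fun htransport => htransport.trans (hG _ _ ht.le)
  initial X hX := by simpa [duhamel, hX, poissonAvg_zero] using hg X hX

lemma isPNSupersolution_of_neg {u : Plane → ℝ → ℝ}
    (h : IsPNSubsolution ε₂ (fun x => -σ x) (fun a => W (-a)) (fun X => -u₀ X) fun X t => -u X t) :
    IsPNSupersolution ε₂ σ W u₀ u where
  lsc := by simpa only [Pi.neg_def, neg_neg] using h.usc.neg
  interior X hX t ht φ hφ hmin := by
    have hmax := hmin.neg
    have hsub := h.interior X hX t ht (fun Y s => -φ Y s) hφ.neg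
      (by simpa only [neg_sub, sub_neg_eq_add, neg_add_eq_sub] using hmax)
    rw [spaceLaplacian_neg] at hsub
    linarith
  boundary X hX t ht φ hφ hmin := by
    have hmax := hmin.neg
    have hsub := h.boundary X hX t ht (fun Y s => -φ Y s) hφ.neg
      (by simpa only [neg_sub, sub_neg_eq_add, neg_add_eq_sub] using hmax)
    rw [spaceLaplacian_neg, boundaryResidual_eq, transportTerm_neg, deriv_comp_neg] at hsub
    simp only [neg_neg] at hsub
    rw [boundaryResidual_eq]
    refine le_max_iff.2 ((min_le_iff.1 hsub).imp ?_ ?_) <;> intro hle <;> linarith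
  initial X hX := neg_le_neg_iff.1 (h.initial X hX)

theorem IsBoundedSource.isPNSolution (h : IsBoundedSource g G M)
    (hg : ∀ X : Plane, X 1 = 0 → g (X 0) = u₀ X)
    (hG : ∀ x t, 0 ≤ t → G x t = 2 * ε₂ * σ (ε₂ * x) - deriv W (duhamel g G x 0 t)) :
    IsPNSolution ε₂ σ W u₀ fun X t => duhamel g G (X 0) (X 1) t where
  sub := h.isPNSubsolution (fun X hX => (hg X hX).le) fun x t ht => (hG x t ht).le
  super := by
    have hsub := h.neg.isPNSubsolution (ε₂ := ε₂) (σ := fun x => -σ x) (W := fun a => W (-a))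
      (u₀ := fun X => -u₀ X) (fun X hX => (congrArg Neg.neg (hg X hX)).le) fun x t ht => by
        rw [duhamel_neg, deriv_comp_neg, neg_neg, hG x t ht]
        linarith
    simp only [duhamel_neg] at hsub
    exact isPNSupersolution_of_neg hsub
  bounded T := by
    refine ⟨M * (1 + T), fun X _ t ht => (h.abs_duhamel_le _ _ ht.1).trans ?_⟩
    have hM := h.nonneg
    gcongr
    exact ht.2

end Solution

end Viscosity

/-! ### Convergence of the lattice solutions -/

lemma eventually_lt_nhdsGT_zero {f : ℝ → ℝ} {c : ℝ} (hf : Continuous f) (hc : f 0 < c) :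
    ∀ᶠ x in 𝓝[>] 0, f x < c :=
  ((hf.tendsto 0).mono_left nhdsWithin_le_nhds).eventually_lt_const hc

/-- The comparison is localized in a strip whose height `Y` is chosen before the tolerance `η`. -/
theorem IsApproxSubsolution.exists_forall_le {K M T θ : ℝ} (hK : 0 ≤ K) (hM : 0 ≤ M)
    (hθ : 0 < θ) : ∃ η > 0, ∀ ε ∈ Ioc 0 1, ∀ e : ℤ → ℕ → ℝ → ℝ, IsApproxSubsolution ε T K η M e →
      ∀ (i : ℤ) (j : ℕ), ε * j ≤ T → ∀ t ∈ Icc 0 T, e i j t ≤ θ := by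
  let E : ℝ := Real.exp ((K + 1) * T)
  have hYlim : Tendsto (fun Y => E * (M / Y * (1 + T))) atTop (𝓝 0) := by
    simpa using ((tendsto_const_nhds.div_atTop tendsto_id).mul_const (1 + T)).const_mul E
  obtain ⟨Y, hYθ, hYT⟩ :=
    ((hYlim.eventually_lt_const hθ).and (eventually_ge_atTop (max T 1))).exists
  have hY : 0 < Y := by linarith [(le_max_right T 1).trans hYT]
  have hηlim : ∀ᶠ η in 𝓝[>] (0 : ℝ),
      E * (M / Y * (1 + T) + 2 * η * (1 + (Y + 1) + (Y + 1) * T)) < θ :=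
    eventually_lt_nhdsGT_zero (by fun_prop) (by simpa using hYθ)
  obtain ⟨η, hηθ, hη : 0 < η⟩ := (hηlim.and self_mem_nhdsWithin).exists
  refine ⟨η, hη, fun ε ⟨hε, hε1⟩ e he i j hj t ht => ?_⟩
  let n : ℕ := ⌈Y / ε⌉₊
  have hn : 0 < n := Nat.ceil_pos.2 (by positivity)
  have hYn : Y ≤ ε * n := (div_le_iff₀' hε).1 (Nat.le_ceil _)
  have hnY : ε * n ≤ Y + 1 := by
    have hceil : (n : ℝ) < Y / ε + 1 := Nat.ceil_lt_add_one (by positivity)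
    calc ε * n ≤ ε * (Y / ε + 1) := by gcongr
      _ = Y + ε := by field_simp
      _ ≤ Y + 1 := by gcongr
  have hjn : j ≤ n := by
    have hle : ε * j ≤ ε * n := hj.trans ((le_max_left T 1).trans (hYT.trans hYn))
    exact_mod_cast le_of_mul_le_mul_left hle hε
  calc e i j t ≤ Real.exp ((K + 1) * t) *
        (M / (ε * n) * (1 + ε * j) + 2 * η * (1 + ε * n + ε * n * (ε * j))) :=
        he.le_exp_mul hε hη hM hK hn hjn ht
    _ ≤ E * (M / Y * (1 + T) + 2 * η * (1 + (Y + 1) + (Y + 1) * T)) := by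
        have htT := ht.2
        have : 0 ≤ T := ht.1.trans htT
        simp only [E]
        gcongr
    _ ≤ θ := hηθ.le

theorem IsLatticeSolution.abs_le_add_mul {ε ε₂ : ℝ} (hε : 0 < ε) {σ Weps : ℝ → ℝ} {u₀ : Plane → ℝ}
    {u : ℤ → ℕ → ℝ → ℝ} (hu : IsLatticeSolution ε ε₂ σ Weps u₀ u) (hW : Continuous (deriv Weps))
    {M C : ℝ} (hM : ∀ i, |u₀ (latticePoint ε i 0)| ≤ M)
    (hC : ∀ x r, |2 * ε₂ * σ (ε₂ * x) - deriv Weps r| ≤ C) (i : ℤ) (j : ℕ) {t : ℝ} (ht : 0 ≤ t) :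
    |u i j t| ≤ M + C * t := by
  obtain ⟨B, hB⟩ := hu.bounded t
  have hlinear : ∀ s : ℝ, HasDerivAt (fun s => M + C * s) C s := fun s => by
    simpa using ((hasDerivAt_id s).const_mul C).const_add M
  have hM_nonneg : 0 ≤ M := (abs_nonneg _).trans (hM 0)
  have hC_nonneg : 0 ≤ C := (abs_nonneg _).trans (hC 0 0)
  have hsub : ∀ c : ℝ, |c| = 1 →
      IsApproxSubsolution ε t 0 0 B fun i j s => c * u i j s - (M + C * s) := fun c hc =>
    have hle : ∀ {a b : ℝ}, |a| ≤ b → c * a ≤ b := fun {a b} hab =>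
      (le_abs_self _).trans (by rwa [abs_mul, hc, one_mul])
    { continuousOn := fun i j => (((hu.continuousOn i j).mono Icc_subset_Ici_self).const_smul c).sub
        (by fun_prop)
      le := fun i j s hs => by linarith [hle (hB i j s hs), mul_nonneg hC_nonneg hs.1]
      interior := fun i j s hs => by
        rw [discreteLaplacian_sub, discreteLaplacian_mul (c := fun _ => c),
          hu.discreteLaplacian_eq_zero i j hs.1]
        simp [discreteLaplacian]
      boundary := fun i s hs _ => by
        refine ⟨_, ((hu.hasDerivAt hW i hs.1).const_mul c).sub (hlinear s), ?_⟩
        rw [boundaryOperator_sub, boundaryOperator_mul (c := fun _ => c), boundaryForce, mul_add]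
        have hconst : boundaryOperator ε (fun _ _ s => M + C * s) i s = 0 := by
          simp [boundaryOperator]
        linarith [hle (hC (ε * i) (u i 0 s))]
      initial := fun i => by
        rw [hu.initial_eq]
        linarith [hle (hM i)] }
  have hbound := fun c hc => sub_nonpos.1 ((hsub c hc).nonpos hε le_rfl i j ⟨ht, le_rfl⟩)
  refine abs_le'.2 ⟨?_, ?_⟩
  · simpa using hbound 1 abs_one
  · simpa using hbound (-1) (by simp)

section Consistency

variable {g : ℝ → ℝ} {G : ℝ → ℝ → ℝ} {M ε δ t : ℝ}

lemma IsBoundedSource.abs_discreteLaplacian_le (h : IsBoundedSource g G M) (hε : 0 < ε)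
    (hδ : 0 < δ) (hεδ : ε ≤ δ / 2) (ht : 0 ≤ t) (i : ℤ) (j : ℕ) :
    |discreteLaplacian ε (fun i j s => duhamel g G (ε * i) (ε * j + δ) s) i j t| ≤
      8 * ε ^ 2 / δ ^ 4 * M * (1 + t) := by
  have hM := h.nonneg
  have hy : δ ≤ ε * (j + 1) + δ := le_add_of_nonneg_left (by positivity)
  have hsum := h.abs_discrete_laplacian_duhamel_le (x := ε * i) (ε := ε) (hδ.trans_le hy) ht
    (by rw [abs_of_pos hε]; linarith)
  have heq : discreteLaplacian ε (fun i j s => duhamel g G (ε * i) (ε * j + δ) s) i j t =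
      1 / ε ^ 2 * (duhamel g G (ε * i + ε) (ε * (j + 1) + δ) t +
        duhamel g G (ε * i - ε) (ε * (j + 1) + δ) t +
        duhamel g G (ε * i) (ε * (j + 1) + δ + ε) t +
        duhamel g G (ε * i) (ε * (j + 1) + δ - ε) t -
        4 * duhamel g G (ε * i) (ε * (j + 1) + δ) t) := by
    unfold discreteLaplacian
    push_cast
    ring_nf
  rw [heq, abs_mul, abs_of_pos (by positivity : 0 < 1 / ε ^ 2)]
  calc _ ≤ 1 / ε ^ 2 * (8 * ε ^ 4 / δ ^ 4 * M * (1 + t)) := by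
        gcongr
        exact hsum.trans (by gcongr)
    _ = _ := by field_simp

lemma IsBoundedSource.abs_boundaryOperator_sub_le (h : IsBoundedSource g G M) (hε : 0 < ε)
    (hδ : 0 < δ) (hεδ : ε ≤ δ / 2) (ht : 0 ≤ t) (i : ℤ) :
    |boundaryOperator ε (fun i j s => duhamel g G (ε * i) (ε * j + δ) s) i t -
      duhamelDeriv g G (ε * i) δ t| ≤ 6 * ε / δ ^ 2 * M * (1 + t) := by
  have hεδ' : |ε| ≤ δ / 2 := by rwa [abs_of_pos hε]
  have hsecond := h.abs_second_difference_duhamel_le (x := ε * i) hδ ht hεδ'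
  have htaylor := h.abs_taylor_duhamel_le (x := ε * i) hδ ht hεδ'
  have heq : boundaryOperator ε (fun i j s => duhamel g G (ε * i) (ε * j + δ) s) i t -
      duhamelDeriv g G (ε * i) δ t = 1 / ε *
        ((duhamel g G (ε * i + ε) δ t + duhamel g G (ε * i - ε) δ t - 2 * duhamel g G (ε * i) δ t) +
        (duhamel g G (ε * i) (δ + ε) t - duhamel g G (ε * i) δ t -
          ε * duhamelDeriv g G (ε * i) δ t)) := by
    unfold boundaryOperator
    push_cast
    field_simp
    ring_nf
  rw [heq, abs_mul, abs_of_pos (by positivity : 0 < 1 / ε)]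
  calc _ ≤ 1 / ε * (4 * ε ^ 2 / δ ^ 2 * M * (1 + t) + 2 * ε ^ 2 / δ ^ 2 * M * (1 + t)) := by
        gcongr
        exact (abs_add_le _ _).trans (add_le_add hsecond htaylor)
    _ = _ := by field_simp; ring

end Consistency

lemma IsApproxLatticeSolution.mono {ε T η η' M : ℝ} {F : ℤ → ℝ → ℝ} {b : ℤ → ℝ}
    {u : ℤ → ℕ → ℝ → ℝ} (hu : IsApproxLatticeSolution ε T η M F b u) (hη : η ≤ η') :
    IsApproxLatticeSolution ε T η' M F b u where
  continuousOn := hu.continuousOn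
  abs_apply_le := hu.abs_apply_le
  interior i j t ht := (hu.interior i j t ht).trans hη
  boundary i t ht := (hu.boundary i t ht).imp fun _ hd => ⟨hd.1, hd.2.trans hη⟩
  initial i := (hu.initial i).trans hη

section ShiftedDuhamel

variable {g : ℝ → ℝ} {G F : ℝ → ℝ → ℝ} {M K T : ℝ} {L : NNReal}

lemma IsBoundedSource.abs_poissonAvg_sub_le (h : IsBoundedSource g G M) (hg : LipschitzWith L g)
    (hGL : ∀ s ∈ Icc 0 T, LipschitzWith L fun w => G w s)
    (hG : ∀ x t, 0 ≤ t → G x t = F x (duhamel g G x 0 t)) (hK : 0 ≤ K)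
    (hF : ∀ x r s, |F x r - F x s| ≤ K * |r - s|) {t : ℝ} (ht : t ∈ Icc 0 T) (x δ : ℝ) :
    |poissonAvg δ (fun w => G w t) x - F x (duhamel g G x δ t)| ≤
      poissonModulus M L δ * (1 + K * (1 + t)) := by
  have haverage := abs_poissonAvg_add_sub_le (h.abs_forcing_le · t) (hGL t ht) 0 δ x
  have hshift := h.abs_duhamel_shift_sub_le hg ht.1
    (fun s hs => hGL s ⟨hs.1, hs.2.trans ht.2⟩) x 0 δ
  rw [zero_add, poissonAvg_zero, hG x t ht.1] at haverage
  rw [zero_add, abs_sub_comm] at hshift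
  calc |poissonAvg δ (fun w => G w t) x - F x (duhamel g G x δ t)|
      ≤ |poissonAvg δ (fun w => G w t) x - F x (duhamel g G x 0 t)| +
        |F x (duhamel g G x 0 t) - F x (duhamel g G x δ t)| := abs_sub_le _ _ _
    _ ≤ poissonModulus M L δ + K * (poissonModulus M L δ * (1 + t)) :=
        add_le_add haverage ((hF _ _ _).trans (by gcongr))
    _ = poissonModulus M L δ * (1 + K * (1 + t)) := by ring

/-- Shifting by `δ` keeps the evaluation points away from the boundary, where the Duhamel integral
need not have bounded second derivatives. -/
theorem IsBoundedSource.isApproxLatticeSolution (h : IsBoundedSource g G M)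
    (hg : LipschitzWith L g) (hGL : ∀ s ∈ Icc 0 T, LipschitzWith L fun w => G w s)
    (hG : ∀ x t, 0 ≤ t → G x t = F x (duhamel g G x 0 t)) (hK : 0 ≤ K)
    (hF : ∀ x r s, |F x r - F x s| ≤ K * |r - s|) (hT : 0 ≤ T) {ε δ : ℝ} (hε : 0 < ε) (hδ : 0 < δ)
    (hεδ : ε ≤ δ / 2) :
    IsApproxLatticeSolution ε T (8 * ε ^ 2 / δ ^ 4 * M * (1 + T) + 6 * ε / δ ^ 2 * M * (1 + T) +
      poissonModulus M L δ * (1 + K * (1 + T))) (M * (1 + T)) (fun i => F (ε * i))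
      (fun i => g (ε * i)) fun i j t => duhamel g G (ε * i) (ε * j + δ) t := by
  have hM := h.nonneg
  have hmodulus := poissonModulus_nonneg hM L.coe_nonneg δ
  have hlaplacian : 0 ≤ 8 * ε ^ 2 / δ ^ 4 * M * (1 + T) := by positivity
  have hoperator : 0 ≤ 6 * ε / δ ^ 2 * M * (1 + T) := by positivity
  have hreaction : 0 ≤ poissonModulus M L δ * (1 + K * (1 + T)) := by positivity
  constructor
  · intro i j
    exact (h.continuous_duhamel.comp
      (by fun_prop : Continuous fun t : ℝ => (ε * i, ε * j + δ, t))).continuousOn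
  · intro i j t ht
    refine (h.abs_duhamel_le _ _ ht.1).trans ?_
    gcongr
    exact ht.2
  · intro i j t ht
    have hbound : 8 * ε ^ 2 / δ ^ 4 * M * (1 + t) ≤ 8 * ε ^ 2 / δ ^ 4 * M * (1 + T) := by
      gcongr
      exact ht.2
    linarith [h.abs_discreteLaplacian_le hε hδ hεδ ht.1 i j]
  · intro i t ht
    have hbound : 6 * ε / δ ^ 2 * M * (1 + t) + poissonModulus M L δ * (1 + K * (1 + t)) ≤
        6 * ε / δ ^ 2 * M * (1 + T) + poissonModulus M L δ * (1 + K * (1 + T)) := by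
      gcongr <;> exact ht.2
    have hsource := h.abs_poissonAvg_sub_le hg hGL hG hK hF (Ioc_subset_Icc_self ht) (ε * i) δ
    have hnormal := h.abs_boundaryOperator_sub_le hε hδ hεδ ht.1.le i
    simp only [Nat.cast_zero, mul_zero, zero_add]
    refine ⟨_, h.hasDerivAt_duhamel_time hδ ht.1.le, ?_⟩
    rw [abs_le] at hsource hnormal ⊢
    constructor <;> linarith
  · intro i
    have hshift := abs_poissonAvg_add_sub_le h.abs_initial_le hg 0 δ (ε * i)
    rw [zero_add, poissonAvg_zero] at hshift
    have hbound : poissonModulus M L δ * 1 ≤ poissonModulus M L δ * (1 + K * (1 + T)) := by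
      gcongr
      exact le_add_of_nonneg_right (by positivity)
    simp only [duhamel, Nat.cast_zero, mul_zero, zero_add, add_zero,
      intervalIntegral.integral_same]
    linarith

theorem IsDuhamelData.eventually_isApproxLatticeSolution (h : IsDuhamelData g G M)
    (hG : ∀ x t, 0 ≤ t → G x t = F x (duhamel g G x 0 t)) (hK : 0 ≤ K)
    (hF : ∀ x r s, |F x r - F x s| ≤ K * |r - s|) (hT : 0 ≤ T) {η : ℝ} (hη : 0 < η) :
    ∀ᶠ δ in 𝓝[>] (0 : ℝ), ∀ᶠ ε in 𝓝[>] (0 : ℝ), IsApproxLatticeSolution ε T η (M * (1 + T))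
      (fun i => F (ε * i)) (fun i => g (ε * i))
      fun i j t => duhamel g G (ε * i) (ε * j + δ) t := by
  obtain ⟨L, hg, hGL⟩ := h.lipschitz T
  have hmodulus : ∀ᶠ δ in 𝓝[>] (0 : ℝ), poissonModulus M L δ * (1 + K * (1 + T)) < η :=
    eventually_lt_nhdsGT_zero
      ((continuous_poissonModulus h.nonneg L.coe_nonneg).mul continuous_const)
      (by rwa [poissonModulus_zero h.nonneg, zero_mul])
  filter_upwards [hmodulus, self_mem_nhdsWithin] with δ hδη (hδ : 0 < δ)
  have hresidual : ∀ᶠ ε in 𝓝[>] (0 : ℝ), 8 * ε ^ 2 / δ ^ 4 * M * (1 + T) +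
      6 * ε / δ ^ 2 * M * (1 + T) + poissonModulus M L δ * (1 + K * (1 + T)) < η :=
    eventually_lt_nhdsGT_zero (by fun_prop) (by simpa using hδη)
  filter_upwards [hresidual, eventually_lt_nhdsGT_zero continuous_id (half_pos hδ),
    self_mem_nhdsWithin] with ε hεη hεδ hε
  exact (h.isApproxLatticeSolution hg hGL hG hK hF hT hε hδ hεδ.le).mono hεη.le

theorem IsDuhamelData.eventually_abs_shift_sub_le (h : IsDuhamelData g G M) {θ : ℝ}
    (hθ : 0 < θ) : ∀ᶠ δ in 𝓝[>] (0 : ℝ), ∀ x y, ∀ t ∈ Icc 0 T,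
      |duhamel g G x (y + δ) t - duhamel g G x y t| ≤ θ := by
  obtain ⟨L, hg, hGL⟩ := h.lipschitz T
  have hmodulus : ∀ᶠ δ in 𝓝[>] (0 : ℝ), poissonModulus M L δ * (1 + T) < θ :=
    eventually_lt_nhdsGT_zero
      ((continuous_poissonModulus h.nonneg L.coe_nonneg).mul continuous_const)
      (by rwa [poissonModulus_zero h.nonneg, zero_mul])
  filter_upwards [hmodulus] with δ hδ x y t ht
  calc |duhamel g G x (y + δ) t - duhamel g G x y t| ≤ poissonModulus M L δ * (1 + t) :=
        h.abs_duhamel_shift_sub_le hg ht.1 (fun s hs => hGL s ⟨hs.1, hs.2.trans ht.2⟩) x y δ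
    _ ≤ poissonModulus M L δ * (1 + T) := by
        have hnonneg := poissonModulus_nonneg h.nonneg L.coe_nonneg δ
        have : 0 ≤ T := ht.1.trans ht.2
        gcongr
        exact ht.2
    _ ≤ θ := hδ.le

end ShiftedDuhamel

section Convergence

variable {ε₂ : ℝ} {σ W : ℝ → ℝ} {u₀ : Plane → ℝ} {Weps : ℝ → ℝ → ℝ}
  {ueps : ℝ → ℤ → ℕ → ℝ → ℝ} {M C T η : ℝ}

theorem eventually_isApproxLatticeSolution_of_tendstoUniformly
    (hM : ∀ X : Plane, X 1 = 0 → |u₀ X| ≤ M)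
    (hC : ∀ x r, |2 * ε₂ * σ (ε₂ * x) - deriv W r| ≤ C)
    (hWeps : ∀ᶠ ε in 𝓝[>] (0 : ℝ), Continuous (deriv (Weps ε)))
    (hW : TendstoUniformly (fun ε => deriv (Weps ε)) (deriv W) (𝓝[>] 0))
    (hu : ∀ᶠ ε in 𝓝[>] (0 : ℝ), IsLatticeSolution ε ε₂ σ (Weps ε) u₀ (ueps ε)) (hη : 0 < η) :
    ∀ᶠ ε in 𝓝[>] (0 : ℝ), IsApproxLatticeSolution ε T η (M + (C + 1) * T)
      (fun i r => 2 * ε₂ * σ (ε₂ * (ε * i)) - deriv W r) (fun i => u₀ (latticePoint ε i 0))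
      (ueps ε) := by
  filter_upwards [hWeps, hu, self_mem_nhdsWithin, Metric.tendstoUniformly_iff.1 hW 1 one_pos,
    Metric.tendstoUniformly_iff.1 hW η hη] with ε hcont hsol hε hdist_one hdist
  have hC_nonneg : 0 ≤ C := (abs_nonneg _).trans (hC 0 0)
  have hforce : ∀ x r, |2 * ε₂ * σ (ε₂ * x) - deriv (Weps ε) r| ≤ C + 1 := fun x r =>
    (abs_sub_le _ (deriv W r) _).trans (add_le_add (hC x r) (hdist_one r).le)
  refine hsol.isApproxLatticeSolution hcont hη.le (fun a => (hdist a).le) fun i j t ht => ?_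
  calc |ueps ε i j t| ≤ M + (C + 1) * t :=
        hsol.abs_le_add_mul hε hcont (fun i => hM _ (by simp [latticePoint])) hforce i j ht.1
    _ ≤ M + (C + 1) * T := by
        gcongr
        exact ht.2

theorem IsDuhamelData.latticeTendstoLocallyUniformly {g : ℝ → ℝ} {G : ℝ → ℝ → ℝ}
    (h : IsDuhamelData g G M) (hg : ∀ X : Plane, X 1 = 0 → g (X 0) = u₀ X)
    (hG : ∀ x t, 0 ≤ t → G x t = 2 * ε₂ * σ (ε₂ * x) - deriv W (duhamel g G x 0 t))
    (hWlip : IsBoundedLipschitz (deriv W))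
    (hC : ∀ x r, |2 * ε₂ * σ (ε₂ * x) - deriv W r| ≤ C)
    (hWeps : ∀ᶠ ε in 𝓝[>] (0 : ℝ), Continuous (deriv (Weps ε)))
    (hW : TendstoUniformly (fun ε => deriv (Weps ε)) (deriv W) (𝓝[>] 0))
    (hu : ∀ᶠ ε in 𝓝[>] (0 : ℝ), IsLatticeSolution ε ε₂ σ (Weps ε) u₀ (ueps ε)) :
    LatticeTendstoLocallyUniformly ueps fun X t => duhamel g G (X 0) (X 1) t := by
  intro R θ hθ
  obtain hR | hR := lt_or_ge R 0
  · exact .of_forall fun ε i j t ht => absurd (ht.1.trans ht.2) hR.not_ge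
  obtain ⟨K, hK, hlip⟩ := hWlip.exists_abs_sub_le
  have hF : ∀ x r s, |2 * ε₂ * σ (ε₂ * x) - deriv W r - (2 * ε₂ * σ (ε₂ * x) - deriv W s)| ≤
      K * |r - s| := fun x r s => by
    rw [sub_sub_sub_cancel_left, abs_sub_comm]
    exact hlip r s
  have hM : ∀ X : Plane, X 1 = 0 → |u₀ X| ≤ M := fun X hX => hg X hX ▸ h.abs_initial_le (X 0)
  have hM_nonneg := h.nonneg
  have hC_nonneg : 0 ≤ C := (abs_nonneg _).trans (hC 0 0)
  obtain ⟨η, hη, hcompare⟩ := IsApproxSubsolution.exists_forall_le (T := R) hK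
    (by positivity : 0 ≤ (M + (C + 1) * R) + M * (1 + R)) (half_pos hθ)
  obtain ⟨δ, hδ, hshift⟩ := ((h.eventually_isApproxLatticeSolution
    (F := fun x r => 2 * ε₂ * σ (ε₂ * x) - deriv W r) hG hK hF hR
    (half_pos hη)).and (h.eventually_abs_shift_sub_le (half_pos hθ))).exists
  filter_upwards [hδ,
    eventually_isApproxLatticeSolution_of_tendstoUniformly hM hC hWeps hW hu (half_pos hη),
    Ioc_mem_nhdsGT one_pos] with ε hv hu hε i j t ht hnorm
  have hheight : ε * j ≤ R := (le_abs_self _).trans ((PiLp.norm_apply_le _ 1).trans hnorm)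
  have hinitial : (fun i : ℤ => u₀ (latticePoint ε i 0)) = fun i : ℤ => g (ε * i) :=
    funext fun i => (hg _ (by simp [latticePoint])).symm
  rw [hinitial] at hu
  have hsub := hu.isApproxSubsolution_sub hv fun i => hF (ε * i)
  have hsup := hv.isApproxSubsolution_sub hu fun i => hF (ε * i)
  rw [add_halves] at hsub hsup
  rw [add_comm (M * (1 + R))] at hsup
  have hclose : |ueps ε i j t - duhamel g G (ε * i) (ε * j + δ) t| ≤ θ / 2 :=
    abs_sub_le_iff.2 ⟨hcompare ε hε _ hsub i j hheight t ht,
      hcompare ε hε _ hsup i j hheight t ht⟩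
  calc |ueps ε i j t - duhamel g G (ε * i) (ε * j) t| ≤ θ / 2 + θ / 2 :=
        (abs_sub_le _ _ _).trans (add_le_add hclose (hshift (ε * i) (ε * j) t ht))
    _ = θ := add_halves θ

end Convergence

/-! ### The trace of the initial datum -/

section Integrals

variable {E : Type*} [TopologicalSpace E] [MeasurableSpace E] {μ : Measure E} {U : Set E}
  {f φ : E → ℝ}

lemma abs_le_of_ae_abs_le [OpensMeasurableSpace E] [μ.IsOpenPosMeasure] (hU : IsOpen U) {C : ℝ}
    (hf : ContinuousOn f U) (h : ∀ᵐ x ∂μ.restrict U, |f x| ≤ C) : ∀ x ∈ U, |f x| ≤ C := by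
  have hmax : (fun x => max |f x| C) =ᵐ[μ.restrict U] fun _ => C := by
    filter_upwards [h] with x hx using max_eq_right hx
  have heq := Measure.eqOn_open_of_ae_eq hmax hU (hf.abs.sup continuousOn_const) continuousOn_const
  exact fun x hx => max_eq_right_iff.1 (heq hx)

lemma integrable_mul_of_tsupport_subset [OpensMeasurableSpace E] [T2Space E]
    (hf : LocallyIntegrableOn f U μ) (hφ : Continuous φ) (hc : HasCompactSupport φ)
    (hs : tsupport φ ⊆ U) : Integrable (fun x => f x * φ x) μ :=
  (integrableOn_iff_integrable_of_support_subset fun _ hx =>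
    subset_tsupport φ (right_ne_zero_of_mul hx)).1
    ((hf.integrableOn_compact_subset hs hc).mul_continuousOn hφ.continuousOn hc)

lemma setIntegral_mul_of_tsupport_subset (hs : tsupport φ ⊆ U) :
    ∫ x in U, f x * φ x ∂μ = ∫ x, f x * φ x ∂μ :=
  setIntegral_eq_integral_of_forall_compl_eq_zero fun _ hx => by
    rw [image_eq_zero_of_notMem_tsupport fun h => hx (hs h), mul_zero]

end Integrals

lemma integral_mul_fderiv_eq_neg_of_tsupport_subset {E : Type*} [NormedAddCommGroup E]
    [NormedSpace ℝ E] [FiniteDimensional ℝ E] [MeasurableSpace E] [BorelSpace E] {μ : Measure E}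
    [μ.IsAddHaarMeasure] {U : Set E} {f φ : E → ℝ} (hU : IsOpen U) (hf : ContDiffOn ℝ 1 f U)
    (hφ : ContDiff ℝ 1 φ) (hc : HasCompactSupport φ) (hs : tsupport φ ⊆ U) (v : E) :
    ∫ x, f x * fderiv ℝ φ x v ∂μ = -∫ x, fderiv ℝ f x v * φ x ∂μ := by
  have hf_loc : LocallyIntegrableOn f U μ :=
    hf.continuousOn.locallyIntegrableOn hU.measurableSet
  have hf'_loc : LocallyIntegrableOn (fun x => fderiv ℝ f x v) U μ :=
    ((hf.continuousOn_fderiv_of_isOpen hU le_rfl).clm_apply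
      continuousOn_const).locallyIntegrableOn hU.measurableSet
  have hφ' : Continuous fun x => fderiv ℝ φ x v :=
    (hφ.continuous_fderiv one_ne_zero).clm_apply continuous_const
  refine integral_mul_fderiv_eq_neg_fderiv_mul_of_integrable
    (integrable_mul_of_tsupport_subset hf'_loc hφ.continuous hc hs)
    (integrable_mul_of_tsupport_subset hf_loc hφ' (hc.fderiv_apply ℝ v)
      ((tsupport_fderiv_apply_subset ℝ v).trans hs))
    (integrable_mul_of_tsupport_subset hf_loc hφ.continuous hc hs)
    (fun x hx => ?_) fun x _ => hφ.differentiable one_ne_zero x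
  exact (hf.differentiableOn one_ne_zero).differentiableAt (hU.mem_nhds (hs hx))

lemma isOpen_omega : IsOpen Omega :=
  isOpen_lt continuous_const (by fun_prop)

lemma MemLinf.locallyIntegrableOn {f : Plane → ℝ} (hf : MemLinf f) :
    LocallyIntegrableOn f Omega :=
  locallyIntegrableOn_of_locallyIntegrable_restrict (MemLp.locallyIntegrable hf le_top)

lemma IsWeakDeriv.ae_eq_fderiv {k : Fin 2} {f g : Plane → ℝ} (h : IsWeakDeriv k f g)
    (hg : LocallyIntegrableOn g Omega) (hf : ContDiffOn ℝ 1 f Omega) :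
    ∀ᵐ X ∂volume.restrict Omega, g X = fderiv ℝ f X (EuclideanSpace.single k 1) := by
  set v : Plane := EuclideanSpace.single k 1
  have hf' : LocallyIntegrableOn (fun X => fderiv ℝ f X v) Omega :=
    ((hf.continuousOn_fderiv_of_isOpen isOpen_omega le_rfl).clm_apply
      continuousOn_const).locallyIntegrableOn isOpen_omega.measurableSet
  have hzero : ∀ᵐ X, X ∈ Omega → (g - fun X => fderiv ℝ f X v) X = 0 := by
    refine isOpen_omega.ae_eq_zero_of_integral_contDiff_smul_eq_zero (hg.sub hf')
      fun φ hφ hc hs => ?_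
    have hweak : ∫ X, f X * fderiv ℝ φ X v = -∫ X, g X * φ X := by
      have hline : ∀ X, lineDeriv ℝ φ X v = fderiv ℝ φ X v := fun X =>
        (hφ.differentiable (by simp) X).lineDeriv_eq_fderiv
      rw [← setIntegral_mul_of_tsupport_subset ((tsupport_fderiv_apply_subset ℝ v).trans hs),
        ← setIntegral_mul_of_tsupport_subset hs, ← h φ hφ hc hs]
      simp only [v, ← hline]
    have hparts := integral_mul_fderiv_eq_neg_of_tsupport_subset (μ := volume) isOpen_omega hf
      (hφ.of_le (by simp)) hc hs v
    calc ∫ X, φ X • (g - fun X => fderiv ℝ f X v) X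
        = ∫ X, (g X * φ X - fderiv ℝ f X v * φ X) := by
          congr with X
          simp only [Pi.sub_apply, smul_eq_mul]
          ring
      _ = (∫ X, g X * φ X) - ∫ X, fderiv ℝ f X v * φ X :=
          integral_sub (integrable_mul_of_tsupport_subset hg hφ.continuous hc hs)
            (integrable_mul_of_tsupport_subset hf' hφ.continuous hc hs)
      _ = 0 := by linarith
  rw [ae_restrict_iff' isOpen_omega.measurableSet]
  filter_upwards [hzero] with X hX hXΩ using sub_eq_zero.1 (hX hXΩ)

namespace MemW2inf

variable {u₀ : Plane → ℝ}

lemma exists_abs_le (hu₀ : MemW2inf u₀) : ∃ M, ∀ X ∈ Omega, |u₀ X| ≤ M :=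
  have hcont : ContinuousOn u₀ Omega := hu₀.1.mono fun X (hX : 0 < X 1) => hX.le
  ⟨_, abs_le_of_ae_abs_le isOpen_omega hcont (ae_le_lpNorm_exponent_top hu₀.2.1)⟩

lemma exists_abs_fderiv_le (hu₀ : MemW2inf u₀) (hd : ContDiffOn ℝ 1 u₀ Omega) (k : Fin 2) :
    ∃ L, ∀ X ∈ Omega, |fderiv ℝ u₀ X (EuclideanSpace.single k 1)| ≤ L := by
  obtain ⟨g, ⟨hg, -⟩, hweak⟩ := hu₀.2.2 k
  have hcont : ContinuousOn (fun X => fderiv ℝ u₀ X (EuclideanSpace.single k 1)) Omega :=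
    (hd.continuousOn_fderiv_of_isOpen isOpen_omega le_rfl).clm_apply continuousOn_const
  refine ⟨lpNorm g ⊤ (volume.restrict Omega),
    abs_le_of_ae_abs_le (μ := volume) isOpen_omega hcont ?_⟩
  filter_upwards [ae_le_lpNorm_exponent_top hg,
    hweak.ae_eq_fderiv hg.locallyIntegrableOn hd] with X hX hgX
  rwa [← hgX]

lemma exists_lipschitzWith_horizontal (hu₀ : MemW2inf u₀) (hd : ContDiffOn ℝ 1 u₀ Omega) :
    ∃ K, ∀ s > 0, LipschitzWith K fun x => u₀ !₂[x, s] := by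
  obtain ⟨L, hL⟩ := hu₀.exists_abs_fderiv_le hd 0
  have hderiv : ∀ s > 0, ∀ x, HasDerivAt (fun x => u₀ !₂[x, s]) (fderiv ℝ u₀ !₂[x, s] unitX) x :=
    fun s hs x => by
      have hline : HasDerivAt (fun x : ℝ => (!₂[x, s] : Plane)) unitX x := by
        have heq : (fun x : ℝ => (!₂[x, s] : Plane)) = fun x => x • unitX + s • unitY := by
          ext x i
          fin_cases i <;> simp
        simpa [heq] using ((hasDerivAt_id x).smul_const unitX).add_const (s • unitY)
      have hdiff : DifferentiableAt ℝ u₀ !₂[x, s] :=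
        (hd.differentiableOn one_ne_zero).differentiableAt (isOpen_omega.mem_nhds hs)
      exact hdiff.hasFDerivAt.comp_hasDerivAt x hline
  refine ⟨L.toNNReal, fun s hs => lipschitzWith_of_nnnorm_deriv_le
    (fun x => (hderiv s hs x).differentiableAt) fun x => ?_⟩
  rw [(hderiv s hs x).deriv]
  exact NNReal.coe_le_coe.1 ((hL !₂[x, s] hs).trans L.le_coe_toNNReal)

lemma isBoundedLipschitz_trace (hu₀ : MemW2inf u₀) (hd : ContDiffOn ℝ 1 u₀ Omega) :
    IsBoundedLipschitz fun x => u₀ !₂[x, 0] := by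
  have hlim : ∀ x, Tendsto (fun s : ℝ => u₀ !₂[x, s]) (𝓝[>] 0) (𝓝 (u₀ !₂[x, 0])) := fun x => by
    have hcont : Continuous fun s : ℝ => (!₂[x, s] : Plane) := by fun_prop
    refine (hu₀.1 !₂[x, 0] (le_refl (0 : ℝ))).tendsto.comp (tendsto_nhdsWithin_iff.2
      ⟨(hcont.tendsto 0).mono_left nhdsWithin_le_nhds, ?_⟩)
    filter_upwards [self_mem_nhdsWithin] with s hs using (mem_Ioi.1 hs).le
  constructor
  · obtain ⟨M, hM⟩ := hu₀.exists_abs_le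
    refine ⟨M, fun x => le_of_tendsto (hlim x).abs ?_⟩
    filter_upwards [self_mem_nhdsWithin] with s hs using hM !₂[x, s] hs
  · obtain ⟨K, hK⟩ := hu₀.exists_lipschitzWith_horizontal hd
    refine ⟨K, LipschitzWith.of_dist_le_mul fun x y =>
      le_of_tendsto ((hlim x).dist (hlim y)) ?_⟩
    filter_upwards [self_mem_nhdsWithin] with s hs using (hK s hs).dist_le_mul x y

end MemW2inf

end FKPN

open FKPN in
theorem theorem1_general {σ : ℝ → ℝ} (hσ : IsBoundedLipschitz σ) (ε₂ : ℝ) {u₀ : Plane → ℝ}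
    (hu₀ : IsBoundedLipschitz fun x => u₀ !₂[x, 0]) :
    (∀ ε > 0, ∀ Weps : ℝ → ℝ, IsLipschitzPotential Weps →
      ∃ u : ℤ → ℕ → ℝ → ℝ, IsLatticeSolution ε ε₂ σ Weps u₀ u ∧
        ∀ v : ℤ → ℕ → ℝ → ℝ, IsLatticeSolution ε ε₂ σ Weps u₀ v →
          ∀ i j, ∀ t ≥ 0, v i j t = u i j t) ∧
    (∀ (Weps : ℝ → ℝ → ℝ) (W : ℝ → ℝ),
      (∀ᶠ ε in 𝓝[>] (0 : ℝ), ContDiff ℝ 1 (Weps ε)) → IsLipschitzPotential W →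
      TendstoUniformly (fun ε => deriv (Weps ε)) (deriv W) (𝓝[>] 0) →
      ∀ ueps : ℝ → ℤ → ℕ → ℝ → ℝ,
        (∀ᶠ ε in 𝓝[>] (0 : ℝ), IsLatticeSolution ε ε₂ σ (Weps ε) u₀ (ueps ε)) →
        ∃ u : Plane → ℝ → ℝ, IsPNSolution ε₂ σ W u₀ u ∧
          LatticeTendstoLocallyUniformly ueps u) := by
  refine ⟨fun ε hε Weps hW => ?_, fun Weps W hWeps hW hlim ueps hu => ?_⟩
  · obtain ⟨M, hM⟩ := hu₀.bounded
    obtain ⟨u, hu⟩ := exists_isLatticeSolution (ε₂ := ε₂) hε hσ.bounded hW.deriv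
      ⟨M, fun i => by simpa [latticePoint] using hM (ε * i)⟩
    exact ⟨u, hu, fun v hv i j t ht =>
      le_antisymm (hv.le hε hW.deriv hu i j ht) (hu.le hε hW.deriv hv i j ht)⟩
  · obtain ⟨K, C, hK, hC⟩ := exists_lipschitzWith_force hσ hW.deriv ε₂
    obtain ⟨G, M, hGM, hG⟩ := exists_isDuhamelData hu₀ hK hC
    have hg : ∀ X : Plane, X 1 = 0 → u₀ !₂[X 0, 0] = u₀ X := fun X hX => by
      congr 1
      ext i
      fin_cases i <;> simp [hX]
    have hWeps' : ∀ᶠ ε in 𝓝[>] (0 : ℝ), Continuous (deriv (Weps ε)) :=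
      hWeps.mono fun ε h => h.continuous_deriv le_rfl
    exact ⟨_, hGM.isPNSolution hg hG, hGM.latticeTendstoLocallyUniformly hg hG hW.deriv
      (fun x r => hC (x, r)) hWeps' hlim hu⟩

theorem theorem1 (σ : ℝ → ℝ) (hσ : FKPN.AdmissibleStress σ) (ε₂ : ℝ) (hε₂ : 0 < ε₂)
    (u₀ : FKPN.Plane → ℝ) (hu₀ : FKPN.MemW2inf u₀)
    (hu₀_harm : InnerProductSpace.HarmonicOnNhd u₀ FKPN.Omega) :
    (∀ ε > 0, ∀ Weps : ℝ → ℝ, FKPN.LocallyHarmonicPotential (fun a => ε * Weps a) →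
      ∃ u : ℤ → ℕ → ℝ → ℝ, FKPN.IsLatticeSolution ε ε₂ σ Weps u₀ u ∧
        ∀ v : ℤ → ℕ → ℝ → ℝ, FKPN.IsLatticeSolution ε ε₂ σ Weps u₀ v →
          ∀ i j, ∀ t ≥ 0, v i j t = u i j t) ∧
    (∀ (Weps : ℝ → ℝ → ℝ) (W : ℝ → ℝ),
      (∀ᶠ ε in 𝓝[>] (0 : ℝ), FKPN.LocallyHarmonicPotential (fun a => ε * Weps ε a)) →
      FKPN.NondegeneratePotential W → FKPN.TendstoC1 Weps W →
      ∀ ueps : ℝ → ℤ → ℕ → ℝ → ℝ,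
        (∀ᶠ ε in 𝓝[>] (0 : ℝ), FKPN.IsLatticeSolution ε ε₂ σ (Weps ε) u₀ (ueps ε)) →
        ∃ u : FKPN.Plane → ℝ → ℝ, FKPN.IsPNSolution ε₂ σ W u₀ u ∧
          FKPN.LatticeTendstoLocallyUniformly ueps u) := by
  obtain ⟨hex, hconv⟩ := theorem1_general hσ.isBoundedLipschitz ε₂
    (hu₀.isBoundedLipschitz_trace (hu₀_harm.contDiffOn.of_le one_le_two))
  exact ⟨fun ε hε Weps hW => hex ε hε Weps (hW.isLipschitzPotential_of_const_mul hε.ne'),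
    fun Weps W hWeps hW hlim => hconv Weps W
      ((hWeps.and self_mem_nhdsWithin).mono fun ε h =>
        (h.1.isLipschitzPotential_of_const_mul (ne_of_gt h.2)).contDiff)
      hW.1.isLipschitzPotential hlim.2⟩
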